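/- **Setting.** Let $(\mathsf X,\mathcal X)$ be a measurable space with countably generated $\sigma$-field, $(\Theta,\mathcal T)$ a measurable space, and $\{P_\theta,\theta\in\Theta\}$ Markov kernels on $\mathsf X$ such that $(\theta,x)\mapsto P_\theta(x,A)$ is measurable for every $A\in\mathcal X$. Let $\pi$ be a probability measure on $\mathsf X$ that is invariant for every $P_\theta$, and $\bar\mu$ a probability measure on $\mathsf X\times\Theta$. Let $\{(X_n,\theta_n),n\ge0\}$ be an $\mathsf X\times\Theta$-valued process with natural filtration $\{\mathcal F_n\}$, $(X_0,\theta_0)\sim\bar\mu$ and $\mathbb E(f(X_{n+1})\mid\mathcal F_n)=P_{\theta_n}f(X_n)$ a.s. for all $n\ge0$ and all measurable $f\ge0$. For $W:\mathsf X\to[1,\infty)$ put $|f|_W=\sup|f|/W$, let $\mathcal L_W$ be the set of measurable $f:\mathsf X\to\mathbb R$ with $|f|_W<\infty$, and put $\|\mu\|_W=\sup_{|g|_W\le1}|\mu(g)|$ for signed measures $\mu$ (the supremum being over measurable $g$). **A1.** Every $P_\theta$ is phi-irreducible and aperiodic. There is a measurable $V:\mathsf X\to[1,\infty)$ with $\int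 V(x)\,\bar\mu(dx,d\theta)<\infty$ such that for every $\beta\in(0,1]$ there are $\rho\in(0,1)$, $C\in(0,\infty)$ with $\|P_\theta^n(x,\cdot)-\pi\|_{V^\beta}\le C\rho^nV^\beta(x)$ for all $n\ge0$, $x\in\mathsf X$, $\theta\in\Theta$; and there are $c\in(0,\infty)$, $\lambda\in(0,1)$ with $P_\theta V(x)\le\lambda V(x)+c$ for all $x,\theta$. **A2.** There are $\eta\in[0,1/2)$, $\alpha>1/2$ and a nonincreasing sequence of positive numbers $\{\gamma_n,n\ge1\}$, $\gamma_n=O(n^{-\alpha})$, such that for every $\beta\in[0,1]$ there is a finite $C$ with $D_\beta(\theta_{n-1},\theta_n)\le C\gamma_nV^\eta(X_n)$ a.s. for all $n\ge1$, where $D_\beta(\theta,\theta')=\sup_{|f|_{V^\beta}\le1}\sup_x|P_\theta f(x)-P_{\theta'}f(x)|/V^\beta(x)$, the first supremum being over measurable $f$. **A3.** $w:\mathbb R\to\mathbb R$ satisfies $w(x)=0$ for $|x|\ge1$, $w(-x)=w(x)$, $w(0)=1$, and its restriction to $[0,1]$ is twice continuously differentiable. Let $\{b_n,n\ge1\}$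 be a nonincreasing sequence of positive numbers with $b_n^{-1}=O(n^{1/2})$ and $|b_n-b_{n-1}|=O(b_nn^{-1})$ as $n\to\infty$. For $h:\mathsf X\to\mathbb R$ put $\pi_n(h)=n^{-1}\sum_{k=1}^nh(X_k)$; let $\gamma_n(k)=n^{-1}\sum_{j=1}^{n-k}(h(X_j)-\pi_n(h))(h(X_{j+k})-\pi_n(h))$ for $0\le k<n$, $\gamma_n(-k)=\gamma_n(k)$, and $\gamma_n(k)=0$ for $|k|\ge n$; and let $\Gamma_n^2(h)=\sum_{k=-n}^nw(kb_n)\gamma_n(k)$. With $\bar P_\theta f=P_\theta f-\pi(f)$, put $g_\theta=\sum_{j\ge0}\bar P_\theta^jh$ and $G_\theta(x,y)=g_\theta(y)-P_\theta g_\theta(x)$. **Theorem.** Assume A1–A3, let $\beta\in(0,1/2-\eta)$ with $\eta$ as in A2, and let $h\in\mathcal L_{V^\beta}$. Then there are real random variables $Q_n,D_n,\epsilon_n$, $n\ge1$, with $$\Gamma_n^2(h)=\frac1n\sum_{k=1}^nG_{\theta_{k-1}}^2(X_{k-1},X_k)+Q_n+D_n+\epsilon_n,\qquad n\ge1,$$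 such that for every $p>1$ with $2p(\beta+\eta)\le1$ there is a finite constant $C$ such that, for all $n\ge1$, $$\mathbb E(|Q_n|^p)\le C\bigl(b_n+n^{-\alpha}b_n^{-1+\alpha}+n^{-1+(1/2)\vee(1/p)}b_n^{-1/2}\bigr)^p,$$ $$\mathbb E(|D_n|^p)\le Cb_n^p,\qquad \mathbb E(|\epsilon_n|^p)\le C(n^{-1}b_n^{-1})^p.$$ In particular, for any such $p$, if $b_n\to0$ and $n^{-1+(1/2)\vee(1/p)}b_n^{-1/2}\to0$ as $n\to\infty$, then $\Gamma_n^2(h)-\frac1n\sum_{k=1}^nG_{\theta_{k-1}}^2(X_{k-1},X_k)$ converges to $0$ in $L^p$. -/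

import Mathlib

open MeasureTheory ProbabilityTheory Filter Topology
open scoped ENNReal

noncomputable section

namespace AdaptiveMC

/-- The weighted supremum norm `|f|_W = sup_x |f x| / W x`, with values in `[0, ∞]`. -/
def wNorm {𝕏 : Type*} (W f : 𝕏 → ℝ) : ℝ≥0∞ :=
  ⨆ x, ENNReal.ofReal (|f x| / W x)

/-- `f` belongs to the class `𝓛_W` of measurable functions with finite `W`-norm. -/
def MemLW {𝕏 : Type*} [MeasurableSpace 𝕏] (W f : 𝕏 → ℝ) : Prop :=
  Measurable f ∧ wNorm W f < ∞

/-- The `W`-norm `‖μ - ν‖_W = sup {|μ(g) - ν(g)| : g measurable, |g|_W ≤ 1}`.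
It is only used for measures that integrate `W`. -/
def wDist {𝕏 : Type*} [MeasurableSpace 𝕏] (W : 𝕏 → ℝ) (μ ν : Measure 𝕏) : ℝ≥0∞ :=
  ⨆ (g : 𝕏 → ℝ) (_ : Measurable g) (_ : wNorm W g ≤ 1),
    ENNReal.ofReal |∫ y, g y ∂μ - ∫ y, g y ∂ν|

/-- The pseudo-metric
`D_β(θ, θ') = sup_{|f|_{V^β} ≤ 1} sup_x |P_θ f(x) - P_θ' f(x)| / V^β(x)`. -/
def kernelDist {𝕏 Θ : Type*} [MeasurableSpace 𝕏] (P : Θ → Kernel 𝕏 𝕏) (V : 𝕏 → ℝ) (β : ℝ)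
    (s t : Θ) : ℝ≥0∞ :=
  ⨆ (f : 𝕏 → ℝ) (_ : Measurable f) (_ : wNorm (fun x => V x ^ β) f ≤ 1),
    wNorm (fun x => V x ^ β) (fun x => ∫ y, f y ∂(P s x) - ∫ y, f y ∂(P t x))

/-- The kernel `κ` is phi-irreducible: it is irreducible with respect to some nonzero
σ-finite measure. -/
def PhiIrreducible {𝕏 : Type*} [MeasurableSpace 𝕏] (κ : Kernel 𝕏 𝕏) : Prop :=
  ∃ φ : Measure 𝕏, SigmaFinite φ ∧ φ ≠ 0 ∧ Kernel.IsIrreducible φ κ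

/-- The kernel `κ` with invariant distribution `π` is aperiodic: there are no `d ≥ 2` and pairwise
disjoint measurable sets `S 0, …, S (d - 1)` of positive `π`-measure through which the chain moves
cyclically. -/
def Aperiodic {𝕏 : Type*} [MeasurableSpace 𝕏] (κ : Kernel 𝕏 𝕏) (π : Measure 𝕏) : Prop :=
  ¬ ∃ (d : ℕ) (S : ℕ → Set 𝕏), 2 ≤ d ∧
      (∀ i < d, MeasurableSet (S i)) ∧
      (∀ i < d, ∀ j < d, i ≠ j → Disjoint (S i) (S j)) ∧
      (∀ i < d, 0 < π (S i)) ∧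
      (∀ i < d, ∀ x ∈ S i, κ x (S ((i + 1) % d)) = 1)

/-- The natural filtration `𝓕_n = σ((X_k, θ_k), k ≤ n)`. -/
@[reducible] def history {Ω 𝕏 Θ : Type*} [MeasurableSpace 𝕏] [MeasurableSpace Θ]
    (X : ℕ → Ω → 𝕏) (θ : ℕ → Ω → Θ) (n : ℕ) : MeasurableSpace Ω :=
  ⨆ (k : ℕ) (_ : k ≤ n), MeasurableSpace.comap (fun ω => (X k ω, θ k ω)) inferInstance

/-- `(X_n, θ_n)` is a process with initial law `μ₀` such that, for every nonnegative measurable `f`,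
`E(f(X_{n+1}) | 𝓕_n) = P_{θ_n} f(X_n)` almost surely; `(X_n)` is then an adaptive Markov chain.
The law of `θ_{n+1}` given `𝓕_n` and `X_{n+1}` is left unspecified. -/
structure IsAdaptiveChain {Ω 𝕏 Θ : Type*} [MeasurableSpace Ω] [MeasurableSpace 𝕏]
    [MeasurableSpace Θ] (Pr : Measure Ω) (P : Θ → Kernel 𝕏 𝕏) (μ₀ : Measure (𝕏 × Θ))
    (X : ℕ → Ω → 𝕏) (θ : ℕ → Ω → Θ) : Prop where
  measurable_X : ∀ n, Measurable (X n)
  measurable_θ : ∀ n, Measurable (θ n)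
  initial : Pr.map (fun ω => (X 0 ω, θ 0 ω)) = μ₀
  markov : ∀ (n : ℕ) (f : 𝕏 → ℝ≥0∞), Measurable f →
    Pr⁻[fun ω => f (X (n + 1) ω) | history X θ n] =ᵐ[Pr]
      fun ω => ∫⁻ y, f y ∂(P (θ n ω) (X n ω))

/-- Uniform geometric ergodicity with a drift function `V ≥ 1`: every `P_θ` is phi-irreducible and
aperiodic with invariant distribution `π`, `V(X_0)` has finite mean, and `V` satisfies the
`V^β`-rates of convergence for all `β ∈ (0, 1]` and the drift condition `P_θ V ≤ λ V + c`, all of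
them uniformly in `θ`. By the drift condition `V` is integrable under `π` and under all `P_θ^n(x, ·)`,
so that the integrals inside `wDist` are proper ones. -/
structure GeomErgodic {𝕏 Θ : Type*} [MeasurableSpace 𝕏] [MeasurableSpace Θ]
    (P : Θ → Kernel 𝕏 𝕏) (π : Measure 𝕏) (μ₀ : Measure (𝕏 × Θ)) (V : 𝕏 → ℝ) : Prop where
  invariant : ∀ t, Kernel.Invariant (P t) π
  irreducible : ∀ t, PhiIrreducible (P t)
  aperiodic : ∀ t, Aperiodic (P t) π
  measurable_V : Measurable V
  one_le_V : ∀ x, 1 ≤ V x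
  initial_moment : ∫⁻ z, ENNReal.ofReal (V z.1) ∂μ₀ < ∞
  rate : ∀ β : ℝ, 0 < β → β ≤ 1 → ∃ ρ C : ℝ, 0 < ρ ∧ ρ < 1 ∧ 0 < C ∧
    ∀ (x : 𝕏) (t : Θ) (n : ℕ),
      wDist (fun y => V y ^ β) ((P t ^ n) x) π ≤ ENNReal.ofReal (C * ρ ^ n * V x ^ β)
  drift : ∃ c lam : ℝ, 0 < c ∧ 0 < lam ∧ lam < 1 ∧ ∀ (x : 𝕏) (t : Θ),
    ∫⁻ y, ENNReal.ofReal (V y) ∂(P t x) ≤ ENNReal.ofReal (lam * V x + c)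

/-- Diminishing adaptation with exponents `η ∈ [0, 1/2)` and `α > 1/2`: there is a nonincreasing
sequence of positive numbers `γ_n = O(n^{-α})`, `n ≥ 1`, such that for every `β ∈ [0, 1]`,
`D_β(θ_{n-1}, θ_n) ≤ C γ_n V^η(X_n)` almost surely, for all `n ≥ 1`. -/
structure Diminishing {Ω 𝕏 Θ : Type*} [MeasurableSpace Ω] [MeasurableSpace 𝕏]
    (Pr : Measure Ω) (P : Θ → Kernel 𝕏 𝕏) (V : 𝕏 → ℝ) (X : ℕ → Ω → 𝕏) (θ : ℕ → Ω → Θ)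
    (η α : ℝ) : Prop where
  η_nonneg : 0 ≤ η
  η_lt : η < 1 / 2
  lt_α : 1 / 2 < α
  bound : ∃ γ : ℕ → ℝ, (∀ n, 1 ≤ n → 0 < γ n) ∧ AntitoneOn γ (Set.Ici 1) ∧
    γ =O[atTop] (fun n : ℕ => (n : ℝ) ^ (-α)) ∧
    ∀ β : ℝ, 0 ≤ β → β ≤ 1 → ∃ C : ℝ, ∀ n : ℕ, 1 ≤ n → ∀ᵐ ω ∂Pr,
      kernelDist P V β (θ (n - 1) ω) (θ n ω) ≤ ENNReal.ofReal (C * γ n * V (X n ω) ^ η)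

/-- A truncated kernel function: it is even, equals `1` at `0`, vanishes for `|x| ≥ 1`, and its
restriction to `[0, 1]` is twice continuously differentiable. -/
structure IsLagWindow (w : ℝ → ℝ) : Prop where
  support : ∀ x, 1 ≤ |x| → w x = 0
  even : ∀ x, w (-x) = w x
  zero : w 0 = 1
  smooth : ContDiffOn ℝ 2 w (Set.Icc 0 1)

/-- A bandwidth sequence `b_n`, `n ≥ 1`: positive, nonincreasing, with `1/b_n = O(n^{1/2})` and
`|b_n - b_{n-1}| = O(b_n / n)`. -/
structure IsBandwidth (b : ℕ → ℝ) : Prop where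
  pos : ∀ n, 1 ≤ n → 0 < b n
  antitone : AntitoneOn b (Set.Ici 1)
  inv_bigO : (fun n => (b n)⁻¹) =O[atTop] (fun n : ℕ => (n : ℝ) ^ (1 / 2 : ℝ))
  diff_bigO : (fun n => |b n - b (n - 1)|) =O[atTop] (fun n : ℕ => b n * (n : ℝ)⁻¹)

/-- The operator `P̄ = κ - π`, `P̄ f(x) = κ f(x) - π(f)`. -/
def centred {𝕏 : Type*} [MeasurableSpace 𝕏] (κ : Kernel 𝕏 𝕏) (π : Measure 𝕏) (f : 𝕏 → ℝ) :
    𝕏 → ℝ :=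
  fun x => ∫ y, f y ∂(κ x) - ∫ y, f y ∂π

/-- The resolvent function `g(x) = ∑_{j ≥ 0} P̄^j h(x)`. -/
def resolvent {𝕏 : Type*} [MeasurableSpace 𝕏] (κ : Kernel 𝕏 𝕏) (π : Measure 𝕏) (h : 𝕏 → ℝ) :
    𝕏 → ℝ :=
  fun x => ∑' j : ℕ, (centred κ π)^[j] h x

/-- `G(x, y) = g(y) - κ g(x)`, where `g` is the resolvent function of `h`. -/
def martDiff {𝕏 : Type*} [MeasurableSpace 𝕏] (κ : Kernel 𝕏 𝕏) (π : Measure 𝕏) (h : 𝕏 → ℝ)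
    (x y : 𝕏) : ℝ :=
  resolvent κ π h y - ∫ z, resolvent κ π h z ∂(κ x)

/-- The average `n⁻¹ ∑_{k=1}^n G²_{θ_{k-1}}(X_{k-1}, X_k)`. -/
def avgSqVar {Ω 𝕏 Θ : Type*} [MeasurableSpace 𝕏] (P : Θ → Kernel 𝕏 𝕏) (π : Measure 𝕏)
    (h : 𝕏 → ℝ) (X : ℕ → Ω → 𝕏) (θ : ℕ → Ω → Θ) (n : ℕ) (ω : Ω) : ℝ :=
  (n : ℝ)⁻¹ * ∑ k ∈ Finset.Icc 1 n,
    martDiff (P (θ (k - 1) ω)) π h (X (k - 1) ω) (X k ω) ^ 2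

/-- The sample mean `π_n(h) = n⁻¹ ∑_{k=1}^n h(X_k)`. -/
def sampleMean {Ω 𝕏 : Type*} (h : 𝕏 → ℝ) (X : ℕ → Ω → 𝕏) (n : ℕ) (ω : Ω) : ℝ :=
  (n : ℝ)⁻¹ * ∑ k ∈ Finset.Icc 1 n, h (X k ω)

/-- The sample autocovariance `γ_n(k)`, `k ∈ ℤ`: it is even in `k`, zero for `|k| ≥ n`, and
`γ_n(k) = n⁻¹ ∑_{j=1}^{n-k} (h(X_j) - π_n(h)) (h(X_{j+k}) - π_n(h))` for `0 ≤ k < n`. -/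
def sampleAutocov {Ω 𝕏 : Type*} (h : 𝕏 → ℝ) (X : ℕ → Ω → 𝕏) (n : ℕ) (k : ℤ) (ω : Ω) : ℝ :=
  if k.natAbs < n then
    (n : ℝ)⁻¹ * ∑ j ∈ Finset.Icc 1 (n - k.natAbs),
      (h (X j ω) - sampleMean h X n ω) * (h (X (j + k.natAbs) ω) - sampleMean h X n ω)
  else 0

/-- The kernel estimator `Γ²_n(h) = ∑_{k=-n}^n w(k b_n) γ_n(k)`. -/
def kernelEstimator {Ω 𝕏 : Type*} (w : ℝ → ℝ) (b : ℕ → ℝ) (h : 𝕏 → ℝ) (X : ℕ → Ω → 𝕏)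
    (n : ℕ) (ω : Ω) : ℝ :=
  ∑ k ∈ Finset.Icc (-(n : ℤ)) (n : ℤ), w ((k : ℝ) * b n) * sampleAutocov h X n k ω

end AdaptiveMC

end

noncomputable section

namespace AdaptiveMC

/-! Put `f = h - π(h)`. By uniform geometric ergodicity the series `g_θ = ∑ P̄_θ^j f` converges in
`V^β`-norm and solves the Poisson equation `g_θ - P_θ g_θ = f`; starting from `h` instead of `f`
only adds the constant `π(h)`, which cancels in `G_θ`. With `y i = f(X_{i+1})`, `D i = G_{θ_i}(X_i,
X_{i+1})` and `u i = P_{θ_i} g_{θ_i}(X_i)` this gives `y i = D i + u i - u (i+1) + r i`. Here `D i`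
is a martingale difference and `r i = g_{θ_{i+1}}(X_{i+1}) - g_{θ_i}(X_{i+1})` measures the
adaptation. As `θ ↦ g_θ` is Lipschitz for `D_β` (`IsLipschitzField.resolvent`), A2 bounds `r i` by a
multiple of `i^{-1/2} V^{β+η}(X_{i+1})`. The drift condition bounds `E V(X_n)`, so `2p(β+η) ≤ 1`
places everything in `L^{2p}` (`martApprox_of_poisson`), and products of two such variables in
`L^p`.

Apart from the centring at the sample mean, `n Γ_n²` equals `∑ y i² + 2 ∑ S i y i`, where `S i =
∑_{j<i} c (i-j) y j` and `c k = w(k b_n)` (`kernelEstimator_eq`). About `N ≈ 1/b_n` lags are active,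
so `S i` has size `√N` in `L^{2p}` (`MartApprox.lagSum_bound`). Substituting for the factor `y i`
and summing by parts produces: - a martingale transform `∑ S i D i` of order `n^{(1/2)∨(1/p)} √N`
and a remainder `∑ S i r i` of order `√n √N`; - `c 1 ∑ y i u (i+1)`, of order `n`. With weight `1`
in place of `c 1` it would cancel `∑ (y i² - D i²)` up to smaller terms (`sum_sq_add_two_mul`), so
only the bias `2 (c 1 - 1) ∑ y i u (i+1)` survives, of order `n b_n`. This is `n D_n`; - a sum of
the same type with weights `c (k+1) - c k` and second factor `u (i+1)`. That factor is again a
`π`-centred Lipschitz function of the chain, hence has its own martingale approximation, and the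
expansion is repeated. The weights are now second differences, with total variation `O(b_n)`, so a
crude bound gives `n b_n` (`quadratic_form_bound`).

Centring costs `O(1/n)` for each lag, as partial sums are `O(√n)` in `L^{2p}`; this gives `ε_n =
O(1/(n b_n))` (`centringError_bound`). -/

/-- `Z` has an `L^q`-norm of at most the real number `K`. -/
structure LpBound {Ω : Type*} {m0 : MeasurableSpace Ω} (μ : Measure Ω) (q : ℝ) (Z : Ω → ℝ)
    (K : ℝ) : Prop where
  meas : AEStronglyMeasurable Z μ
  nonneg : 0 ≤ K
  le : eLpNorm Z (ENNReal.ofReal q) μ ≤ ENNReal.ofReal K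

/-! ### Calculus of quantitative `L^q` bounds -/

section LpBound

variable {Ω : Type*} {m0 : MeasurableSpace Ω} {μ : Measure Ω} {q p : ℝ} {Z Z' : Ω → ℝ} {K K' : ℝ}

lemma eLpNorm_le_ofReal_iff (hq : 0 < q) (hK : 0 ≤ K) :
    eLpNorm Z (ENNReal.ofReal q) μ ≤ ENNReal.ofReal K ↔
      ∫⁻ ω, ENNReal.ofReal (|Z ω| ^ q) ∂μ ≤ ENNReal.ofReal (K ^ q) := by
  rw [eLpNorm_eq_lintegral_rpow_enorm_toReal (by simpa using hq) ENNReal.ofReal_ne_top,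
    ENNReal.toReal_ofReal hq.le, one_div, ENNReal.rpow_inv_le_iff hq,
    ENNReal.ofReal_rpow_of_nonneg hK hq.le]
  have : ∀ ω, ‖Z ω‖ₑ ^ q = ENNReal.ofReal (|Z ω| ^ q) := fun ω => by
    rw [Real.enorm_eq_ofReal_abs, ENNReal.ofReal_rpow_of_nonneg (abs_nonneg _) hq.le]
  simp_rw [this]

lemma LpBound.lintegral_le (h : LpBound μ q Z K) (hq : 0 < q) :
    ∫⁻ ω, ENNReal.ofReal (|Z ω| ^ q) ∂μ ≤ ENNReal.ofReal (K ^ q) :=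
  (eLpNorm_le_ofReal_iff hq h.nonneg).1 h.le

lemma LpBound.memLp (h : LpBound μ q Z K) : MemLp Z (ENNReal.ofReal q) μ :=
  ⟨h.meas, h.le.trans_lt ENNReal.ofReal_lt_top⟩

lemma LpBound.aemeasurable_rpow (h : AEStronglyMeasurable Z μ) :
    AEStronglyMeasurable (fun ω => |Z ω| ^ q) μ :=
  (h.aemeasurable.abs.pow_const q).aestronglyMeasurable

lemma LpBound.integrable_rpow (h : LpBound μ q Z K) (hq : 0 < q) :
    Integrable (fun ω => |Z ω| ^ q) μ := by
  refine ⟨LpBound.aemeasurable_rpow h.meas, ?_⟩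
  rw [hasFiniteIntegral_iff_ofReal (ae_of_all _ fun ω => by positivity)]
  exact (h.lintegral_le hq).trans_lt ENNReal.ofReal_lt_top

lemma LpBound.integral_rpow_le (h : LpBound μ q Z K) (hq : 0 < q) :
    ∫ ω, |Z ω| ^ q ∂μ ≤ K ^ q := by
  have := h.lintegral_le hq
  rw [← ofReal_integral_eq_lintegral_ofReal (h.integrable_rpow hq)
    (ae_of_all _ fun ω => by positivity)] at this
  exact (ENNReal.ofReal_le_ofReal_iff (Real.rpow_nonneg h.nonneg _)).1 this

lemma LpBound.of_lintegral (hZ : AEStronglyMeasurable Z μ) (hq : 0 < q) (hK : 0 ≤ K)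
    (h : ∫⁻ ω, ENNReal.ofReal (|Z ω| ^ q) ∂μ ≤ ENNReal.ofReal (K ^ q)) : LpBound μ q Z K :=
  ⟨hZ, hK, (eLpNorm_le_ofReal_iff hq hK).2 h⟩

lemma LpBound.of_integral (hZ : AEStronglyMeasurable Z μ) (hq : 0 < q) (hK : 0 ≤ K)
    (hi : Integrable (fun ω => |Z ω| ^ q) μ) (h : ∫ ω, |Z ω| ^ q ∂μ ≤ K ^ q) :
    LpBound μ q Z K := by
  refine .of_lintegral hZ hq hK ?_
  rw [← ofReal_integral_eq_lintegral_ofReal hi (ae_of_all _ fun ω => by positivity)]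
  exact ENNReal.ofReal_le_ofReal h

lemma LpBound.mono (h : LpBound μ q Z K) (hK : K ≤ K') : LpBound μ q Z K' :=
  ⟨h.meas, h.nonneg.trans hK, h.le.trans (ENNReal.ofReal_le_ofReal hK)⟩

lemma LpBound.mono_ae (h : LpBound μ q Z K) (hZ' : AEStronglyMeasurable Z' μ)
    (hle : ∀ᵐ ω ∂μ, |Z' ω| ≤ |Z ω|) : LpBound μ q Z' K :=
  ⟨hZ', h.nonneg, (eLpNorm_mono_ae (by simpa using hle)).trans h.le⟩

lemma LpBound.add (hq : 1 ≤ q) (h : LpBound μ q Z K) (h' : LpBound μ q Z' K') :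
    LpBound μ q (fun ω => Z ω + Z' ω) (K + K') := by
  refine ⟨h.meas.add h'.meas, add_nonneg h.nonneg h'.nonneg, ?_⟩
  rw [ENNReal.ofReal_add h.nonneg h'.nonneg]
  exact (eLpNorm_add_le h.meas h'.meas (by simpa using hq)).trans (add_le_add h.le h'.le)

lemma LpBound.const_mul (c : ℝ) (h : LpBound μ q Z K) :
    LpBound μ q (fun ω => c * Z ω) (|c| * K) := by
  refine ⟨h.meas.const_mul c, mul_nonneg (abs_nonneg c) h.nonneg, ?_⟩
  rw [ENNReal.ofReal_mul (abs_nonneg c)]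
  refine (eLpNorm_const_smul_le (c := c) (f := Z)).trans ?_
  rw [Real.enorm_eq_ofReal_abs]
  exact mul_le_mul_right h.le _

lemma LpBound.neg (h : LpBound μ q Z K) : LpBound μ q (fun ω => -Z ω) K :=
  h.mono_ae h.meas.neg (ae_of_all _ fun ω => by simp)

lemma LpBound.sub (hq : 1 ≤ q) (h : LpBound μ q Z K) (h' : LpBound μ q Z' K') :
    LpBound μ q (fun ω => Z ω - Z' ω) (K + K') := by
  simpa only [sub_eq_add_neg] using h.add hq h'.neg

lemma LpBound.zero : LpBound μ q (fun _ => 0) 0 :=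
  ⟨aestronglyMeasurable_const, le_rfl, by simp⟩

lemma LpBound.sum {ι : Type*} (hq : 1 ≤ q) (s : Finset ι) {Z : ι → Ω → ℝ} {K : ι → ℝ}
    (h : ∀ i ∈ s, LpBound μ q (Z i) (K i)) :
    LpBound μ q (fun ω => ∑ i ∈ s, Z i ω) (∑ i ∈ s, K i) := by
  classical
  induction s using Finset.induction_on with
  | empty => simpa using LpBound.zero
  | insert a s ha ih =>
    simp only [Finset.sum_insert ha]
    exact (h a (Finset.mem_insert_self a s)).add hq
      (ih fun i hi => h i (Finset.mem_insert_of_mem hi))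

lemma LpBound.mul (hp : 0 < p) (h : LpBound μ (2 * p) Z K) (h' : LpBound μ (2 * p) Z' K') :
    LpBound μ p (fun ω => Z ω * Z' ω) (K * K') := by
  refine ⟨h.meas.mul h'.meas, mul_nonneg h.nonneg h'.nonneg, ?_⟩
  have : ENNReal.HolderTriple (ENNReal.ofReal (2 * p)) (ENNReal.ofReal (2 * p))
      (ENNReal.ofReal p) := by
    refine ⟨?_⟩
    rw [← ENNReal.ofReal_inv_of_pos (by positivity), ← ENNReal.ofReal_inv_of_pos hp,
      ← ENNReal.ofReal_add (by positivity) (by positivity)]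
    congr 1
    field_simp
    norm_num
  rw [ENNReal.ofReal_mul h.nonneg]
  exact (eLpNorm_smul_le_mul_eLpNorm (r := ENNReal.ofReal p) h'.meas h.meas).trans
    (mul_le_mul' h.le h'.le)

end LpBound

/-! ### Second-order expansions of `|x + y|^p` -/

section Scalar

/-- The power is at most `exp (p s)`. For `|p s| ≤ 1` the exponential is expanded to second order;
otherwise `(p s)² ≥ 1` absorbs both `exp (p / 2)` and the linear term. -/
lemma one_add_rpow_le {p s : ℝ} (hp : 0 < p) (hs : |s| ≤ 1 / 2) :
    (1 + s) ^ p ≤ 1 + p * s + (Real.exp (p / 2) + 1) * (p ^ 2 * s ^ 2) := by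
  have hs' := abs_le.1 hs
  have h1 : (1 + s) ^ p ≤ Real.exp (p * s) := by
    rw [mul_comm, Real.exp_mul]
    refine Real.rpow_le_rpow (by linarith) ?_ hp.le
    linarith [Real.add_one_le_exp s]
  refine h1.trans ?_
  have hE : 0 < Real.exp (p / 2) := Real.exp_pos _
  rw [← mul_pow]
  rcases le_or_gt |p * s| 1 with h | h
  · have := (abs_le.1 (Real.abs_exp_sub_one_sub_id_le h)).2
    nlinarith [mul_nonneg hE.le (sq_nonneg (p * s))]
  · have h2 : Real.exp (p * s) ≤ Real.exp (p / 2) := Real.exp_le_exp.2 (by nlinarith)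
    have h3 : 1 ≤ (p * s) ^ 2 := by rw [← sq_abs]; nlinarith
    have h4 : -(p * s) ≤ (p * s) ^ 2 := by
      rw [← sq_abs]
      nlinarith [neg_abs_le (p * s)]
    nlinarith [mul_le_mul_of_nonneg_left h3 hE.le]

/-- The quadratic error `|x|^{p-2} y²` is needed only when `y` is small relative to `x`. Keeping
`|y| ≤ |x| / 2` in that alternative allows it to be exchanged for `|y|^p` when `p ≤ 2`. -/
lemma abs_add_rpow_le {p : ℝ} (hp : 1 < p) : ∃ C : ℝ, 0 ≤ C ∧ ∀ x y : ℝ,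
    |x + y| ^ p ≤ |x| ^ p + p * (x * |x| ^ (p - 2)) * y + C * |y| ^ p ∨
      (|y| ≤ |x| / 2 ∧ |x + y| ^ p ≤ |x| ^ p + p * (x * |x| ^ (p - 2)) * y
        + C * (|x| ^ (p - 2) * y ^ 2)) := by
  have hp0 : 0 < p := by linarith
  refine ⟨max ((3 : ℝ) ^ p + p * 2 ^ p) ((Real.exp (p / 2) + 1) * p ^ 2), by positivity,
    fun x y => ?_⟩
  have habs : ∀ x : ℝ, x ≠ 0 → |x| ^ (p - 2) * x ^ 2 = |x| ^ p := fun x hx => by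
    rw [← sq_abs x, ← Real.rpow_natCast, ← Real.rpow_add (abs_pos.2 hx)]
    congr 1; push_cast; ring
  rcases le_or_gt |y| (|x| / 2) with h | h
  · right
    refine ⟨h, ?_⟩
    by_cases hx : x = 0
    · subst hx
      have : y = 0 := by simpa using h
      subst this
      simp
    have hx' := abs_pos.2 hx
    have hs : |y / x| ≤ 1 / 2 := by
      rw [abs_div, div_le_iff₀ hx']; linarith
    have h1 := one_add_rpow_le hp0 hs
    have h2 : |x + y| ^ p = |x| ^ p * (1 + y / x) ^ p := by
      have h3 : 0 ≤ 1 + y / x := by linarith [(abs_le.1 hs).1]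
      rw [← Real.mul_rpow hx'.le h3]
      congr 1
      rw [← abs_of_nonneg h3, ← abs_mul]
      congr 1; field_simp
    rw [h2]
    have hxp : 0 ≤ |x| ^ p := by positivity
    refine (mul_le_mul_of_nonneg_left h1 hxp).trans ?_
    have e1 : |x| ^ p * (p * (y / x)) = p * (x * |x| ^ (p - 2)) * y := by
      rw [← habs x hx]; field_simp
    have e2 : |x| ^ p * (y / x) ^ 2 = |x| ^ (p - 2) * y ^ 2 := by
      rw [← habs x hx]; field_simp
    calc |x| ^ p * (1 + p * (y / x) + (Real.exp (p / 2) + 1) * (p ^ 2 * (y / x) ^ 2))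
        = |x| ^ p + |x| ^ p * (p * (y / x))
          + (Real.exp (p / 2) + 1) * p ^ 2 * (|x| ^ p * (y / x) ^ 2) := by ring
      _ ≤ _ := by
        rw [e1, e2]
        gcongr
        exact le_max_right _ _
  -- Now `|x| < 2 |y|`, so every term is `O(|y|^p)`: `3^p` comes from `|x + y|`, and `p 2^p` from
  -- the linear term.
  · left
    have hy : 0 < |y| := (by positivity : (0:ℝ) ≤ |x| / 2).trans_lt h
    have h1 : |x + y| ^ p ≤ 3 ^ p * |y| ^ p := by
      rw [← Real.mul_rpow (by norm_num) hy.le]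
      refine Real.rpow_le_rpow (abs_nonneg _) ?_ hp0.le
      linarith [abs_add_le x y]
    have h2 : -(p * (x * |x| ^ (p - 2)) * y) ≤ p * 2 ^ p * |y| ^ p := by
      by_cases hx : x = 0
      · subst hx; simp; positivity
      have hx' := abs_pos.2 hx
      have : |x * |x| ^ (p - 2) * y| ≤ 2 ^ p * |y| ^ p := by
        rw [abs_mul, abs_mul, abs_of_nonneg (by positivity : 0 ≤ |x| ^ (p - 2))]
        have e : |x| * |x| ^ (p - 2) = |x| ^ (p - 1) := by
          nth_rewrite 1 [← Real.rpow_one |x|]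
          rw [← Real.rpow_add hx']; congr 1; ring
        rw [e, ← Real.mul_rpow (by norm_num) hy.le]
        calc |x| ^ (p - 1) * |y| ≤ (2 * |y|) ^ (p - 1) * (2 * |y|) := by
              gcongr <;> linarith
          _ = (2 * |y|) ^ p := by
              rw [← Real.rpow_add_one (by positivity)]; congr 1; ring
      have := (abs_le.1 this).1
      nlinarith
    have h3 : 0 ≤ |x| ^ p := by positivity
    have h4 : ((3 : ℝ) ^ p + p * 2 ^ p) * |y| ^ p ≤
        max ((3 : ℝ) ^ p + p * 2 ^ p) ((Real.exp (p / 2) + 1) * p ^ 2) * |y| ^ p := by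
      gcongr; exact le_max_left _ _
    linarith

lemma abs_add_rpow_le_of_le_two {p : ℝ} (hp : 1 < p) (hp2 : p ≤ 2) : ∃ C : ℝ, 0 ≤ C ∧
    ∀ x y : ℝ, |x + y| ^ p ≤ |x| ^ p + p * (x * |x| ^ (p - 2)) * y + C * |y| ^ p := by
  obtain ⟨C, hC, h⟩ := abs_add_rpow_le hp
  refine ⟨C, hC, fun x y => ?_⟩
  rcases h x y with h | ⟨hxy, h⟩
  · exact h
  refine h.trans ?_
  gcongr
  by_cases hy : y = 0
  · subst hy; simp; positivity
  have hy' := abs_pos.2 hy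
  have e : |y| ^ (p - 2) * y ^ 2 = |y| ^ p := by
    rw [← sq_abs y, ← Real.rpow_natCast, ← Real.rpow_add hy']
    congr 1; push_cast; ring
  rw [← e]
  refine mul_le_mul_of_nonneg_right ?_ (sq_nonneg _)
  -- The exponent `p - 2` is nonpositive, so the smaller base has the larger power.
  exact Real.rpow_le_rpow_of_nonpos hy' (by linarith) (by linarith)

lemma abs_add_rpow_le_of_two_le {p : ℝ} (hp : 2 ≤ p) : ∃ C : ℝ, 0 ≤ C ∧
    ∀ x y : ℝ, |x + y| ^ p ≤ |x| ^ p + p * (x * |x| ^ (p - 2)) * y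
      + C * (|x| ^ (p - 2) * y ^ 2 + |y| ^ p) := by
  obtain ⟨C, hC, h⟩ := abs_add_rpow_le (show 1 < p by linarith)
  refine ⟨C, hC, fun x y => ?_⟩
  have h1 : 0 ≤ C * (|x| ^ (p - 2) * y ^ 2) := by positivity
  have h2 : 0 ≤ C * |y| ^ p := by positivity
  rcases h x y with h | ⟨-, h⟩ <;> linarith

/-- Turns the second-order recursion for `p`-th moments into an additive recursion for squared
norms. With `s = p / 2`, `a = k²`, `e = d²` and `A = 2C + 2`, superadditivity of `x^s` gives `a^s +
A e^s ≤ (a + A e)^s`, and Bernoulli's inequality gives `a^s + A a^{s-1} e ≤ (a + A e)^s`. The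
average of the two suffices since `A / 2 ≥ C`. -/
lemma rpow_add_le_sqrt_rpow {p C k d : ℝ} (hp : 2 ≤ p) (hC : 0 ≤ C) (hk : 0 ≤ k) (hd : 0 ≤ d) :
    k ^ p + C * (k ^ (p - 2) * d ^ 2 + d ^ p) ≤ √(k ^ 2 + (2 * C + 2) * d ^ 2) ^ p := by
  set A := 2 * C + 2 with hA
  have hA1 : 1 ≤ A := by linarith
  have hA0 : 0 ≤ A := by linarith
  set s := p / 2 with hs
  have hs1 : 1 ≤ s := by linarith
  have e0 : ∀ x : ℝ, 0 ≤ x → x ^ p = (x ^ 2) ^ s := fun x hx => by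
    rw [← Real.rpow_natCast, ← Real.rpow_mul hx]; congr 1; push_cast; linarith
  rw [e0 _ (Real.sqrt_nonneg _), Real.sq_sqrt (by positivity), e0 k hk, e0 d hd]
  have e1 : k ^ (p - 2) = (k ^ 2) ^ (s - 1) := by
    rw [← Real.rpow_natCast, ← Real.rpow_mul hk]; congr 1; push_cast; linarith
  rw [e1]
  obtain ⟨a, ha, rfl⟩ : ∃ a, 0 ≤ a ∧ k ^ 2 = a := ⟨_, sq_nonneg k, rfl⟩
  generalize ha' : k ^ 2 = a at *
  generalize d ^ 2 = e, sq_nonneg d = he at *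
  have h1 : a ^ s + (A * e) ^ s ≤ (a + A * e) ^ s :=
    Real.add_rpow_le_rpow_add ha (by positivity) hs1
  have h1' : A * e ^ s ≤ (A * e) ^ s := by
    rw [Real.mul_rpow hA0 he]
    gcongr
    exact Real.self_le_rpow_of_one_le hA1 hs1
  have h2 : a ^ s + A * (a ^ (s - 1) * e) ≤ (a + A * e) ^ s := by
    rcases ha.eq_or_lt with h0 | h0
    · subst h0
      rw [Real.zero_rpow (by linarith)]
      rcases hs1.eq_or_lt with h | h
      · rw [← h]; simp
      · rw [Real.zero_rpow (by linarith)]; simp; positivity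
    · have h3 := one_add_mul_self_le_rpow_one_add (s := A * e / a)
        (by linarith [show 0 ≤ A * e / a by positivity]) hs1
      have h4 : (a + A * e) ^ s = a ^ s * (1 + A * e / a) ^ s := by
        rw [← Real.mul_rpow h0.le (by positivity)]; congr 1; field_simp
      rw [h4]
      refine le_trans ?_ (mul_le_mul_of_nonneg_left h3 (by positivity))
      have h5 : a ^ s = a ^ (s - 1) * a := by
        rw [← Real.rpow_add_one h0.ne']; congr 1; ring
      have h6 : a ^ s * (1 + s * (A * e / a)) = a ^ s + s * (A * (a ^ (s - 1) * e)) := by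
        rw [h5]; field_simp
      rw [h6]
      have : 0 ≤ A * (a ^ (s - 1) * e) := by positivity
      nlinarith
  have h7 : 0 ≤ a ^ (s - 1) * e := by positivity
  have h8 : 0 ≤ e ^ s := by positivity
  nlinarith

end Scalar

/-! ### Moment inequalities for martingales -/

section Martingale

set_option linter.unusedSectionVars false

variable {Ω : Type*} {m0 : MeasurableSpace Ω} {μ : Measure Ω} [IsProbabilityMeasure μ]
  {p : ℝ} {S D : Ω → ℝ} {k d : ℝ}

lemma rpow_sub_mul_le {p r a b : ℝ} (hr : 0 ≤ r) (hrp : r ≤ p) (ha : 0 ≤ a)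
    (hb : 0 ≤ b) : a ^ (p - r) * b ^ r ≤ a ^ p + b ^ p := by
  have h1 : a ^ (p - r) * b ^ r ≤ max a b ^ (p - r) * max a b ^ r := by
    have h3 : 0 ≤ p - r := by linarith
    gcongr
    · exact le_max_left _ _
    · exact le_max_right _ _
  have h2 : max a b ^ (p - r) * max a b ^ r = max a b ^ p := by
    rw [← Real.rpow_add_of_nonneg (le_max_of_le_left ha) (by linarith) hr]; congr 1; ring
  rw [h2] at h1
  refine h1.trans ?_
  have := Real.rpow_nonneg ha p
  have := Real.rpow_nonneg hb p
  rcases max_choice a b with h | h <;> rw [h] <;> linarith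

lemma LpBound.integrable (hp : 1 ≤ p) (h : LpBound μ p S k) : Integrable S μ :=
  h.memLp.integrable (by simpa using hp)

lemma LpBound.integrable_rpow_mul {r : ℝ} (hr : 0 ≤ r) (hrp : r ≤ p) (hp : 0 < p)
    (hS : LpBound μ p S k) (hD : LpBound μ p D d) :
    Integrable (fun ω => |S ω| ^ (p - r) * |D ω| ^ r) μ := by
  refine ((hS.integrable_rpow hp).add (hD.integrable_rpow hp)).mono'
    ((LpBound.aemeasurable_rpow hS.meas).mul (LpBound.aemeasurable_rpow hD.meas))
    (ae_of_all _ fun ω => ?_)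
  rw [Real.norm_of_nonneg (by positivity)]
  exact rpow_sub_mul_le hr hrp (abs_nonneg _) (abs_nonneg _)

lemma LpBound.integrable_signed_rpow_mul (hp : 1 < p) (hS : LpBound μ p S k)
    (hD : LpBound μ p D d) : Integrable (fun ω => (S ω * |S ω| ^ (p - 2)) * D ω) μ := by
  refine (hS.integrable_rpow_mul (r := 1) zero_le_one hp.le (by linarith) hD).mono'
    ((hS.meas.mul (LpBound.aemeasurable_rpow hS.meas)).mul hD.meas)
    (ae_of_all _ fun ω => ?_)
  rw [Real.norm_eq_abs, abs_mul, abs_mul, abs_of_nonneg (by positivity : 0 ≤ |S ω| ^ (p - 2)),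
    Real.rpow_one]
  gcongr
  by_cases h : S ω = 0
  · simp [h]; positivity
  · nth_rewrite 1 [← Real.rpow_one |S ω|]
    rw [← Real.rpow_add (abs_pos.2 h)]
    apply le_of_eq; congr 1; ring

/-- The first-order term of the expansion of `|S + D|^p` is a past-measurable factor times a
martingale difference, so it has mean zero. -/
lemma integral_signed_rpow_mul_eq_zero {m : MeasurableSpace Ω} (hm : m ≤ m0) (hp : 1 < p)
    (hSm : Measurable[m] S) (hS : LpBound μ p S k) (hD : LpBound μ p D d)
    (hD0 : μ[D | m] =ᵐ[μ] 0) : ∫ ω, (S ω * |S ω| ^ (p - 2)) * D ω ∂μ = 0 := by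
  have hφ : StronglyMeasurable[m] (fun ω => S ω * |S ω| ^ (p - 2)) :=
    (hSm.mul ((measurable_norm.comp hSm).pow_const _)).stronglyMeasurable
  have h := condExp_mul_of_stronglyMeasurable_left hφ
    (hS.integrable_signed_rpow_mul hp hD) (hD.integrable hp.le)
  have h2 := integral_condExp (μ := μ) hm
    (f := (fun ω => S ω * |S ω| ^ (p - 2)) * D)
  have h3 : ∫ ω, ((fun ω => S ω * |S ω| ^ (p - 2)) * D) ω ∂μ = 0 := by
    rw [← h2, integral_congr_ae h]
    have : (fun ω => S ω * |S ω| ^ (p - 2)) * μ[D | m] =ᵐ[μ] 0 := by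
      filter_upwards [hD0] with ω hω
      simp [hω]
    rw [integral_congr_ae this]; simp
  exact h3

/-- Hölder's inequality with weights `(p - 2) / p` and `2 / p`; in this form `p = 2` needs no
separate treatment. -/
lemma LpBound.integral_rpow_mul_sq_le (hp : 2 ≤ p) (hS : LpBound μ p S k)
    (hD : LpBound μ p D d) :
    ∫ ω, |S ω| ^ (p - 2) * D ω ^ 2 ∂μ ≤ k ^ (p - 2) * d ^ 2 := by
  have hp0 : 0 < p := by linarith
  have hk := hS.nonneg
  have hd := hD.nonneg
  have e : ∀ ω, D ω ^ 2 = |D ω| ^ (2 : ℝ) := fun ω => by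
    rw [← sq_abs]; norm_cast
  simp_rw [e]
  have hi := hS.integrable_rpow_mul (r := 2) zero_le_two hp hp0 hD
  have h1 := ENNReal.lintegral_mul_norm_pow_le (μ := μ)
    (f := fun ω => ENNReal.ofReal (|S ω| ^ p)) (g := fun ω => ENNReal.ofReal (|D ω| ^ p))
    (LpBound.aemeasurable_rpow hS.meas).aemeasurable.ennreal_ofReal
    (LpBound.aemeasurable_rpow hD.meas).aemeasurable.ennreal_ofReal
    (p := (p - 2) / p) (q := 2 / p) (div_nonneg (by linarith) hp0.le) (by positivity)
    (by field_simp; ring)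
  have e2 : ∀ (x : ℝ) (r : ℝ), 0 ≤ x → 0 ≤ r →
      ENNReal.ofReal (x ^ p) ^ (r / p) = ENNReal.ofReal (x ^ r) := fun x r hx hr => by
    rw [ENNReal.ofReal_rpow_of_nonneg (by positivity) (by positivity), ← Real.rpow_mul hx]
    congr 2; field_simp
  have h2 : (∫⁻ ω, ENNReal.ofReal (|S ω| ^ p) ∂μ) ^ ((p - 2) / p)
      * (∫⁻ ω, ENNReal.ofReal (|D ω| ^ p) ∂μ) ^ (2 / p)
      ≤ ENNReal.ofReal (k ^ (p - 2)) * ENNReal.ofReal (d ^ (2 : ℝ)) := by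
    rw [← e2 k (p - 2) hk (by linarith), ← e2 d 2 hd (by norm_num)]
    have h3 : 0 ≤ (p - 2) / p := div_nonneg (by linarith) hp0.le
    gcongr
    · exact hS.lintegral_le hp0
    · exact hD.lintegral_le hp0
  have h3 := h1.trans h2
  rw [← ENNReal.ofReal_mul (by positivity)] at h3
  have h4 : ∀ ω, ENNReal.ofReal (|S ω| ^ p) ^ ((p - 2) / p)
      * ENNReal.ofReal (|D ω| ^ p) ^ (2 / p)
      = ENNReal.ofReal (|S ω| ^ (p - 2) * |D ω| ^ (2 : ℝ)) := fun ω => by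
    rw [e2 _ _ (abs_nonneg _) (by linarith), e2 _ _ (abs_nonneg _) (by norm_num),
      ← ENNReal.ofReal_mul (by positivity)]
  simp_rw [h4] at h3
  rw [← ofReal_integral_eq_lintegral_ofReal hi (ae_of_all _ fun ω => by positivity),
    ENNReal.ofReal_le_ofReal_iff (by positivity)] at h3
  refine h3.trans (le_of_eq ?_)
  norm_cast

/-- Integrating the expansion removes the linear term. The bound has the form of a square root so
that induction over the increments simply adds the `d²`. -/
lemma LpBound.add_martingale_of_two_le (hp : 2 ≤ p) : ∃ A : ℝ, 0 ≤ A ∧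
    ∀ (S D : Ω → ℝ) (k d : ℝ) (m : MeasurableSpace Ω), m ≤ m0 → Measurable[m] S →
      LpBound μ p S k → LpBound μ p D d → μ[D | m] =ᵐ[μ] 0 →
      LpBound μ p (fun ω => S ω + D ω) (√(k ^ 2 + A * d ^ 2)) := by
  obtain ⟨C, hC, h⟩ := abs_add_rpow_le_of_two_le hp
  refine ⟨2 * C + 2, by positivity, fun S D k d m hm hSm hS hD hD0 => ?_⟩
  have hp0 : 0 < p := by linarith
  have hp1 : 1 < p := by linarith
  have hSD := hS.add hp1.le hD
  refine .of_integral hSD.meas hp0 (Real.sqrt_nonneg _) (hSD.integrable_rpow hp0) ?_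
  refine le_trans ?_ (rpow_add_le_sqrt_rpow hp hC hS.nonneg hD.nonneg)
  have hi1 := hS.integrable_rpow hp0
  have hi2 := hS.integrable_signed_rpow_mul hp1 hD
  have hi3 : Integrable (fun ω => |S ω| ^ (p - 2) * D ω ^ 2) μ := by
    have := hS.integrable_rpow_mul (r := 2) zero_le_two hp hp0 hD
    refine this.congr (ae_of_all _ fun ω => ?_)
    simp only [← sq_abs (D ω)]; norm_cast
  have hi4 := hD.integrable_rpow hp0
  calc ∫ ω, |S ω + D ω| ^ p ∂μ
      ≤ ∫ ω, ((|S ω| ^ p + p * ((S ω * |S ω| ^ (p - 2)) * D ω))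
        + C * (|S ω| ^ (p - 2) * D ω ^ 2 + |D ω| ^ p)) ∂μ := by
        refine integral_mono (hSD.integrable_rpow hp0)
          ((hi1.add (hi2.const_mul p)).add ((hi3.add hi4).const_mul C)) fun ω => ?_
        have := h (S ω) (D ω)
        simp only []
        linarith
    _ = ∫ ω, |S ω| ^ p ∂μ + C * (∫ ω, |S ω| ^ (p - 2) * D ω ^ 2 ∂μ + ∫ ω, |D ω| ^ p ∂μ) := by
        have hi5 : Integrable
            (fun ω => |S ω| ^ p + p * ((S ω * |S ω| ^ (p - 2)) * D ω)) μ :=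
          hi1.add (hi2.const_mul p)
        have hi6 : Integrable (fun ω => C * (|S ω| ^ (p - 2) * D ω ^ 2 + |D ω| ^ p)) μ :=
          (hi3.add hi4).const_mul C
        rw [integral_add hi5 hi6,
          integral_add hi1 (hi2.const_mul p), integral_const_mul, integral_const_mul,
          integral_add hi3 hi4, integral_signed_rpow_mul_eq_zero hm hp1 hSm hS hD hD0]
        ring
    _ ≤ _ := by
        gcongr
        · exact hS.integral_rpow_le hp0
        · exact hS.integral_rpow_mul_sq_le hp hD
        · exact hD.integral_rpow_le hp0

/-- The counterpart of von Bahr-Esseen type: here the `p`-th powers of the norms are what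
accumulates. -/
lemma LpBound.add_martingale_of_le_two (hp : 1 < p) (hp2 : p ≤ 2) : ∃ A : ℝ, 0 ≤ A ∧
    ∀ (S D : Ω → ℝ) (k d : ℝ) (m : MeasurableSpace Ω), m ≤ m0 → Measurable[m] S →
      LpBound μ p S k → LpBound μ p D d → μ[D | m] =ᵐ[μ] 0 →
      LpBound μ p (fun ω => S ω + D ω) ((k ^ p + A * d ^ p) ^ p⁻¹) := by
  obtain ⟨C, hC, h⟩ := abs_add_rpow_le_of_le_two hp hp2
  refine ⟨C, hC, fun S D k d m hm hSm hS hD hD0 => ?_⟩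
  have hp0 : 0 < p := by linarith
  have hSD := hS.add hp.le hD
  have hk := hS.nonneg
  have hd := hD.nonneg
  refine .of_integral hSD.meas hp0 (by positivity) (hSD.integrable_rpow hp0) ?_
  rw [Real.rpow_inv_rpow (by positivity) hp0.ne']
  have hi1 := hS.integrable_rpow hp0
  have hi2 := hS.integrable_signed_rpow_mul hp hD
  have hi4 := hD.integrable_rpow hp0
  calc ∫ ω, |S ω + D ω| ^ p ∂μ
      ≤ ∫ ω, ((|S ω| ^ p + p * ((S ω * |S ω| ^ (p - 2)) * D ω)) + C * |D ω| ^ p) ∂μ := by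
        refine integral_mono (hSD.integrable_rpow hp0)
          ((hi1.add (hi2.const_mul p)).add (hi4.const_mul C)) fun ω => ?_
        have := h (S ω) (D ω)
        simp only []
        linarith
    _ = ∫ ω, |S ω| ^ p ∂μ + C * ∫ ω, |D ω| ^ p ∂μ := by
        have hi5 : Integrable
            (fun ω => |S ω| ^ p + p * ((S ω * |S ω| ^ (p - 2)) * D ω)) μ :=
          hi1.add (hi2.const_mul p)
        rw [integral_add hi5 (hi4.const_mul C),
          integral_add hi1 (hi2.const_mul p), integral_const_mul, integral_const_mul,
          integral_signed_rpow_mul_eq_zero hm hp hSm hS hD hD0]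
        ring
    _ ≤ _ := by
        gcongr
        · exact hS.integral_rpow_le hp0
        · exact hD.integral_rpow_le hp0

lemma measurable_sum_range_adapted {F : ℕ → MeasurableSpace Ω} (hFm : Monotone F)
    {D : ℕ → Ω → ℝ} (hD : ∀ i, Measurable[F (i + 1)] (D i)) (n : ℕ) :
    Measurable[F n] (fun ω => ∑ i ∈ Finset.range n, D i ω) :=
  Finset.measurable_fun_sum _ fun i hi =>
    (hD i).mono (hFm (Finset.mem_range.1 hi)) le_rfl

/-- Moment inequality of order `p ≥ 2` for sums of martingale differences. -/
theorem martingale_moment_of_two_le (hp : 2 ≤ p) : ∃ A : ℝ, 0 ≤ A ∧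
    ∀ (F : ℕ → MeasurableSpace Ω) (D : ℕ → Ω → ℝ) (k : ℕ → ℝ), Monotone F → (∀ i, F i ≤ m0) →
      (∀ i, Measurable[F (i + 1)] (D i)) → (∀ i, LpBound μ p (D i) (k i)) →
      (∀ i, μ[D i | F i] =ᵐ[μ] 0) → ∀ n,
      LpBound μ p (fun ω => ∑ i ∈ Finset.range n, D i ω)
        (A * √(∑ i ∈ Finset.range n, k i ^ 2)) := by
  obtain ⟨A, hA, h⟩ := LpBound.add_martingale_of_two_le (μ := μ) hp
  refine ⟨√A, Real.sqrt_nonneg _, fun F D k hF hF0 hm hD hD0 n => ?_⟩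
  rw [← Real.sqrt_mul hA]
  induction n with
  | zero => simpa using LpBound.zero
  | succ n ih =>
    have := h _ _ _ _ (F n) (hF0 n) (measurable_sum_range_adapted hF hm n) ih (hD n) (hD0 n)
    rw [Real.sq_sqrt (mul_nonneg hA (Finset.sum_nonneg fun i _ => sq_nonneg _)),
      ← mul_add, ← Finset.sum_range_succ] at this
    simpa only [Finset.sum_range_succ _ n] using this

/-- Moment inequality of order `p > 1` for sums of martingale differences with a common bound. -/
theorem martingale_moment (hp : 1 < p) : ∃ A : ℝ, 0 ≤ A ∧
    ∀ (F : ℕ → MeasurableSpace Ω) (D : ℕ → Ω → ℝ) (k : ℝ), Monotone F → (∀ i, F i ≤ m0) →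
      (∀ i, Measurable[F (i + 1)] (D i)) → (∀ i, LpBound μ p (D i) k) →
      (∀ i, μ[D i | F i] =ᵐ[μ] 0) → ∀ n : ℕ,
      LpBound μ p (fun ω => ∑ i ∈ Finset.range n, D i ω)
        (A * k * (n : ℝ) ^ max (1 / 2) (1 / p)) := by
  have hp0 : 0 < p := by linarith
  rcases le_or_gt 2 p with hp2 | hp2
  · obtain ⟨A, hA, h⟩ := martingale_moment_of_two_le (μ := μ) hp2
    refine ⟨A, hA, fun F D k hF hF0 hm hD hD0 n => ?_⟩
    refine (h F D (fun _ => k) hF hF0 hm hD hD0 n).mono (le_of_eq ?_)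
    rw [max_eq_left (by rw [div_le_div_iff₀ hp0 two_pos]; linarith), ← Real.sqrt_eq_rpow]
    simp only [Finset.sum_const, Finset.card_range, nsmul_eq_mul]
    rw [Real.sqrt_mul (Nat.cast_nonneg n), Real.sqrt_sq (hD 0).nonneg]
    ring
  · obtain ⟨A, hA, h⟩ := LpBound.add_martingale_of_le_two (μ := μ) hp hp2.le
    refine ⟨A ^ p⁻¹, by positivity, fun F D k hF hF0 hm hD hD0 n => ?_⟩
    have hk := (hD 0).nonneg
    rw [max_eq_right (by rw [div_le_div_iff₀ two_pos hp0]; linarith), one_div]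
    have key : LpBound μ p (fun ω => ∑ i ∈ Finset.range n, D i ω) ((A * k ^ p * n) ^ p⁻¹) := by
      induction n with
      | zero => simpa [hp0.ne'] using LpBound.zero
      | succ n ih =>
        have := h _ _ _ _ (F n) (hF0 n) (measurable_sum_range_adapted hF hm n) ih (hD n) (hD0 n)
        rw [Real.rpow_inv_rpow (by positivity) hp0.ne'] at this
        simp only [Finset.sum_range_succ _ n]
        refine this.mono (le_of_eq ?_)
        congr 1; push_cast; ring
    refine key.mono (le_of_eq ?_)
    rw [Real.mul_rpow (by positivity) (by positivity), Real.mul_rpow hA (by positivity),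
      Real.rpow_rpow_inv hk hp0.ne']

end Martingale

/-! ### Martingale approximations and lagged sums -/

/-- A martingale approximation `y i = D i + (u i - u (i + 1)) + r i` in `L^q`: the `D i` are
martingale differences and the remainders `r i` are of order `i^{-1/2}`. The variables `y i`, `D i`
and `r i` belong to time `i + 1`, and `u i` to time `i`. -/
structure MartApprox {Ω : Type*} {m0 : MeasurableSpace Ω} (μ : Measure Ω)
    (F : ℕ → MeasurableSpace Ω) (q K : ℝ) (y D u r : ℕ → Ω → ℝ) : Prop where
  mono : Monotone F
  le : ∀ i, F i ≤ m0
  eq : ∀ i ω, y i ω = D i ω + u i ω - u (i + 1) ω + r i ω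
  meas_y : ∀ i, Measurable[F (i + 1)] (y i)
  meas_D : ∀ i, Measurable[F (i + 1)] (D i)
  meas_u : ∀ i, Measurable[F i] (u i)
  bound_y : ∀ i, LpBound μ q (y i) K
  bound_D : ∀ i, LpBound μ q (D i) K
  bound_u : ∀ i, LpBound μ q (u i) K
  bound_r : ∀ i : ℕ, LpBound μ q (r i) (K / √(i + 1))
  condExp : ∀ i, μ[D i | F i] =ᵐ[μ] 0

/-- The weighted sum `∑_{j < i} c (i - j) y j` over the past. -/
def lagSum {Ω : Type*} (c : ℕ → ℝ) (y : ℕ → Ω → ℝ) (i : ℕ) (ω : Ω) : ℝ :=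
  ∑ j ∈ Finset.range i, c (i - j) * y j ω

section Algebra

variable {Ω : Type*} (c : ℕ → ℝ) (y D u r : ℕ → Ω → ℝ)

/-- The discrete derivative of the lagged sum in `i`: the new summand enters with lag `1`, and every
older one moves up by one lag. -/
lemma lagSum_succ (i : ℕ) (ω : Ω) :
    lagSum c y (i + 1) ω = lagSum c y i ω + c 1 * y i ω
      + lagSum (fun k => c (k + 1) - c k) y i ω := by
  simp only [lagSum, Finset.sum_range_succ, Nat.add_sub_cancel_left]
  have : ∀ j ∈ Finset.range i, c (i + 1 - j) * y j ω
      = c (i - j) * y j ω + (c (i - j + 1) - c (i - j)) * y j ω := fun j hj => by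
    have := Finset.mem_range.1 hj
    rw [show i + 1 - j = i - j + 1 by omega]; ring
  rw [Finset.sum_congr rfl this, Finset.sum_add_distrib]
  ring

/-- Summation by parts: `∑ S i (u i - u (i+1))` becomes `∑ (S (i+1) - S i) u (i+1) - S n u n`, as `S
0 = 0`, and `lagSum_succ` splits the increment. -/
lemma sum_lagSum_mul (z : ℕ → Ω → ℝ)
    (hz : ∀ i ω, z i ω = D i ω + u i ω - u (i + 1) ω + r i ω) (n : ℕ) (ω : Ω) :
    ∑ i ∈ Finset.range n, lagSum c y i ω * z i ω =
      ∑ i ∈ Finset.range n, lagSum c y i ω * D i ω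
        + ∑ i ∈ Finset.range n, lagSum c y i ω * r i ω
        + c 1 * ∑ i ∈ Finset.range n, y i ω * u (i + 1) ω
        + ∑ i ∈ Finset.range n, lagSum (fun k => c (k + 1) - c k) y i ω * u (i + 1) ω
        - lagSum c y n ω * u n ω := by
  induction n with
  | zero => simp [lagSum]
  | succ n ih =>
    simp only [Finset.sum_range_succ]
    rw [ih, lagSum_succ, hz]
    ring

lemma sum_mul_sub_succ (e : ℕ → ℝ) (n : ℕ) (v : ℕ → ℝ) :
    ∑ j ∈ Finset.range n, e j * (v j - v (j + 1)) =
      e 0 * v 0 - e n * v n + ∑ j ∈ Finset.range n, (e (j + 1) - e j) * v (j + 1) := by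
  induction n with
  | zero => simp
  | succ n ih => simp only [Finset.sum_range_succ]; rw [ih]; ring

/-- The two quantities of order `n` on the left cancel each other. The reason is the square of `y +
u' - r = D + u` with `u' = u (i+1)`, after which `u² - u'²` telescopes. -/
lemma sum_sq_add_two_mul (hy : ∀ i ω, y i ω = D i ω + u i ω - u (i + 1) ω + r i ω) (n : ℕ)
    (ω : Ω) :
    ∑ i ∈ Finset.range n, (y i ω ^ 2 - D i ω ^ 2)
      + 2 * ∑ i ∈ Finset.range n, y i ω * u (i + 1) ω =
      2 * ∑ i ∈ Finset.range n, (y i ω + u (i + 1) ω) * r i ω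
        - ∑ i ∈ Finset.range n, r i ω * r i ω
        + 2 * ∑ i ∈ Finset.range n, u i ω * D i ω + u 0 ω * u 0 ω - u n ω * u n ω := by
  induction n with
  | zero => simp
  | succ n ih =>
    simp only [Finset.sum_range_succ, mul_add]
    have : r n ω = y n ω - D n ω - u n ω + u (n + 1) ω := by rw [hy]; ring
    rw [this]
    linear_combination ih

end Algebra

lemma sum_inv_sqrt_le (n : ℕ) : ∑ i ∈ Finset.range n, 1 / √((i : ℝ) + 1) ≤ 2 * √n := by
  induction n with
  | zero => simp
  | succ n ih =>
    rw [Finset.sum_range_succ]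
    have h1 : 0 < √((n : ℝ) + 1) := Real.sqrt_pos.2 (by positivity)
    have h2 : √((n : ℝ) + 1) ^ 2 = n + 1 := Real.sq_sqrt (by positivity)
    have h3 : √(n : ℝ) ^ 2 = n := Real.sq_sqrt (by positivity)
    have h4 : 1 / √((n : ℝ) + 1) ≤ 2 * (√((n : ℝ) + 1) - √n) := by
      rw [div_le_iff₀ h1]
      nlinarith [sq_nonneg (√((n : ℝ) + 1) - √n)]
    push_cast
    linarith

lemma sum_Ico_inv_sqrt_le (a b : ℕ) :
    ∑ i ∈ Finset.Ico a b, 1 / √((i : ℝ) + 1) ≤ 2 * √((b - a : ℕ) : ℝ) := by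
  rw [Finset.sum_Ico_eq_sum_range]
  refine (Finset.sum_le_sum fun i _ => ?_).trans (sum_inv_sqrt_le (b - a))
  gcongr
  linarith

/-- Lag weights that vanish from `N` on, with bounded values and bounded variation. -/
structure IsLagWeight (c : ℕ → ℝ) (N : ℕ) (m : ℝ) : Prop where
  abs_le : ∀ k, |c k| ≤ m
  eq_zero : ∀ k, N ≤ k → c k = 0
  variation : ∀ n, ∑ k ∈ Finset.range n, |c (k + 1) - c k| ≤ m

lemma IsLagWeight.nonneg {c : ℕ → ℝ} {N : ℕ} {m : ℝ} (h : IsLagWeight c N m) : 0 ≤ m :=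
  (abs_nonneg _).trans (h.abs_le 0)

lemma IsLagWeight.diff {c : ℕ → ℝ} {N : ℕ} {m : ℝ} (h : IsLagWeight c N m) :
    IsLagWeight (fun k => c (k + 1) - c k) N (2 * m) := by
  refine ⟨fun k => ?_, fun k hk => ?_, fun n => ?_⟩
  · have := abs_sub (c (k + 1)) (c k)
    linarith [h.abs_le k, h.abs_le (k + 1)]
  · simp [h.eq_zero k hk, h.eq_zero (k + 1) (by omega)]
  · calc _ ≤ ∑ k ∈ Finset.range n, (|c (k + 1 + 1) - c (k + 1)| + |c (k + 1) - c k|) :=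
        Finset.sum_le_sum fun k _ => abs_sub _ _
      _ ≤ ∑ k ∈ Finset.range (n + 1), |c (k + 1) - c k| + m := by
        rw [Finset.sum_add_distrib, Finset.sum_range_succ' _ n]
        linarith [h.variation n, abs_nonneg (c (0 + 1) - c 0)]
      _ ≤ _ := by linarith [h.variation (n + 1)]

/-! ### Moment bounds for lagged sums and the quadratic form -/

section Bounds

set_option linter.unusedSectionVars false

variable {Ω : Type*} {m0 : MeasurableSpace Ω} {μ : Measure Ω} [IsProbabilityMeasure μ]

/-- The martingale part contributes the `ℓ²`-norm of the weights, the coboundary `u j - u (j+1)`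
their variation and end values after Abel summation, and the remainders a sum against `1/√(j+1)`. -/
theorem MartApprox.weighted_sum {q : ℝ} (hq : 2 ≤ q) : ∃ A : ℝ, 0 ≤ A ∧
    ∀ (F : ℕ → MeasurableSpace Ω) (K : ℝ) (y D u r : ℕ → Ω → ℝ), MartApprox μ F q K y D u r →
      ∀ (e : ℕ → ℝ) (n : ℕ), LpBound μ q (fun ω => ∑ j ∈ Finset.range n, e j * y j ω)
        (A * K * (√(∑ j ∈ Finset.range n, e j ^ 2) + |e 0| + |e n|
          + ∑ j ∈ Finset.range n, |e (j + 1) - e j|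
          + ∑ j ∈ Finset.range n, |e j| / √((j : ℝ) + 1))) := by
  obtain ⟨A, hA, h⟩ := martingale_moment_of_two_le (μ := μ) hq
  have hq1 : 1 ≤ q := by linarith
  refine ⟨A + 1, by positivity, fun F K y D u r H e n => ?_⟩
  have hK : 0 ≤ K := (H.bound_u 0).nonneg
  have h1 : LpBound μ q (fun ω => ∑ j ∈ Finset.range n, e j * D j ω)
      (A * √(∑ j ∈ Finset.range n, (|e j| * K) ^ 2)) := by
    refine h F (fun j ω => e j * D j ω) _ H.mono H.le (fun i => (H.meas_D i).const_mul _)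
      (fun i => (H.bound_D i).const_mul _) (fun i => ?_) n
    filter_upwards [condExp_smul (μ := μ) (e i) (D i) (F i), H.condExp i] with ω h1 h2
    have : (e i • D i) = fun ω => e i * D i ω := rfl
    rw [← this, h1]; simp [h2]
  have h2 := (((H.bound_u 0).const_mul (e 0)).sub hq1 ((H.bound_u n).const_mul (e n))).add hq1
    (LpBound.sum hq1 (Finset.range n)
      (fun j _ => (H.bound_u (j + 1)).const_mul (e (j + 1) - e j)))
  have h3 := LpBound.sum hq1 (Finset.range n) (fun j _ => (H.bound_r j).const_mul (e j))
  have h4 := (h1.add hq1 h2).add hq1 h3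
  have e1 : (fun ω => ∑ j ∈ Finset.range n, e j * D j ω + (e 0 * u 0 ω - e n * u n ω
      + ∑ j ∈ Finset.range n, (e (j + 1) - e j) * u (j + 1) ω)
      + ∑ j ∈ Finset.range n, e j * r j ω) = fun ω => ∑ j ∈ Finset.range n, e j * y j ω := by
    funext ω
    rw [← sum_mul_sub_succ e n (fun j => u j ω), ← Finset.sum_add_distrib,
      ← Finset.sum_add_distrib]
    refine Finset.sum_congr rfl fun j _ => ?_
    rw [H.eq]; ring
  rw [e1] at h4
  refine h4.mono ?_
  have e2 : ∑ j ∈ Finset.range n, |e j| * (K / √((j : ℝ) + 1))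
      = K * ∑ j ∈ Finset.range n, |e j| / √((j : ℝ) + 1) := by
    rw [Finset.mul_sum]
    exact Finset.sum_congr rfl fun j _ => by ring
  simp only [mul_pow, sq_abs, ← Finset.sum_mul]
  rw [Real.sqrt_mul (Finset.sum_nonneg fun _ _ => sq_nonneg _), Real.sqrt_sq hK, e2]
  have t1 : 0 ≤ √(∑ j ∈ Finset.range n, e j ^ 2) := Real.sqrt_nonneg _
  have t2 : 0 ≤ ∑ j ∈ Finset.range n, |e (j + 1) - e j| := Finset.sum_nonneg fun _ _ => abs_nonneg _
  have t3 : 0 ≤ ∑ j ∈ Finset.range n, |e j| / √((j : ℝ) + 1) :=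
    Finset.sum_nonneg fun _ _ => by positivity
  have t4 := abs_nonneg (e 0)
  have t5 := abs_nonneg (e n)
  have : 0 ≤ K * (√(∑ j ∈ Finset.range n, e j ^ 2)
      + A * (|e 0| + |e n| + ∑ j ∈ Finset.range n, |e (j + 1) - e j|
        + ∑ j ∈ Finset.range n, |e j| / √((j : ℝ) + 1))) := by positivity
  linarith

theorem MartApprox.sum_bound {q : ℝ} (hq : 2 ≤ q) : ∃ A : ℝ, 0 ≤ A ∧
    ∀ (F : ℕ → MeasurableSpace Ω) (K : ℝ) (y D u r : ℕ → Ω → ℝ), MartApprox μ F q K y D u r →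
      ∀ n : ℕ, LpBound μ q (fun ω => ∑ j ∈ Finset.range n, y j ω) (A * K * √n) := by
  obtain ⟨A, hA, h⟩ := MartApprox.weighted_sum (μ := μ) hq
  refine ⟨5 * A, by positivity, fun F K y D u r H n => ?_⟩
  have hK : 0 ≤ K := (H.bound_u 0).nonneg
  have h1 := h F K y D u r H (fun _ => 1) n
  rcases n.eq_zero_or_pos with rfl | hn
  · simpa using LpBound.zero
  simp only [one_mul] at h1
  refine h1.mono ?_
  have h2 : 1 ≤ √(n : ℝ) := Real.one_le_sqrt.2 (by exact_mod_cast hn)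
  have h3 := sum_inv_sqrt_le n
  simp only [one_pow, Finset.sum_const, Finset.card_range, nsmul_eq_mul, mul_one, abs_one,
    sub_self, abs_zero, mul_zero]
  have : 0 ≤ A * K := by positivity
  nlinarith

/-- Only the last `N` indices carry a nonzero weight. Their `ℓ²`-norm is at most `m √N`, the
variation and end values are at most `m`, and `∑ 1/√(j+1)` over a window of length `N` is at most `2
√N`. -/
theorem MartApprox.lagSum_bound {q : ℝ} (hq : 2 ≤ q) : ∃ A : ℝ, 0 ≤ A ∧
    ∀ (F : ℕ → MeasurableSpace Ω) (K : ℝ) (y D u r : ℕ → Ω → ℝ), MartApprox μ F q K y D u r →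
      ∀ (c : ℕ → ℝ) (N : ℕ) (m : ℝ), 1 ≤ N → IsLagWeight c N m → ∀ i : ℕ,
      LpBound μ q (lagSum c y i) (A * K * m * √N) := by
  obtain ⟨A, hA, h⟩ := MartApprox.weighted_sum (μ := μ) hq
  refine ⟨6 * A, by positivity, fun F K y D u r H c N m hN hc i => ?_⟩
  have hK : 0 ≤ K := (H.bound_u 0).nonneg
  have hm := hc.nonneg
  refine (h F K y D u r H (fun j => c (i - j)) i).mono ?_
  have hs : 1 ≤ √(N : ℝ) := Real.one_le_sqrt.2 (by exact_mod_cast hN)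
  -- Restricts sums to the window on which the lag `i - j` stays within the support of `c`.
  have hsub : ∀ f : ℕ → ℝ, (∀ j < i, N ≤ i - j → f j = 0) →
      ∑ j ∈ Finset.range i, f j = ∑ j ∈ Finset.Ico (i - N) i, f j := fun f hf => by
    symm
    refine Finset.sum_subset (fun j hj => ?_) (fun j hj hj' => ?_)
    · rw [Finset.mem_Ico] at hj; exact Finset.mem_range.2 hj.2
    · rw [Finset.mem_Ico] at hj'
      rw [Finset.mem_range] at hj
      exact hf j hj (by omega)
  have hcard : ((i - (i - N) : ℕ) : ℝ) ≤ N := by exact_mod_cast (by omega : i - (i - N) ≤ N)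
  have h1 : √(∑ j ∈ Finset.range i, c (i - j) ^ 2) ≤ m * √N := by
    rw [hsub _ fun j _ hj => by simp [hc.eq_zero _ hj]]
    rw [← Real.sqrt_sq hm, ← Real.sqrt_mul (sq_nonneg m)]
    refine Real.sqrt_le_sqrt ?_
    calc ∑ j ∈ Finset.Ico (i - N) i, c (i - j) ^ 2
        ≤ ∑ j ∈ Finset.Ico (i - N) i, m ^ 2 :=
          Finset.sum_le_sum fun j _ => sq_le_sq' (by linarith [(_root_.abs_le.1 (hc.abs_le (i - j))).1])
            (_root_.abs_le.1 (hc.abs_le (i - j))).2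
      _ ≤ m ^ 2 * N := by
          rw [Finset.sum_const, Nat.card_Ico, nsmul_eq_mul, mul_comm]
          gcongr
  have h2 : ∑ j ∈ Finset.range i, |c (i - j)| / √((j : ℝ) + 1) ≤ m * (2 * √N) := by
    rw [hsub _ fun j _ hj => by simp [hc.eq_zero _ hj]]
    calc ∑ j ∈ Finset.Ico (i - N) i, |c (i - j)| / √((j : ℝ) + 1)
        ≤ ∑ j ∈ Finset.Ico (i - N) i, m * (1 / √((j : ℝ) + 1)) :=
          Finset.sum_le_sum fun j _ => by
            rw [mul_one_div]; gcongr; exact hc.abs_le _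
      _ ≤ _ := by
          rw [← Finset.mul_sum]
          gcongr
          exact (sum_Ico_inv_sqrt_le _ _).trans (by gcongr)
  have h3 : ∑ j ∈ Finset.range i, |c (i - (j + 1)) - c (i - j)| ≤ m := by
    refine le_trans (le_of_eq ?_) (hc.variation i)
    rw [← Finset.sum_range_reflect]
    refine Finset.sum_congr rfl fun j hj => ?_
    have := Finset.mem_range.1 hj
    rw [show i - (i - 1 - j + 1) = j by omega, show i - (i - 1 - j) = j + 1 by omega, abs_sub_comm]
  have h4 := hc.abs_le (i - 0)
  have h5 := hc.abs_le (i - i)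
  have h6 : m ≤ m * √N := le_mul_of_one_le_right hm hs
  have h7 : 0 ≤ A * K := by positivity
  calc _ ≤ A * K * (m * √N + m + m + m + m * (2 * √N)) := by gcongr
    _ ≤ A * K * (6 * (m * √N)) := by gcongr; linarith
    _ = _ := by ring

lemma LpBound.sum_range_mul {p : ℝ} (hp : 1 ≤ p) {n : ℕ} {a b : ℕ → Ω → ℝ} {k l : ℝ}
    (ha : ∀ i, LpBound μ (2 * p) (a i) k) (hb : ∀ i, LpBound μ (2 * p) (b i) l) :
    LpBound μ p (fun ω => ∑ i ∈ Finset.range n, a i ω * b i ω) (n * (k * l)) := by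
  have := LpBound.sum hp (Finset.range n) fun i _ => (ha i).mul (by linarith) (hb i)
  simpa using this

lemma LpBound.sum_range_mul_rem {p : ℝ} (hp : 1 ≤ p) {n : ℕ} {a b : ℕ → Ω → ℝ} {k l : ℝ}
    (ha : ∀ i, LpBound μ (2 * p) (a i) k)
    (hb : ∀ i : ℕ, LpBound μ (2 * p) (b i) (l / √((i : ℝ) + 1))) (hl : 0 ≤ l) :
    LpBound μ p (fun ω => ∑ i ∈ Finset.range n, a i ω * b i ω) (2 * (k * l) * √n) := by
  have := LpBound.sum hp (Finset.range n) fun i _ => (ha i).mul (by linarith) (hb i)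
  refine this.mono ?_
  have e : ∀ i : ℕ, k * (l / √((i : ℝ) + 1)) = (k * l) * (1 / √((i : ℝ) + 1)) := fun i => by ring
  simp_rw [e, ← Finset.mul_sum]
  have := sum_inv_sqrt_le n
  have := mul_nonneg (ha 0).nonneg hl
  nlinarith

lemma measurable_lagSum {F : ℕ → MeasurableSpace Ω} (hF : Monotone F) {y : ℕ → Ω → ℝ}
    (hy : ∀ i, Measurable[F (i + 1)] (y i)) (c : ℕ → ℝ) (i : ℕ) :
    Measurable[F i] (lagSum c y i) :=
  Finset.measurable_fun_sum _ fun j hj =>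
    ((hy j).mono (hF (Finset.mem_range.1 hj)) le_rfl).const_mul _

/-- Martingale transforms have moments of the same order as martingales. -/
theorem martingale_transform_moment {p : ℝ} (hp : 1 < p) : ∃ A : ℝ, 0 ≤ A ∧
    ∀ (F : ℕ → MeasurableSpace Ω) (D s : ℕ → Ω → ℝ) (k l : ℝ), Monotone F → (∀ i, F i ≤ m0) →
      (∀ i, Measurable[F (i + 1)] (D i)) → (∀ i, LpBound μ (2 * p) (D i) k) →
      (∀ i, μ[D i | F i] =ᵐ[μ] 0) → (∀ i, Measurable[F i] (s i)) →
      (∀ i, LpBound μ (2 * p) (s i) l) → ∀ n : ℕ,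
      LpBound μ p (fun ω => ∑ i ∈ Finset.range n, s i ω * D i ω)
        (A * (l * k) * (n : ℝ) ^ max (1 / 2) (1 / p)) := by
  obtain ⟨A, hA, h⟩ := martingale_moment (μ := μ) hp
  refine ⟨A, hA, fun F D s k l hF hF0 hm hD hD0 hsm hs n => ?_⟩
  have hb : ∀ i, LpBound μ p (fun ω => s i ω * D i ω) (l * k) := fun i =>
    (hs i).mul (by linarith) (hD i)
  refine h F (fun i ω => s i ω * D i ω) (l * k) hF hF0
    (fun i => ((hsm i).mono (hF (Nat.le_succ i)) le_rfl).mul (hm i)) hb (fun i => ?_) n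
  have h1 := condExp_mul_of_stronglyMeasurable_left (μ := μ) (hsm i).stronglyMeasurable
    ((hb i).integrable hp.le) ((hD i).integrable (by linarith))
  refine h1.trans ?_
  filter_upwards [hD0 i] with ω hω
  simp [hω]

/-- The triangle inequality without any cancellation; enough for second-difference weights, whose
`ℓ¹`-norm is already `O(b)`. -/
lemma lagSum_crude {q : ℝ} (hq : 1 ≤ q) {y : ℕ → Ω → ℝ} {K : ℝ}
    (hy : ∀ i, LpBound μ q (y i) K) {c : ℕ → ℝ} {v : ℝ}
    (hc : ∀ n, ∑ k ∈ Finset.range n, |c k| ≤ v) (i : ℕ) :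
    LpBound μ q (lagSum c y i) (v * K) := by
  refine (LpBound.sum hq (Finset.range i) fun j _ => (hy j).const_mul (c (i - j))).mono ?_
  rw [← Finset.sum_mul]
  refine mul_le_mul_of_nonneg_right ?_ (hy 0).nonneg
  rw [← Finset.sum_range_reflect]
  -- The lags run from `1` to `i`, so the bound on `range (i + 1)` is used and the lag `0` term
  -- dropped.
  refine le_trans ?_ (hc (i + 1))
  rw [Finset.sum_range_succ']
  refine le_trans (le_of_eq ?_) (le_add_of_nonneg_right (abs_nonneg _))
  refine Finset.sum_congr rfl fun j hj => ?_
  have := Finset.mem_range.1 hj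
  rw [show i - (i - 1 - j) = j + 1 by omega]

/-- The quadratic form `∑ y² + 2 ∑_{j < i} c (i - j) y j y i` minus `∑ D²`, up to the bias term
`2 (c 1 - 1) ∑ y u`, is of smaller order. -/
theorem quadratic_form_bound {p : ℝ} (hp : 1 < p) {F : ℕ → MeasurableSpace Ω} {K : ℝ}
    {y D u r D' u' r' : ℕ → Ω → ℝ} (H : MartApprox μ F (2 * p) K y D u r)
    (H' : MartApprox μ F (2 * p) K (fun i => u (i + 1)) D' u' r') (m : ℝ) (hm : 0 ≤ m) :
    ∃ C : ℝ, 0 ≤ C ∧ ∀ (c : ℕ → ℝ) (N n : ℕ) (b : ℝ), 1 ≤ N → 1 ≤ n → 0 ≤ b →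
      IsLagWeight c N m → |c 2 - c 1| ≤ m * b →
      (∀ k, ∑ i ∈ Finset.range k, |c (i + 2) - c (i + 1) - (c (i + 1) - c i)| ≤ m * b) →
      LpBound μ p (fun ω => ∑ i ∈ Finset.range n, (y i ω ^ 2 - D i ω ^ 2)
          + 2 * ∑ i ∈ Finset.range n, lagSum c y i ω * y i ω
          - 2 * (c 1 - 1) * ∑ i ∈ Finset.range n, y i ω * u (i + 1) ω)
        (C * ((n : ℝ) ^ max (1 / 2) (1 / p) * √N + n * b)) := by
  have hq : 2 ≤ 2 * p := by linarith
  have hp1 := hp.le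
  have hp0 : 0 < p := by linarith
  obtain ⟨A₁, hA₁, hmt⟩ := martingale_transform_moment (μ := μ) hp
  obtain ⟨A₂, hA₂, hlag⟩ := MartApprox.lagSum_bound (μ := μ) hq
  have hK : 0 ≤ K := (H.bound_u 0).nonneg
  -- A common constant for both families of lagged sums: `a`, the first difference of `c`, is a lag
  -- weight with constant `2 m`.
  set T := A₂ * K * (2 * m) with hT
  have hT0 : 0 ≤ T := by positivity
  refine ⟨10 * K ^ 2 + 2 * K ^ 2 + 2 * A₁ * K ^ 2 + 2 * K ^ 2
    + 2 * (A₁ * (T * K) + 2 * (T * K) + T * K) + 2 * (A₁ * (T * K) + 2 * (T * K) + T * K)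
    + 2 * (m * K ^ 2 + m * K ^ 2), by positivity, fun c N n b hN hn hb hc hc2 hcv => ?_⟩
  set M := (n : ℝ) ^ max (1 / 2) (1 / p) with hM
  have hn1 : (1 : ℝ) ≤ n := by exact_mod_cast hn
  have hsM : √(n : ℝ) ≤ M := by
    rw [Real.sqrt_eq_rpow]
    exact Real.rpow_le_rpow_of_exponent_le hn1 (le_max_left _ _)
  have hs1 : 1 ≤ √(n : ℝ) := Real.one_le_sqrt.2 hn1
  have hM1 : 1 ≤ M := hs1.trans hsM
  have hS1 : 1 ≤ √(N : ℝ) := Real.one_le_sqrt.2 (by exact_mod_cast hN)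
  set s := √(N : ℝ) with hs
  set a : ℕ → ℝ := fun k => c (k + 1) - c k with ha
  have hSb : ∀ i, LpBound μ (2 * p) (lagSum c y i) (T * s) := fun i =>
    (hlag F K y D u r H c N m hN hc i).mono (by
      rw [hT]
      have : 0 ≤ A₂ * K * m * s := by positivity
      nlinarith)
  have hSa : ∀ i, LpBound μ (2 * p) (lagSum a y i) (T * s) := fun i =>
    hlag F K y D u r H a N (2 * m) hN hc.diff i
  have hSm : ∀ c i, Measurable[F i] (lagSum c y i) := measurable_lagSum H.mono H.meas_y
  have hSd : ∀ i, LpBound μ (2 * p) (lagSum (fun k => a (k + 1) - a k) y i) (m * b * K) :=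
    lagSum_crude (by linarith) H.bound_y hcv
  -- the diagonal
  have d1 := LpBound.sum_range_mul_rem (n := n) hp1
    (fun i => (H.bound_y i).add (by linarith) (H.bound_u (i + 1))) H.bound_r hK
  have hr : ∀ i, LpBound μ (2 * p) (r i) K := fun i => (H.bound_r i).mono
    (div_le_self hK (Real.one_le_sqrt.2 (by simp)))
  have d2 := LpBound.sum_range_mul_rem (n := n) hp1 hr H.bound_r hK
  have d3 := hmt F D u K K H.mono H.le H.meas_D H.bound_D H.condExp H.meas_u H.bound_u n
  have d4 := (H.bound_u 0).mul hp0 (H.bound_u 0)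
  have d5 := (H.bound_u n).mul hp0 (H.bound_u n)
  -- the first expansion
  have e1 := hmt F D _ K (T * s) H.mono H.le H.meas_D H.bound_D H.condExp (hSm c) hSb n
  have e2 := LpBound.sum_range_mul_rem (n := n) hp1 hSb H.bound_r hK
  have e3 := (hSb n).mul hp0 (H.bound_u n)
  -- the second expansion
  have f1 := hmt F D' _ K (T * s) H'.mono H'.le H'.meas_D H'.bound_D H'.condExp (hSm a) hSa n
  have f2 := LpBound.sum_range_mul_rem (n := n) hp1 hSa H'.bound_r hK
  have f3 := (LpBound.sum_range_mul (n := n) hp1 H.bound_y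
    (fun i => H'.bound_u (i + 1))).const_mul (a 1)
  have f4 := LpBound.sum_range_mul (n := n) hp1 hSd (fun i => H'.bound_u (i + 1))
  have f5 := (hSa n).mul hp0 (H'.bound_u n)
  have tot := ((((((d1.const_mul 2).sub hp1 d2).add hp1 (d3.const_mul 2)).add hp1 d4).sub hp1
    d5).add hp1 (((e1.add hp1 e2).sub hp1 e3).const_mul 2)).add hp1
    (((((f1.add hp1 f2).add hp1 f3).add hp1 f4).sub hp1 f5).const_mul 2)
  have hfun : ∀ ω, 2 * ∑ i ∈ Finset.range n, (y i ω + u (i + 1) ω) * r i ω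
        - ∑ i ∈ Finset.range n, r i ω * r i ω
        + 2 * ∑ i ∈ Finset.range n, u i ω * D i ω + u 0 ω * u 0 ω - u n ω * u n ω
        + 2 * (∑ i ∈ Finset.range n, lagSum c y i ω * D i ω
          + ∑ i ∈ Finset.range n, lagSum c y i ω * r i ω - lagSum c y n ω * u n ω)
        + 2 * (∑ i ∈ Finset.range n, lagSum a y i ω * D' i ω
          + ∑ i ∈ Finset.range n, lagSum a y i ω * r' i ω
          + a 1 * ∑ i ∈ Finset.range n, y i ω * u' (i + 1) ω
          + ∑ i ∈ Finset.range n, lagSum (fun k => a (k + 1) - a k) y i ω * u' (i + 1) ω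
          - lagSum a y n ω * u' n ω) =
      ∑ i ∈ Finset.range n, (y i ω ^ 2 - D i ω ^ 2)
          + 2 * ∑ i ∈ Finset.range n, lagSum c y i ω * y i ω
          - 2 * (c 1 - 1) * ∑ i ∈ Finset.range n, y i ω * u (i + 1) ω := fun ω => by
    have g1 := sum_sq_add_two_mul y D u r H.eq n ω
    have g2 := sum_lagSum_mul c y D u r y H.eq n ω
    have g3 := sum_lagSum_mul a y D' u' r' _ H'.eq n ω
    rw [g2, ← ha]
    linear_combination -g1 - 2 * g3
  simp only [hfun] at tot
  refine tot.mono ?_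
  have x1 : √(n : ℝ) ≤ M * s := hsM.trans (le_mul_of_one_le_right (by linarith) hS1)
  have x2 : M ≤ M * s := le_mul_of_one_le_right (by linarith) hS1
  have x3 : 1 ≤ M * s := hM1.trans x2
  have x4 : √(n : ℝ) * s ≤ M * s := by gcongr
  have x5 : s ≤ M * s := le_mul_of_one_le_left (by linarith) hM1
  have x6 : 0 ≤ n * b := by positivity
  -- `a 1 = c 2 - c 1`: in the second expansion even the lag `1` term is small, so no further
  -- cancellation is required.
  have y1 : |a 1| ≤ m * b := hc2
  have y2 : |a 1| * (n * (K * K)) ≤ m * b * (n * (K * K)) := by gcongr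
  simp only [abs_two]
  have z1 := mul_le_mul_of_nonneg_left x1 (by positivity : 0 ≤ K ^ 2)
  have z2 := mul_le_mul_of_nonneg_left x2 (by positivity : 0 ≤ A₁ * K ^ 2)
  have z3 := mul_le_mul_of_nonneg_left x3 (by positivity : 0 ≤ K ^ 2)
  have z4 := mul_le_mul_of_nonneg_left x4 (by positivity : 0 ≤ T * K)
  have z5 := mul_le_mul_of_nonneg_left x5 (by positivity : 0 ≤ T * K)
  have z6 : 0 ≤ (10 * K ^ 2 + 2 * K ^ 2 + 2 * A₁ * K ^ 2 + 2 * K ^ 2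
    + 2 * (A₁ * (T * K) + 2 * (T * K) + T * K)
    + 2 * (A₁ * (T * K) + 2 * (T * K) + T * K)) * (n * b) := by positivity
  have z7 : 0 ≤ (2 * (m * K ^ 2 + m * K ^ 2)) * (M * s) := by positivity
  nlinarith

end Bounds

/-! ### Reduction of the kernel estimator to the quadratic form -/

lemma sum_Icc_one_eq_range (n : ℕ) (f : ℕ → ℝ) :
    ∑ j ∈ Finset.Icc 1 n, f j = ∑ j ∈ Finset.range n, f (j + 1) := by
  rw [Finset.range_eq_Ico, Finset.sum_Ico_add' f 0 n 1]
  rfl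

/-- Groups the pairs by their later index instead of by their lag; the induction on `n` adds all
pairs ending at `n`. -/
lemma sum_lag_products (c : ℕ → ℝ) (y : ℕ → ℝ) (n : ℕ) :
    ∑ k ∈ Finset.range n, c k * ∑ j ∈ Finset.range (n - k), y j * y (j + k) =
      c 0 * ∑ i ∈ Finset.range n, y i ^ 2
        + ∑ i ∈ Finset.range n, (∑ j ∈ Finset.range i, c (i - j) * y j) * y i := by
  induction n with
  | zero => simp
  | succ n ih =>
    have h1 : ∀ k ∈ Finset.range (n + 1),
        c k * ∑ j ∈ Finset.range (n + 1 - k), y j * y (j + k)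
          = c k * ∑ j ∈ Finset.range (n - k), y j * y (j + k) + c k * y (n - k) * y n := by
      intro k hk
      have := Finset.mem_range.1 hk
      rw [show n + 1 - k = n - k + 1 by omega, Finset.sum_range_succ,
        show n - k + k = n by omega]
      ring
    have h2 : ∑ k ∈ Finset.range (n + 1), c k * y (n - k) * y n
        = c 0 * y n ^ 2 + (∑ j ∈ Finset.range n, c (n - j) * y j) * y n := by
      rw [← Finset.sum_range_reflect, Finset.sum_range_succ, add_comm, Finset.sum_mul]
      congr 1
      · simp; ring
      · refine Finset.sum_congr rfl fun j hj => ?_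
        have := Finset.mem_range.1 hj
        rw [show n + 1 - 1 - j = n - j by omega, show n - (n - j) = j by omega]
    rw [Finset.sum_congr rfl h1, Finset.sum_add_distrib, h2, Finset.sum_range_succ _ n, ih]
    simp only [Finset.sum_range_succ _ n, Nat.sub_self, Finset.range_zero, Finset.sum_empty]
    ring

/-- The change of the `k`-th sample autocovariance of `y 0, …, y (n - 1)` when the variables are
centred at their sample mean. -/
def centringTerm {Ω : Type*} (y : ℕ → Ω → ℝ) (n k : ℕ) (ω : Ω) : ℝ :=
  (n : ℝ)⁻¹ * ((n - k : ℕ) * ((n : ℝ)⁻¹ * ∑ j ∈ Finset.range n, y j ω) ^ 2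
    - ((n : ℝ)⁻¹ * ∑ j ∈ Finset.range n, y j ω) * (∑ j ∈ Finset.range (n - k), y j ω
      + (∑ j ∈ Finset.range n, y j ω - ∑ j ∈ Finset.range k, y j ω)))

lemma sum_centred_products (y : ℕ → ℝ) (n k : ℕ) (hk : k ≤ n) (a : ℝ) :
    ∑ j ∈ Finset.range (n - k), (y j - a) * (y (j + k) - a) =
      ∑ j ∈ Finset.range (n - k), y j * y (j + k) + ((n - k : ℕ) * a ^ 2
        - a * (∑ j ∈ Finset.range (n - k), y j
          + (∑ j ∈ Finset.range n, y j - ∑ j ∈ Finset.range k, y j))) := by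
  have h1 : ∑ j ∈ Finset.range n, y j - ∑ j ∈ Finset.range k, y j
      = ∑ j ∈ Finset.range (n - k), y (j + k) := by
    rw [sub_eq_iff_eq_add, add_comm, ← Finset.sum_range_add_sum_Ico _ hk,
      Finset.sum_Ico_eq_sum_range]
    simp only [add_comm k]
  rw [h1]
  have h2 : ∀ j, (y j - a) * (y (j + k) - a)
      = y j * y (j + k) - a * y j - a * y (j + k) + a ^ 2 := fun j => by ring
  simp only [h2, Finset.sum_add_distrib, Finset.sum_sub_distrib, ← Finset.mul_sum,
    Finset.sum_const, Finset.card_range, nsmul_eq_mul]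
  ring

/-- The part of the kernel estimator that is due to centring at the sample mean. -/
def centringError {Ω : Type*} (c : ℕ → ℝ) (y : ℕ → Ω → ℝ) (n : ℕ) (ω : Ω) : ℝ :=
  2 * ∑ k ∈ Finset.range n, c k * centringTerm y n k ω - c 0 * centringTerm y n 0 ω

/-- Evenness folds the sum over `ℤ` into twice the sum over `k ≥ 0` minus the `k = 0` term, hence
the diagonal has weight `w 0` and the off-diagonal part weight `2`. The constant `a` is free, since
sample autocovariances are invariant under shifts of `h`. -/
lemma kernelEstimator_eq {Ω 𝕏 : Type*} (w : ℝ → ℝ) (hw : ∀ x, w (-x) = w x) (b : ℕ → ℝ)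
    (h : 𝕏 → ℝ) (X : ℕ → Ω → 𝕏) (a : ℝ) (n : ℕ) (hn : 1 ≤ n) (ω : Ω) :
    kernelEstimator w b h X n ω =
      (n : ℝ)⁻¹ * (w 0 * ∑ i ∈ Finset.range n, (h (X (i + 1) ω) - a) ^ 2
        + 2 * ∑ i ∈ Finset.range n, lagSum (fun k => w (k * b n))
          (fun i ω => h (X (i + 1) ω) - a) i ω * (h (X (i + 1) ω) - a))
      + centringError (fun k => w (k * b n)) (fun i ω => h (X (i + 1) ω) - a) n ω := by
  have hn0 : (n : ℝ) ≠ 0 := by positivity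
  set y : ℕ → Ω → ℝ := fun i ω => h (X (i + 1) ω) - a with hy
  set c : ℕ → ℝ := fun k => w (k * b n) with hc
  have hev : Function.Even (fun k : ℤ => w ((k : ℝ) * b n) * sampleAutocov h X n k ω) := by
    intro k
    simp only [sampleAutocov, Int.natAbs_neg, Int.cast_neg, neg_mul, hw]
  have hcov : ∀ k : ℕ, k < n → sampleAutocov h X n k ω =
      (n : ℝ)⁻¹ * ∑ j ∈ Finset.range (n - k), y j ω * y (j + k) ω + centringTerm y n k ω := by
    intro k hk
    have hm : sampleMean h X n ω = a + (n : ℝ)⁻¹ * ∑ j ∈ Finset.range n, y j ω := by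
      simp only [sampleMean, hy, sum_Icc_one_eq_range, Finset.sum_sub_distrib, Finset.sum_const,
        Finset.card_range, nsmul_eq_mul]
      field_simp; ring
    simp only [sampleAutocov, Int.natAbs_natCast, hk, if_true, sum_Icc_one_eq_range]
    have := sum_centred_products (fun j => y j ω) n k hk.le
      ((n : ℝ)⁻¹ * ∑ j ∈ Finset.range n, y j ω)
    rw [centringTerm, ← mul_add, ← this]
    congr 1
    refine Finset.sum_congr rfl fun j _ => ?_
    simp only [hm, hy]
    rw [show j + 1 + k = j + k + 1 by ring]
    ring
  have hlast : sampleAutocov h X n n ω = 0 := by simp [sampleAutocov]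
  rw [kernelEstimator, Finset.sum_Icc_of_even_eq_range hev, Finset.sum_range_succ]
  simp only [hlast, mul_zero, add_zero, Int.cast_natCast]
  have h1 : ∀ k ∈ Finset.range n, w ((k : ℝ) * b n) * sampleAutocov h X n k ω
      = (n : ℝ)⁻¹ * (c k * ∑ j ∈ Finset.range (n - k), y j ω * y (j + k) ω)
        + c k * centringTerm y n k ω := fun k hk => by
    rw [hcov k (Finset.mem_range.1 hk)]; simp only [hc]; ring
  have h0 := hcov 0 (by omega)
  have hc0 : c 0 = w 0 := by simp [hc]
  rw [Nat.cast_zero] at h0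
  rw [Finset.sum_congr rfl h1, Finset.sum_add_distrib, ← Finset.mul_sum,
    sum_lag_products c (fun j => y j ω) n, h0, centringError, hc0]
  simp only [Nat.sub_zero, add_zero, lagSum, nsmul_eq_mul, Nat.cast_ofNat, Int.cast_zero,
    zero_mul, ← sq]
  ring

section

variable {Ω : Type*} {m0 : MeasurableSpace Ω} {μ : Measure Ω} [IsProbabilityMeasure μ]

/-- The sample mean is `O(n^{-1/2})` and partial sums are `O(n^{1/2})` in `L^{2p}`, so each centring
term is `O(1/n)` in `L^p`; at most `N` lags have a nonzero weight. -/
theorem centringError_bound {p : ℝ} (hp : 1 < p) {F : ℕ → MeasurableSpace Ω} {K : ℝ}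
    {y D u r : ℕ → Ω → ℝ} (H : MartApprox μ F (2 * p) K y D u r) (m : ℝ) (hm : 0 ≤ m) :
    ∃ C : ℝ, 0 ≤ C ∧ ∀ (c : ℕ → ℝ) (N n : ℕ), 1 ≤ N → 1 ≤ n → IsLagWeight c N m →
      LpBound μ p (centringError c y n) (C * ((n : ℝ)⁻¹ * N)) := by
  have hp0 : 0 < p := by linarith
  have hp1 := hp.le
  obtain ⟨A, hA, hs⟩ := MartApprox.sum_bound (μ := μ) (q := 2 * p) (by linarith)
  have hK : 0 ≤ K := (H.bound_u 0).nonneg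
  set B := A * K with hB
  have hB0 : 0 ≤ B := by positivity
  refine ⟨3 * m * (4 * B ^ 2), by positivity, fun c N n hN hn hc => ?_⟩
  have hn1 : (1 : ℝ) ≤ n := by exact_mod_cast hn
  have hn0 : (0 : ℝ) < n := by positivity
  have hsum : ∀ k ≤ n, LpBound μ (2 * p) (fun ω => ∑ j ∈ Finset.range k, y j ω) (B * √n) :=
    fun k hk => (hs F K y D u r H k).mono (by gcongr)
  have hmean := (hsum n le_rfl).const_mul (n : ℝ)⁻¹
  have hterm : ∀ k, k < n → LpBound μ p (centringTerm y n k) ((n : ℝ)⁻¹ * (4 * B ^ 2)) := by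
    intro k hk
    have h1 := ((hmean.mul hp0 hmean).const_mul ((n - k : ℕ) : ℝ)).sub hp1
      (hmean.mul hp0 ((hsum (n - k) (Nat.sub_le _ _)).add (by linarith)
        ((hsum n le_rfl).sub (by linarith) (hsum k hk.le))))
    have h2 := h1.const_mul (n : ℝ)⁻¹
    have e : (fun ω => (n : ℝ)⁻¹ * ((n - k : ℕ) * (((n : ℝ)⁻¹ * ∑ j ∈ Finset.range n, y j ω)
        * ((n : ℝ)⁻¹ * ∑ j ∈ Finset.range n, y j ω))
        - ((n : ℝ)⁻¹ * ∑ j ∈ Finset.range n, y j ω) * (∑ j ∈ Finset.range (n - k), y j ω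
          + (∑ j ∈ Finset.range n, y j ω - ∑ j ∈ Finset.range k, y j ω))))
        = centringTerm y n k := by
      funext ω; rw [centringTerm, sq]
    rw [e] at h2
    refine h2.mono ?_
    rw [abs_of_nonneg (by positivity : (0 : ℝ) ≤ (n : ℝ)⁻¹), Nat.abs_cast]
    refine mul_le_mul_of_nonneg_left ?_ (by positivity)
    have h3 : √(n : ℝ) * √n = n := Real.mul_self_sqrt hn0.le
    have h4 : ((n - k : ℕ) : ℝ) ≤ n := by exact_mod_cast Nat.sub_le _ _
    have e1 : (n : ℝ)⁻¹ * (B * √n) * ((n : ℝ)⁻¹ * (B * √n)) = (n : ℝ)⁻¹ * B ^ 2 := by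
      calc _ = (n : ℝ)⁻¹ * (n : ℝ)⁻¹ * B ^ 2 * (√(n : ℝ) * √n) := by ring
        _ = _ := by rw [h3]; field_simp
    have e2 : (n : ℝ)⁻¹ * (B * √n) * (B * √n + (B * √n + B * √n)) = 3 * B ^ 2 := by
      calc _ = 3 * (n : ℝ)⁻¹ * B ^ 2 * (√(n : ℝ) * √n) := by ring
        _ = _ := by rw [h3]; field_simp
    rw [e1, e2]
    have h5 : ((n - k : ℕ) : ℝ) * ((n : ℝ)⁻¹ * B ^ 2) ≤ n * ((n : ℝ)⁻¹ * B ^ 2) := by gcongr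
    have h6 : (n : ℝ) * ((n : ℝ)⁻¹ * B ^ 2) = B ^ 2 := by field_simp
    linarith
  have htot := ((LpBound.sum hp1 (Finset.range n) fun k hk =>
    (hterm k (Finset.mem_range.1 hk)).const_mul (c k)).const_mul 2).sub hp1
    ((hterm 0 (by omega)).const_mul (c 0))
  refine htot.mono ?_
  rw [abs_two, ← Finset.sum_mul]
  have h1 : ∑ k ∈ Finset.range n, |c k| ≤ m * N := by
    calc ∑ k ∈ Finset.range n, |c k| ≤ ∑ k ∈ Finset.range (max n N), |c k| :=
          Finset.sum_le_sum_of_subset_of_nonneg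
            (Finset.range_subset_range.2 (le_max_left _ _)) fun _ _ _ => abs_nonneg _
      _ = ∑ k ∈ Finset.range N, |c k| := by
          symm
          refine Finset.sum_subset (Finset.range_subset_range.2 (le_max_right _ _))
            fun k _ hk => ?_
          rw [hc.eq_zero k (by simpa using hk), abs_zero]
      _ ≤ ∑ k ∈ Finset.range N, m := Finset.sum_le_sum fun k _ => hc.abs_le k
      _ = m * N := by simp [mul_comm]
  have hN1 : (1 : ℝ) ≤ N := by exact_mod_cast hN
  have h2 : |c 0| ≤ m * N := (hc.abs_le 0).trans (le_mul_of_one_le_right hm hN1)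
  have h3 : 0 ≤ (n : ℝ)⁻¹ * (4 * B ^ 2) := by positivity
  nlinarith

end

/-! ### Regularity of the lag window -/

lemma exists_lipschitz_Icc {f : ℝ → ℝ} (hf : ContDiffOn ℝ 1 f (Set.Icc 0 1)) :
    ∃ L : ℝ, 0 ≤ L ∧ ∀ x ∈ Set.Icc (0 : ℝ) 1, ∀ y ∈ Set.Icc (0 : ℝ) 1,
      |f y - f x| ≤ L * |y - x| := by
  have hu : UniqueDiffOn ℝ (Set.Icc (0 : ℝ) 1) := uniqueDiffOn_Icc zero_lt_one
  have hc : ContinuousOn (derivWithin f (Set.Icc 0 1)) (Set.Icc 0 1) :=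
    (hf.derivWithin hu (m := 0) (by norm_num)).continuousOn
  obtain ⟨L, hL⟩ := isCompact_Icc.exists_bound_of_continuousOn hc
  refine ⟨max L 0, le_max_right _ _, fun x hx y hy => ?_⟩
  exact (convex_Icc 0 1).norm_image_sub_le_of_norm_derivWithin_le
    (hf.differentiableOn (by norm_num)) (fun z hz => (hL z hz).trans (le_max_left _ _)) hx hy

/-- As `w 1 = 0`, `w z = w (min z 1)` on the half-line, so the Lipschitz bound on `[0, 1]` extends
even though `w'` may jump at `1`. -/
lemma IsLagWindow.exists_lipschitz {w : ℝ → ℝ} (hw : IsLagWindow w) :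
    ∃ L : ℝ, 0 ≤ L ∧ ∀ x y : ℝ, 0 ≤ x → 0 ≤ y → |w y - w x| ≤ L * |y - x| := by
  obtain ⟨L, hL0, hL⟩ := exists_lipschitz_Icc (hw.smooth.of_le (by norm_num))
  refine ⟨L, hL0, fun x y hx hy => ?_⟩
  have hmin : ∀ z : ℝ, 0 ≤ z → w z = w (min z 1) := fun z hz => by
    rcases le_total z 1 with h | h
    · rw [min_eq_left h]
    · rw [min_eq_right h, hw.support z (by rwa [abs_of_nonneg hz]), hw.support 1 (by simp)]
  rw [hmin x hx, hmin y hy]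
  refine (hL _ ⟨le_min hx zero_le_one, min_le_right _ _⟩ _
    ⟨le_min hy zero_le_one, min_le_right _ _⟩).trans ?_
  refine mul_le_mul_of_nonneg_left ?_ hL0
  have := abs_min_sub_min_le_max y 1 x 1
  simpa using this

/-- The mean value inequality for `z ↦ w (z + t) - w z` on `[x, x + t]`, whose derivative is at most
`M t` since `w'` is Lipschitz on `[0, 1]`. -/
lemma IsLagWindow.exists_second_diff {w : ℝ → ℝ} (hw : IsLagWindow w) :
    ∃ M : ℝ, 0 ≤ M ∧ ∀ x t : ℝ, 0 ≤ x → 0 ≤ t → x + 2 * t ≤ 1 →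
      |w (x + t + t) - w (x + t) - (w (x + t) - w x)| ≤ M * t ^ 2 := by
  have hu : UniqueDiffOn ℝ (Set.Icc (0 : ℝ) 1) := uniqueDiffOn_Icc zero_lt_one
  obtain ⟨M, hM0, hM⟩ := exists_lipschitz_Icc (hw.smooth.derivWithin hu (m := 1) (by norm_num))
  refine ⟨M, hM0, fun x t hx ht hxt => ?_⟩
  have hd : ∀ z ∈ Set.Icc (0 : ℝ) 1,
      HasDerivWithinAt w (derivWithin w (Set.Icc 0 1) z) (Set.Icc 0 1) z := fun z hz =>
    (hw.smooth.differentiableOn (by norm_num) z hz).hasDerivWithinAt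
  have hs : Set.Icc x (x + t) ⊆ Set.Icc 0 1 := Set.Icc_subset_Icc hx (by linarith)
  have hmem : ∀ z ∈ Set.Icc x (x + t), z + t ∈ Set.Icc (0 : ℝ) 1 := fun z hz =>
    ⟨by linarith [hz.1], by linarith [hz.2]⟩
  have hder : ∀ z ∈ Set.Icc x (x + t), HasDerivWithinAt (fun z => w (z + t) - w z)
      (derivWithin w (Set.Icc 0 1) (z + t) - derivWithin w (Set.Icc 0 1) z)
      (Set.Icc x (x + t)) z := fun z hz => by
    refine HasDerivWithinAt.sub ?_ ((hd z (hs hz)).mono hs)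
    have h1 : HasDerivWithinAt (fun z : ℝ => z + t) 1 (Set.Icc x (x + t)) z :=
      (hasDerivWithinAt_id z _).add_const t
    have := (hd (z + t) (hmem z hz)).comp z h1 hmem
    rw [mul_one] at this
    exact this
  have h := (convex_Icc x (x + t)).norm_image_sub_le_of_norm_hasDerivWithin_le (C := M * t) hder
    (fun z hz => ?_) (Set.left_mem_Icc.2 (by linarith)) (Set.right_mem_Icc.2 (by linarith))
  · simp only [Real.norm_eq_abs, add_sub_cancel_left, abs_of_nonneg ht] at h
    exact h.trans (le_of_eq (by ring))
  · have := hM z (hs hz) (z + t) (hmem z hz)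
    rwa [add_sub_cancel_left, abs_of_nonneg ht] at this

/-- Uniform properties of the lag weights `k ↦ w (k b)` for bandwidths `b ≤ B`. -/
theorem IsLagWindow.weights {w : ℝ → ℝ} (hw : IsLagWindow w) (B : ℝ) (hB : 0 ≤ B) :
    ∃ m : ℝ, 0 ≤ m ∧ ∀ b : ℝ, 0 < b → b ≤ B → ∃ N : ℕ, 1 ≤ N ∧ (N : ℝ) ≤ (1 + B) * b⁻¹ ∧
      IsLagWeight (fun k => w (k * b)) N m ∧
      |w ((1 : ℕ) * b) - 1| ≤ m * b ∧
      |w ((2 : ℕ) * b) - w ((1 : ℕ) * b)| ≤ m * b ∧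
      ∀ k, ∑ i ∈ Finset.range k, |w ((i + 2 : ℕ) * b) - w ((i + 1 : ℕ) * b)
        - (w ((i + 1 : ℕ) * b) - w (i * b))| ≤ m * b := by
  obtain ⟨L, hL0, hL⟩ := hw.exists_lipschitz
  obtain ⟨M, hM0, hM⟩ := hw.exists_second_diff
  refine ⟨L * (1 + B) + M * (1 + B) + 4 * L, by positivity, fun b hb hbB => ?_⟩
  set m := L * (1 + B) + M * (1 + B) + 4 * L with hm
  have hm0 : 0 ≤ m := by positivity
  have hLm : L ≤ m := by nlinarith [mul_nonneg hL0 hB, mul_nonneg hM0 hB]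
  have hstep : ∀ k : ℕ, |w ((k + 1 : ℕ) * b) - w (k * b)| ≤ L * b := fun k => by
    refine (hL _ _ (by positivity) (by positivity)).trans (le_of_eq ?_)
    rw [show ((k + 1 : ℕ) : ℝ) * b - k * b = b by push_cast; ring, abs_of_pos hb]
  have hinv : 0 < b⁻¹ := inv_pos.2 hb
  have hN1 : 1 ≤ ⌈b⁻¹⌉₊ := Nat.one_le_ceil_iff.2 hinv
  set N := ⌈b⁻¹⌉₊ with hN
  have hNle : (N : ℝ) * b ≤ 1 + B := by
    have h1 := (Nat.ceil_lt_add_one hinv.le).le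
    calc (N : ℝ) * b ≤ (b⁻¹ + 1) * b := by gcongr
      _ = 1 + b := by field_simp
      _ ≤ 1 + B := by linarith
  have hzero : ∀ k : ℕ, N ≤ k → w (k * b) = 0 := fun k hk => by
    refine hw.support _ ?_
    rw [abs_of_nonneg (by positivity)]
    have h1 : b⁻¹ ≤ k := (Nat.le_ceil _).trans (by exact_mod_cast hk)
    calc (1 : ℝ) = b⁻¹ * b := by field_simp
      _ ≤ k * b := by gcongr
  refine ⟨N, hN1, ?_, ⟨fun k => ?_, hzero, fun n => ?_⟩, ?_, (hstep 1).trans (by gcongr),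
    fun n => ?_⟩
  · rwa [← div_eq_mul_inv, le_div_iff₀ hb]
  · rcases le_total 1 ((k : ℝ) * b) with h | h
    · simp only [hw.support _ (h.trans (le_abs_self _)), abs_zero]; exact hm0
    · have h1 := hL 1 (k * b) zero_le_one (by positivity)
      rw [hw.support 1 (by simp), sub_zero] at h1
      refine h1.trans (le_trans ?_ hLm)
      refine mul_le_of_le_one_right hL0 ?_
      rw [abs_le]
      constructor <;> linarith [show 0 ≤ (k : ℝ) * b by positivity]
  · calc ∑ k ∈ Finset.range n, |w ((k + 1 : ℕ) * b) - w (k * b)|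
        ≤ ∑ k ∈ Finset.range (max n N), |w ((k + 1 : ℕ) * b) - w (k * b)| :=
          Finset.sum_le_sum_of_subset_of_nonneg
            (Finset.range_subset_range.2 (le_max_left _ _)) fun _ _ _ => abs_nonneg _
      _ = ∑ k ∈ Finset.range N, |w ((k + 1 : ℕ) * b) - w (k * b)| := by
          symm
          refine Finset.sum_subset (Finset.range_subset_range.2 (le_max_right _ _))
            fun k _ hk => ?_
          have hk : N ≤ k := by simpa using hk
          rw [hzero k hk, hzero (k + 1) (by omega), sub_zero, abs_zero]
      _ ≤ ∑ k ∈ Finset.range N, L * b := Finset.sum_le_sum fun k _ => hstep k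
      _ = L * (N * b) := by rw [Finset.sum_const, Finset.card_range, nsmul_eq_mul]; ring
      _ ≤ L * (1 + B) := by gcongr
      _ ≤ m := by rw [hm]; linarith [show 0 ≤ M * (1 + B) + 4 * L by positivity]
  · have := hstep 0
    simp only [Nat.cast_zero, zero_mul, hw.zero, zero_add] at this
    exact this.trans (by gcongr)
  · set f : ℕ → ℝ := fun i => |w ((i + 2 : ℕ) * b) - w ((i + 1 : ℕ) * b)
        - (w ((i + 1 : ℕ) * b) - w (i * b))| with hf
    have hf2 : ∀ i, f i ≤ 2 * (L * b) := fun i =>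
      (abs_sub _ _).trans (by linarith [hstep i, hstep (i + 1)])
    -- For these `i` all three points lie in `[0, 1]`, as `i + 2 < ⌈b⁻¹⌉`.
    have hfM : ∀ i, i < N - 2 → f i ≤ M * b ^ 2 := fun i hi => by
      have h1 : ((i + 2 : ℕ) : ℝ) * b ≤ 1 := by
        have : ((i + 2 : ℕ) : ℝ) < b⁻¹ := by
          rw [← Nat.lt_ceil]; omega
        calc ((i + 2 : ℕ) : ℝ) * b ≤ b⁻¹ * b := by gcongr
          _ = 1 := by field_simp
      have h2 := hM (i * b) b (by positivity) hb.le (by push_cast at h1; linarith)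
      refine le_trans (le_of_eq ?_) h2
      simp only [hf]
      push_cast
      ring_nf
    -- The smooth second differences contribute `N · M b² = O(b)`. At most two more, near the kink
    -- at `1`, are bounded by `2 L b` each. Since `N - 2 + 2 ≥ N` even when the subtraction
    -- truncates, all later ones vanish.
    calc ∑ i ∈ Finset.range n, f i ≤ ∑ i ∈ Finset.range (max n (N - 2 + 2)), f i :=
          Finset.sum_le_sum_of_subset_of_nonneg
            (Finset.range_subset_range.2 (le_max_left _ _)) fun _ _ _ => abs_nonneg _
      _ = ∑ i ∈ Finset.range (N - 2 + 2), f i := by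
          symm
          refine Finset.sum_subset (Finset.range_subset_range.2 (le_max_right _ _))
            fun k _ hk => ?_
          have hk : N - 2 + 2 ≤ k := by simpa using hk
          simp only [hf]
          rw [hzero k (by omega), hzero (k + 1) (by omega), hzero (k + 2) (by omega)]
          simp
      _ ≤ ∑ i ∈ Finset.range (N - 2), M * b ^ 2 + 2 * (L * b) + 2 * (L * b) := by
          rw [Finset.sum_range_succ, Finset.sum_range_succ]
          gcongr with i hi
          · exact hfM i (Finset.mem_range.1 hi)
          · exact hf2 _
          · exact hf2 _
      _ ≤ M * (N * b) * b + 4 * (L * b) := by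
          rw [Finset.sum_const, Finset.card_range, nsmul_eq_mul]
          have : ((N - 2 : ℕ) : ℝ) ≤ N := by exact_mod_cast Nat.sub_le _ _
          have : ((N - 2 : ℕ) : ℝ) * (M * b ^ 2) ≤ N * (M * b ^ 2) := by gcongr
          linarith
      _ ≤ M * (1 + B) * b + 4 * (L * b) := by gcongr
      _ ≤ m * b := by
          rw [hm]
          nlinarith [show 0 ≤ L * (1 + B) * b by positivity]

/-! ### Weighted norms and geometric ergodicity -/

lemma abs_le_of_wNorm_le {𝕏 : Type*} {W f : 𝕏 → ℝ} (hW : ∀ x, 1 ≤ W x) {δ : ℝ} (hδ : 0 ≤ δ)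
    (h : wNorm W f ≤ ENNReal.ofReal δ) (x : 𝕏) : |f x| ≤ δ * W x := by
  have h0 : 0 < W x := by linarith [hW x]
  have := (le_iSup (fun x => ENNReal.ofReal (|f x| / W x)) x).trans h
  rwa [ENNReal.ofReal_le_ofReal_iff hδ, div_le_iff₀ h0] at this

lemma wNorm_le_one {𝕏 : Type*} {W f : 𝕏 → ℝ} (hW : ∀ x, 1 ≤ W x) (h : ∀ x, |f x| ≤ W x) :
    wNorm W f ≤ 1 := by
  refine iSup_le fun x => ?_
  rw [ENNReal.ofReal_le_one, div_le_one (by linarith [hW x])]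
  exact h x

lemma abs_integral_sub_le_of_wDist_le {𝕏 : Type*} [MeasurableSpace 𝕏] {W : 𝕏 → ℝ}
    (hW : ∀ x, 1 ≤ W x) {μ ν : Measure 𝕏} {δ : ℝ} (hδ : 0 ≤ δ)
    (h : wDist W μ ν ≤ ENNReal.ofReal δ) {f : 𝕏 → ℝ} (hf : Measurable f) {M : ℝ} (hM : 0 ≤ M)
    (hb : ∀ x, |f x| ≤ M * W x) : |∫ y, f y ∂μ - ∫ y, f y ∂ν| ≤ M * δ := by
  rcases hM.eq_or_lt with rfl | hM
  · have : f = fun _ => 0 := funext fun x => by simpa using hb x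
    simp [this]
  have h1 : wNorm W (fun x => M⁻¹ * f x) ≤ 1 := wNorm_le_one hW fun x => by
    rw [abs_mul, abs_of_pos (inv_pos.2 hM), inv_mul_le_iff₀ hM]
    exact hb x
  have h2 := (le_iSup₂_of_le (f := fun (g : 𝕏 → ℝ) (_ : Measurable g) =>
    ⨆ (_ : wNorm W g ≤ 1), ENNReal.ofReal |∫ y, g y ∂μ - ∫ y, g y ∂ν|)
    (fun x => M⁻¹ * f x) (hf.const_mul _) (le_iSup_of_le h1 le_rfl)).trans h
  rw [ENNReal.ofReal_le_ofReal_iff hδ, integral_const_mul, integral_const_mul, ← mul_sub, abs_mul,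
    abs_of_pos (inv_pos.2 hM), inv_mul_le_iff₀ hM] at h2
  exact h2

lemma abs_integral_sub_le_of_kernelDist_le {𝕏 Θ : Type*} [MeasurableSpace 𝕏]
    {P : Θ → Kernel 𝕏 𝕏} {V : 𝕏 → ℝ} {β : ℝ} (hW : ∀ x, 1 ≤ V x ^ β) {s t : Θ} {δ : ℝ}
    (hδ : 0 ≤ δ) (h : kernelDist P V β s t ≤ ENNReal.ofReal δ) {f : 𝕏 → ℝ} (hf : Measurable f)
    {M : ℝ} (hM : 0 ≤ M) (hb : ∀ x, |f x| ≤ M * V x ^ β) (x : 𝕏) :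
    |∫ y, f y ∂(P s x) - ∫ y, f y ∂(P t x)| ≤ M * δ * V x ^ β := by
  rcases hM.eq_or_lt with rfl | hM
  · have : f = fun _ => 0 := funext fun x => by simpa using hb x
    simp [this]
  have h1 : wNorm (fun x => V x ^ β) (fun x => M⁻¹ * f x) ≤ 1 := wNorm_le_one hW fun x => by
    rw [abs_mul, abs_of_pos (inv_pos.2 hM), inv_mul_le_iff₀ hM]
    exact hb x
  have h2 := (le_iSup₂_of_le (f := fun (g : 𝕏 → ℝ) (_ : Measurable g) =>
    ⨆ (_ : wNorm (fun x => V x ^ β) g ≤ 1),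
      wNorm (fun x => V x ^ β) (fun x => ∫ y, g y ∂(P s x) - ∫ y, g y ∂(P t x)))
    (fun x => M⁻¹ * f x) (hf.const_mul _) (le_iSup_of_le h1 le_rfl)).trans h
  have h3 := abs_le_of_wNorm_le hW hδ h2 x
  rw [integral_const_mul, integral_const_mul, ← mul_sub, abs_mul,
    abs_of_pos (inv_pos.2 hM), inv_mul_le_iff₀ hM] at h3
  linarith

lemma integrable_of_integral_min_le {𝕏 : Type*} [MeasurableSpace 𝕏] {ν : Measure 𝕏}
    [IsFiniteMeasure ν] {V : 𝕏 → ℝ} (hV : Measurable V) (hV0 : ∀ x, 0 ≤ V x) {K : ℝ}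
    (h : ∀ n : ℕ, ∫ x, min (V x) n ∂ν ≤ K) : Integrable V ν := by
  refine ⟨hV.aestronglyMeasurable, ?_⟩
  rw [hasFiniteIntegral_iff_ofReal (ae_of_all _ hV0)]
  have h1 : ∀ x, ENNReal.ofReal (V x) = ⨆ n : ℕ, ENNReal.ofReal (min (V x) n) := fun x => by
    refine le_antisymm ?_ (iSup_le fun n => ENNReal.ofReal_le_ofReal (min_le_left _ _))
    obtain ⟨n, hn⟩ := exists_nat_ge (V x)
    exact le_iSup_of_le n (by rw [min_eq_left hn])
  have hm : ∀ n : ℕ, Measurable fun x => min (V x) (n : ℝ) := fun n => hV.min measurable_const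
  simp_rw [h1]
  rw [lintegral_iSup (fun n => (hm n).ennreal_ofReal)
    (fun m n hmn x => ENNReal.ofReal_le_ofReal (min_le_min le_rfl (by exact_mod_cast hmn)))]
  refine (iSup_le fun n => ?_ : _ ≤ ENNReal.ofReal K).trans_lt ENNReal.ofReal_lt_top
  have hi : Integrable (fun x => min (V x) (n : ℝ)) ν := by
    refine Integrable.of_bound (hm n).aestronglyMeasurable n (ae_of_all _ fun x => ?_)
    rw [Real.norm_of_nonneg (le_min (hV0 x) (Nat.cast_nonneg n))]
    exact min_le_right _ _
  rw [← ofReal_integral_eq_lintegral_ofReal hi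
    (ae_of_all _ fun x => le_min (hV0 x) (Nat.cast_nonneg n))]
  exact ENNReal.ofReal_le_ofReal (h n)

lemma isMarkovKernel_pow {𝕏 : Type*} [MeasurableSpace 𝕏] (κ : Kernel 𝕏 𝕏) [IsMarkovKernel κ]
    (n : ℕ) : IsMarkovKernel (κ ^ n) := by
  induction n with
  | zero => exact inferInstanceAs (IsMarkovKernel (Kernel.id : Kernel 𝕏 𝕏))
  | succ n ih => exact inferInstanceAs (IsMarkovKernel ((κ ^ n) ∘ₖ κ))

lemma integral_integral_of_invariant {𝕏 : Type*} [MeasurableSpace 𝕏] {κ : Kernel 𝕏 𝕏}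
    [IsMarkovKernel κ] {π : Measure 𝕏} [IsProbabilityMeasure π] (h : Kernel.Invariant κ π)
    {f : 𝕏 → ℝ} (hf : Integrable f π) :
    Integrable (fun x => ∫ y, f y ∂(κ x)) π ∧ ∫ x, ∫ y, f y ∂(κ x) ∂π = ∫ x, f x ∂π := by
  have h1 : (κ ∘ₖ Kernel.const Unit π) () = π := by
    rw [← Measure.comp_eq_comp_const_apply]; exact h.def
  have hf' : Integrable f ((κ ∘ₖ Kernel.const Unit π) ()) := by rwa [h1]
  have h2 := Kernel.integral_comp hf'
  have h3 := hf'.integral_comp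
  rw [h1] at h2
  simp only [Kernel.const_apply] at h2 h3
  exact ⟨h3, h2.symm⟩

/-- Geometric ergodicity in `W`-norm of a family of kernels, expressed through the iterates of the
centred operators. -/
structure UniformlyErgodic {𝕏 Θ : Type*} [MeasurableSpace 𝕏] (P : Θ → Kernel 𝕏 𝕏)
    (π : Measure 𝕏) (W : 𝕏 → ℝ) (ρ C : ℝ) : Prop where
  meas : Measurable W
  one_le : ∀ x, 1 ≤ W x
  ρ_pos : 0 < ρ
  ρ_lt : ρ < 1
  C_pos : 0 < C
  integrable : Integrable W π
  integrable_kernel : ∀ t x, Integrable W (P t x)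
  invariant : ∀ t, Kernel.Invariant (P t) π
  rate : ∀ t (f : 𝕏 → ℝ) (M : ℝ), Measurable f → 0 ≤ M → (∀ x, |f x| ≤ M * W x) →
    ∫ y, f y ∂π = 0 → ∀ n x, |(centred (P t) π)^[n] f x| ≤ M * C * ρ ^ n * W x

lemma integrable_of_abs_le_mul {𝕏 : Type*} [MeasurableSpace 𝕏] {ν : Measure 𝕏} {W f : 𝕏 → ℝ}
    (hW : Integrable W ν) (hf : Measurable f) {M : ℝ} (h : ∀ x, |f x| ≤ M * W x) :
    Integrable f ν :=
  (hW.const_mul M).mono' hf.aestronglyMeasurable (ae_of_all _ h)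

/-- Bochner integrals of non-integrable functions are `0`, so the rate says nothing about `V` until
`V` is known to be integrable. This is first obtained from the truncations `min V k`, which are
always integrable, and monotone convergence. -/
theorem GeomErgodic.uniformlyErgodic {𝕏 Θ : Type*} [MeasurableSpace 𝕏] [MeasurableSpace Θ]
    {P : Θ → Kernel 𝕏 𝕏} [∀ t, IsMarkovKernel (P t)] {π : Measure 𝕏} [IsProbabilityMeasure π]
    {μ₀ : Measure (𝕏 × Θ)} [IsProbabilityMeasure μ₀] {V : 𝕏 → ℝ} (hV : GeomErgodic P π μ₀ V)
    {β : ℝ} (hβ : 0 < β) (hβ1 : β ≤ 1) :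
    ∃ ρ C : ℝ, UniformlyErgodic P π (fun x => V x ^ β) ρ C := by
  have hV0 : ∀ x, 0 ≤ V x := fun x => by linarith [hV.one_le_V x]
  have hW1 : ∀ x, 1 ≤ V x ^ β := fun x => Real.one_le_rpow (hV.one_le_V x) hβ.le
  have hWV : ∀ x, V x ^ β ≤ V x := fun x =>
    Real.rpow_le_self_of_one_le (hV.one_le_V x) hβ1
  have hWm : Measurable fun x => V x ^ β := hV.measurable_V.pow_const β
  obtain ⟨x₀, t₀⟩ : Nonempty (𝕏 × Θ) := by
    by_contra hne
    rw [not_nonempty_iff] at hne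
    have := measure_univ (μ := μ₀)
    simp [Set.univ_eq_empty_iff.2 hne] at this
  have hpow : ∀ t n, IsMarkovKernel (P t ^ n) := fun t n => isMarkovKernel_pow _ _
  have hp0 : ∀ t x, (P t ^ 0) x = Measure.dirac x := fun t x => Kernel.id_apply x
  obtain ⟨ρ₁, C₁, hρ₁, hρ₁', hC₁, hr₁⟩ := hV.rate 1 one_pos le_rfl
  have htr : ∀ x t n, ∀ k : ℕ, |∫ y, min (V y) k ∂((P t ^ n) x) - ∫ y, min (V y) k ∂π|
      ≤ 1 * (C₁ * ρ₁ ^ n * V x ^ (1 : ℝ)) := fun x t n k => by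
    have hx := hV0 x
    refine abs_integral_sub_le_of_wDist_le (W := fun y => V y ^ (1 : ℝ))
      (fun y => by simpa using hV.one_le_V y) (by positivity) (hr₁ x t n)
      (hV.measurable_V.min measurable_const) zero_le_one fun y => ?_
    rw [abs_of_nonneg (le_min (hV0 y) (Nat.cast_nonneg k)), Real.rpow_one, one_mul]
    exact min_le_left _ _
  -- The rate at `n = 0` compares `π` with a Dirac mass, which bounds the truncated integrals by a
  -- finite number independent of `k`.
  have hπ : Integrable V π := by
    refine integrable_of_integral_min_le hV.measurable_V hV0 (K := V x₀ + C₁ * V x₀) fun k => ?_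
    have h1 := (abs_le.1 (htr x₀ t₀ 0 k)).1
    rw [hp0, integral_dirac' _ _ (hV.measurable_V.min measurable_const).stronglyMeasurable] at h1
    simp only [pow_zero, mul_one, Real.rpow_one, one_mul] at h1
    linarith [min_le_left (V x₀) (k : ℝ)]
  have hPn : ∀ t n x, Integrable V ((P t ^ n) x) := fun t n x => by
    refine integrable_of_integral_min_le hV.measurable_V hV0
      (K := ∫ y, V y ∂π + 1 * (C₁ * ρ₁ ^ n * V x ^ (1 : ℝ))) fun k => ?_
    have h1 := (abs_le.1 (htr x t n k)).2
    have h2 : ∫ y, min (V y) k ∂π ≤ ∫ y, V y ∂π := by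
      refine integral_mono_of_nonneg (ae_of_all _ fun y => le_min (hV0 y) (Nat.cast_nonneg k)) hπ
        (ae_of_all _ fun y => min_le_left _ _)
    linarith
  have hle : ∀ x, |V x ^ β| ≤ 1 * V x := fun x => by
    rw [one_mul, abs_of_nonneg (Real.rpow_nonneg (hV0 x) _)]; exact hWV x
  have hWπ := integrable_of_abs_le_mul hπ hWm hle
  have hWn : ∀ t n x, Integrable (fun x => V x ^ β) ((P t ^ n) x) := fun t n x =>
    integrable_of_abs_le_mul (hPn t n x) hWm hle
  obtain ⟨ρ, C, hρ, hρ', hC, hr⟩ := hV.rate β hβ hβ1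
  refine ⟨ρ, C, hWm, hW1, hρ, hρ', hC, hWπ, fun t x => by simpa using hWn t 1 x, hV.invariant,
    fun t f M hf hM hb h0 n x => ?_⟩
  -- Invariance keeps the `π`-mean of the iterates at zero, so on centred functions `P̄^n` coincides
  -- with `P^n`.
  have hiter : ∀ n, (centred (P t) π)^[n] f = (fun x => ∫ y, f y ∂((P t ^ n) x)) ∧
      Integrable ((centred (P t) π)^[n] f) π ∧ ∫ x, (centred (P t) π)^[n] f x ∂π = 0 := by
    intro n
    induction n with
    | zero =>
      refine ⟨?_, integrable_of_abs_le_mul hWπ hf hb, h0⟩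
      funext x
      rw [hp0, integral_dirac' _ _ hf.stronglyMeasurable]
      rfl
    | succ n ih =>
      obtain ⟨h1, h2, h3⟩ := ih
      have h4 := integral_integral_of_invariant (hV.invariant t) h2
      have h5 : (centred (P t) π)^[n + 1] f
          = fun x => ∫ y, (centred (P t) π)^[n] f y ∂(P t x) := by
        funext x
        rw [Function.iterate_succ_apply', centred, h3, sub_zero]
      rw [h5]
      refine ⟨?_, h4.1, h4.2.trans h3⟩
      funext x
      have h6 : P t ^ (n + 1) = (P t ^ n) ∘ₖ (P t) := pow_succ _ _
      have h7 : Integrable f ((P t ^ (n + 1)) x) := integrable_of_abs_le_mul (hWn t _ x) hf hb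
      rw [h6] at h7 ⊢
      rw [Kernel.integral_comp h7, h1]
  rw [(hiter n).1]
  have hx := hV0 x
  have := abs_integral_sub_le_of_wDist_le hW1 (by positivity) (hr x t n) hf hM hb
  rw [h0, sub_zero] at this
  refine this.trans (le_of_eq (by ring))

/-- A parametrised function `f t x` that is jointly measurable, `π`-centred, bounded by a multiple
of `V ^ β` and Lipschitz in the parameter with respect to `kernelDist P V β`. -/
structure IsLipschitzField {𝕏 Θ : Type*} [MeasurableSpace 𝕏] [MeasurableSpace Θ]
    (P : Θ → Kernel 𝕏 𝕏) (π : Measure 𝕏) (V : 𝕏 → ℝ) (β M : ℝ) (f : Θ → 𝕏 → ℝ) : Prop where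
  meas : Measurable (Function.uncurry f)
  nonneg : 0 ≤ M
  bound : ∀ t x, |f t x| ≤ M * V x ^ β
  mean : ∀ t, ∫ x, f t x ∂π = 0
  lipschitz : ∀ s t δ, 0 ≤ δ → kernelDist P V β s t ≤ ENNReal.ofReal δ →
    ∀ x, |f s x - f t x| ≤ M * δ * V x ^ β

/-! ### The Poisson equation and its dependence on the parameter -/

section Resolvent

set_option linter.unusedSectionVars false

variable {𝕏 Θ : Type*} [MeasurableSpace 𝕏] [MeasurableSpace Θ] {P : Θ → Kernel 𝕏 𝕏}
  [∀ t, IsMarkovKernel (P t)] {π : Measure 𝕏} [IsProbabilityMeasure π] {W V : 𝕏 → ℝ}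
  {ρ C β M : ℝ}

/-- The kernels `P t` as one kernel in `(t, x)`. -/
def jointKernel (P : Θ → Kernel 𝕏 𝕏)
    (hP : ∀ A : Set 𝕏, MeasurableSet A → Measurable (fun q : Θ × 𝕏 => P q.1 q.2 A)) :
    Kernel (Θ × 𝕏) 𝕏 where
  toFun q := P q.1 q.2
  measurable' := Measure.measurable_of_measurable_coe _ hP

lemma jointKernel_apply (hP : ∀ A : Set 𝕏, MeasurableSet A →
    Measurable (fun q : Θ × 𝕏 => P q.1 q.2 A)) (q : Θ × 𝕏) :
    jointKernel P hP q = P q.1 q.2 := rfl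

instance (hP : ∀ A : Set 𝕏, MeasurableSet A →
    Measurable (fun q : Θ × 𝕏 => P q.1 q.2 A)) : IsMarkovKernel (jointKernel P hP) :=
  ⟨fun q => by rw [jointKernel_apply]; infer_instance⟩

lemma measurable_centred (hP : ∀ A : Set 𝕏, MeasurableSet A →
    Measurable (fun q : Θ × 𝕏 => P q.1 q.2 A)) {f : Θ → 𝕏 → ℝ}
    (hf : Measurable (Function.uncurry f)) :
    Measurable (Function.uncurry fun t => centred (P t) π (f t)) := by
  have h1 : StronglyMeasurable fun q : Θ × 𝕏 => ∫ y, f q.1 y ∂(jointKernel P hP q) := by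
    refine StronglyMeasurable.integral_kernel_prod_right
      (f := fun (q : Θ × 𝕏) (y : 𝕏) => f q.1 y) (Measurable.stronglyMeasurable ?_)
    exact hf.comp (measurable_fst.fst.prodMk measurable_snd)
  have h2 : StronglyMeasurable fun t : Θ => ∫ y, f t y ∂π :=
    StronglyMeasurable.integral_prod_right hf.stronglyMeasurable
  exact h1.measurable.sub (h2.measurable.comp measurable_fst)

lemma measurable_centred_iterate (hP : ∀ A : Set 𝕏, MeasurableSet A →
    Measurable (fun q : Θ × 𝕏 => P q.1 q.2 A)) {f : Θ → 𝕏 → ℝ}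
    (hf : Measurable (Function.uncurry f)) (n : ℕ) :
    Measurable (Function.uncurry fun t => (centred (P t) π)^[n] (f t)) := by
  induction n with
  | zero => exact hf
  | succ n ih =>
    simp only [Function.iterate_succ_apply']
    exact measurable_centred hP ih

lemma UniformlyErgodic.summable (h : UniformlyErgodic P π W ρ C) {f : 𝕏 → ℝ} (hf : Measurable f)
    (hM : 0 ≤ M) (hb : ∀ x, |f x| ≤ M * W x) (h0 : ∫ y, f y ∂π = 0) (t : Θ) (x : 𝕏) :
    Summable fun j => (centred (P t) π)^[j] f x :=
  Summable.of_norm_bounded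
    (((summable_geometric_of_lt_one h.ρ_pos.le h.ρ_lt).mul_left (M * C)).mul_right (W x))
    fun j => h.rate t f M hf hM hb h0 j x

lemma UniformlyErgodic.abs_resolvent_le (h : UniformlyErgodic P π W ρ C) {f : 𝕏 → ℝ}
    (hf : Measurable f) (hM : 0 ≤ M) (hb : ∀ x, |f x| ≤ M * W x) (h0 : ∫ y, f y ∂π = 0) (t : Θ)
    (x : 𝕏) : |resolvent (P t) π f x| ≤ M * (C * (1 - ρ)⁻¹) * W x := by
  have h1 := ((hasSum_geometric_of_lt_one h.ρ_pos.le h.ρ_lt).mul_left (M * C)).mul_right (W x)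
  have h2 : ‖∑' j, (centred (P t) π)^[j] f x‖ ≤ _ := tsum_of_norm_bounded h1 fun j => by
    rw [Real.norm_eq_abs]
    exact h.rate t f M hf hM hb h0 j x
  rw [Real.norm_eq_abs] at h2
  exact h2.trans (le_of_eq (by ring))

/-- Centred solutions of the Poisson equation are unique: iterating gives `∑_{j<n} P̄^j ψ = φ - P̄^n
φ`, and `P̄^n φ → 0`. Thus `φ` is the resolvent of `ψ` and inherits its bound; the a priori constant
`K` does not enter. -/
lemma UniformlyErgodic.abs_le_of_poisson (h : UniformlyErgodic P π W ρ C) (t : Θ)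
    {φ ψ : 𝕏 → ℝ} (hφ : Measurable φ) {K : ℝ} (hK : 0 ≤ K) (hφb : ∀ x, |φ x| ≤ K * W x)
    (hφ0 : ∫ y, φ y ∂π = 0) (hψ : Measurable ψ) (hM : 0 ≤ M) (hψb : ∀ x, |ψ x| ≤ M * W x)
    (hψ0 : ∫ y, ψ y ∂π = 0) (heq : ∀ x, ∫ y, φ y ∂(P t x) = φ x - ψ x) (x : 𝕏) :
    |φ x| ≤ M * (C * (1 - ρ)⁻¹) * W x := by
  have hcent : centred (P t) π φ = fun x => φ x - ψ x := by
    funext x; rw [centred, hφ0, sub_zero, heq]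
  have hlin : ∀ n, ∀ x, (centred (P t) π)^[n] (fun x => φ x - ψ x) x
      = (centred (P t) π)^[n] φ x - (centred (P t) π)^[n] ψ x := by
    have key : ∀ n, (∀ x, (centred (P t) π)^[n] (fun x => φ x - ψ x) x
        = (centred (P t) π)^[n] φ x - (centred (P t) π)^[n] ψ x) ∧
        Measurable ((centred (P t) π)^[n] φ) ∧ Measurable ((centred (P t) π)^[n] ψ) := by
      intro n
      induction n with
      | zero => exact ⟨fun x => rfl, hφ, hψ⟩
      | succ n ih =>
        obtain ⟨ih, m1, m2⟩ := ih
        have b1 : ∀ x, |(centred (P t) π)^[n] φ x| ≤ (K * C * ρ ^ n) * W x :=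
          h.rate t φ K hφ hK hφb hφ0 n
        have b2 : ∀ x, |(centred (P t) π)^[n] ψ x| ≤ (M * C * ρ ^ n) * W x :=
          h.rate t ψ M hψ hM hψb hψ0 n
        simp only [Function.iterate_succ_apply']
        refine ⟨fun x => ?_, ?_, ?_⟩
        · rw [show (centred (P t) π)^[n] (fun x => φ x - ψ x)
            = fun x => (centred (P t) π)^[n] φ x - (centred (P t) π)^[n] ψ x from funext ih]
          have i1 := integrable_of_abs_le_mul (h.integrable_kernel t x) m1 b1
          have i2 := integrable_of_abs_le_mul (h.integrable_kernel t x) m2 b2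
          have i3 := integrable_of_abs_le_mul h.integrable m1 b1
          have i4 := integrable_of_abs_le_mul h.integrable m2 b2
          simp only [centred]
          rw [integral_sub i1 i2, integral_sub i3 i4]
          ring
        · exact (m1.stronglyMeasurable.integral_kernel (κ := P t)).measurable.sub_const _
        · exact (m2.stronglyMeasurable.integral_kernel (κ := P t)).measurable.sub_const _
    exact fun n => (key n).1
  have hpart : ∀ n, ∑ j ∈ Finset.range n, (centred (P t) π)^[j] ψ x
      = φ x - (centred (P t) π)^[n] φ x := by
    intro n
    induction n with
    | zero => simp
    | succ n ih =>
      rw [Finset.sum_range_succ, ih, Function.iterate_succ_apply, hcent, hlin]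
      ring
  have hlim : Tendsto (fun n => (centred (P t) π)^[n] φ x) atTop (𝓝 0) :=
    (h.summable hφ hK hφb hφ0 t x).tendsto_atTop_zero
  have hsum := (h.summable hψ hM hψb hψ0 t x).hasSum.tendsto_sum_nat
  simp only [hpart] at hsum
  have h2 := tendsto_nhds_unique hsum (tendsto_const_nhds.sub hlim)
  rw [sub_zero] at h2
  rw [← h2]
  exact h.abs_resolvent_le hψ hM hψb hψ0 t x

lemma IsLipschitzField.sub {f g : Θ → 𝕏 → ℝ} {M' : ℝ} (hW : UniformlyErgodic P π (fun x => V x ^ β) ρ C)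
    (hf : IsLipschitzField P π V β M f) (hg : IsLipschitzField P π V β M' g) :
    IsLipschitzField P π V β (M + M') (fun t x => f t x - g t x) := by
  have mf : ∀ t, Measurable (f t) := fun t => hf.meas.comp measurable_prodMk_left
  have mg : ∀ t, Measurable (g t) := fun t => hg.meas.comp measurable_prodMk_left
  refine ⟨hf.meas.sub hg.meas, add_nonneg hf.nonneg hg.nonneg, fun t x => ?_, fun t => ?_,
    fun s t δ hδ hd x => ?_⟩
  · rw [add_mul]
    exact (abs_sub _ _).trans (add_le_add (hf.bound t x) (hg.bound t x))
  · rw [integral_sub (integrable_of_abs_le_mul hW.integrable (mf t) (hf.bound t))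
      (integrable_of_abs_le_mul hW.integrable (mg t) (hg.bound t)), hf.mean, hg.mean, sub_zero]
  · rw [show f s x - g s x - (f t x - g t x) = (f s x - f t x) - (g s x - g t x) by ring,
      add_mul, add_mul]
    exact (abs_sub _ _).trans
      (add_le_add (hf.lipschitz s t δ hδ hd x) (hg.lipschitz s t δ hδ hd x))

/-- The resolvent solves the Poisson equation. -/
lemma UniformlyErgodic.integral_resolvent (hP : ∀ A : Set 𝕏, MeasurableSet A →
    Measurable (fun q : Θ × 𝕏 => P q.1 q.2 A)) (h : UniformlyErgodic P π W ρ C) {f : 𝕏 → ℝ}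
    (hf : Measurable f) (hM : 0 ≤ M) (hb : ∀ x, |f x| ≤ M * W x) (h0 : ∫ y, f y ∂π = 0) (t : Θ) :
    (∀ x, ∫ y, resolvent (P t) π f y ∂(P t x) = resolvent (P t) π f x - f x) ∧
      ∫ y, resolvent (P t) π f y ∂π = 0 := by
  have hm : ∀ n, Measurable ((centred (P t) π)^[n] f) := fun n =>
    (measurable_centred_iterate (π := π) hP (f := fun _ => f) (hf.comp measurable_snd) n).comp
      measurable_prodMk_left
  have hr := h.rate t f M hf hM hb h0
  have hint : ∀ ν : Measure 𝕏, Integrable W ν →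
      ∫ y, resolvent (P t) π f y ∂ν = ∑' n, ∫ y, (centred (P t) π)^[n] f y ∂ν := by
    intro ν hν
    have hi : ∀ n, Integrable ((centred (P t) π)^[n] f) ν := fun n =>
      integrable_of_abs_le_mul hν (hm n) (hr n)
    refine ((hasSum_integral_of_summable_integral_norm hi ?_).tsum_eq).symm
    refine Summable.of_nonneg_of_le (fun n => integral_nonneg fun _ => norm_nonneg _) (fun n => ?_)
      (((summable_geometric_of_lt_one h.ρ_pos.le h.ρ_lt).mul_left (M * C)).mul_right
        (∫ y, W y ∂ν))
    rw [← integral_const_mul]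
    exact integral_mono (hi n).norm (hν.const_mul _) fun y => hr n y
  have hmean : ∀ n, ∫ y, (centred (P t) π)^[n] f y ∂π = 0 := by
    intro n
    induction n with
    | zero => exact h0
    | succ n ih =>
      simp only [Function.iterate_succ_apply']
      have hi := integrable_of_abs_le_mul h.integrable (hm n) (hr n)
      have h4 := integral_integral_of_invariant (h.invariant t) hi
      simp only [centred] at h4 ih ⊢
      rw [integral_sub h4.1 (integrable_const _), h4.2, ih]
      simp
  constructor
  · intro x
    rw [hint _ (h.integrable_kernel t x), resolvent, (h.summable hf hM hb h0 t x).tsum_eq_zero_add]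
    simp only [Function.iterate_zero, id_eq, add_sub_cancel_left]
    refine tsum_congr fun n => ?_
    rw [Function.iterate_succ_apply', centred, hmean, sub_zero]
  · rw [hint _ h.integrable]
    simp [hmean]

/-- Subtracting the Poisson equations for `s` and `t` shows that `g s - g t` solves the one for `P
s` with right-hand side `(f s - f t) + (P s - P t) g t`. It is centred because `π` is invariant for
both kernels, and small by the Lipschitz bound on `f` and the definition of `kernelDist`. -/
theorem IsLipschitzField.resolvent (hP : ∀ A : Set 𝕏, MeasurableSet A →
    Measurable (fun q : Θ × 𝕏 => P q.1 q.2 A)) (h : UniformlyErgodic P π (fun x => V x ^ β) ρ C)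
    {f : Θ → 𝕏 → ℝ} (hf : IsLipschitzField P π V β M f) :
    ∃ M', IsLipschitzField P π V β M' (fun t => resolvent (P t) π (f t)) ∧
      ∀ t x, ∫ y, AdaptiveMC.resolvent (P t) π (f t) y ∂(P t x)
        = AdaptiveMC.resolvent (P t) π (f t) x - f t x := by
  have mf : ∀ t, Measurable (f t) := fun t => hf.meas.comp measurable_prodMk_left
  have hM := hf.nonneg
  have hρ : 0 < (1 - ρ)⁻¹ := inv_pos.2 (by linarith [h.ρ_lt])
  have hC := h.C_pos
  set A := C * (1 - ρ)⁻¹ with hA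
  have hA0 : 0 < A := by positivity
  have hpois := fun t => h.integral_resolvent hP (mf t) hM (hf.bound t) (hf.mean t) t
  have hb := fun t => h.abs_resolvent_le (mf t) hM (hf.bound t) (hf.mean t) t
  have hmeas : Measurable (Function.uncurry fun t => AdaptiveMC.resolvent (P t) π (f t)) := by
    refine measurable_of_tendsto_metrizable (f := fun n (q : Θ × 𝕏) =>
      ∑ j ∈ Finset.range n, (centred (P q.1) π)^[j] (f q.1) q.2)
      (fun n => Finset.measurable_fun_sum _ fun j _ => measurable_centred_iterate hP hf.meas j) ?_
    rw [tendsto_pi_nhds]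
    intro q
    exact (h.summable (mf q.1) hM (hf.bound q.1) (hf.mean q.1) q.1 q.2).hasSum.tendsto_sum_nat
  have mg : ∀ t, Measurable (AdaptiveMC.resolvent (P t) π (f t)) := fun t =>
    hmeas.comp measurable_prodMk_left
  -- The first summand serves the sup bound, the second the Lipschitz bound.
  refine ⟨M * A + (M + M * A) * A, ⟨hmeas, by positivity, fun t x => ?_, fun t => (hpois t).2,
    fun s t δ hδ hd x => ?_⟩, fun t x => (hpois t).1 x⟩
  · have hx : 0 ≤ V x ^ β := by linarith [h.one_le x]
    refine (hb t x).trans ?_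
    have : 0 ≤ (M + M * A) * A * V x ^ β := by positivity
    linarith
  · set g := fun t => AdaptiveMC.resolvent (P t) π (f t) with hg
    have ig : ∀ t, Integrable (g t) π := fun t =>
      integrable_of_abs_le_mul h.integrable (mg t) (hb t)
    have igk : ∀ t s x, Integrable (g t) (P s x) := fun t s x =>
      integrable_of_abs_le_mul (h.integrable_kernel s x) (mg t) (hb t)
    -- `g s - g t` solves a Poisson equation for `P s` with a small right-hand side
    set ψ : 𝕏 → ℝ := fun x => (f s x - f t x)
      + (∫ y, g t y ∂(P s x) - ∫ y, g t y ∂(P t x)) with hψ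
    have hψm : Measurable ψ := ((mf s).sub (mf t)).add
      (((mg t).stronglyMeasurable.integral_kernel (κ := P s)).measurable.sub
        ((mg t).stronglyMeasurable.integral_kernel (κ := P t)).measurable)
    have hψb : ∀ x, |ψ x| ≤ ((M + M * A) * δ) * V x ^ β := fun x => by
      have h1 := hf.lipschitz s t δ hδ hd x
      have h2 := abs_integral_sub_le_of_kernelDist_le h.one_le hδ hd (mg t)
        (by positivity) (hb t) x
      refine (abs_add_le _ _).trans ?_
      linarith
    have hψ0 : ∫ y, ψ y ∂π = 0 := by
      have j1 := integral_integral_of_invariant (h.invariant s) (ig t)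
      have j2 := integral_integral_of_invariant (h.invariant t) (ig t)
      have k1 := integrable_of_abs_le_mul h.integrable (mf s) (hf.bound s)
      have k2 := integrable_of_abs_le_mul h.integrable (mf t) (hf.bound t)
      have k3 : Integrable (fun x => f s x - f t x) π := k1.sub k2
      have j3 : Integrable (fun x => ∫ y, g t y ∂(P s x) - ∫ y, g t y ∂(P t x)) π :=
        j1.1.sub j2.1
      simp only [hψ]
      rw [integral_add k3 j3, integral_sub k1 k2,
        integral_sub j1.1 j2.1, j1.2, j2.2, hf.mean, hf.mean]
      ring
    have hφb : ∀ x, |g s x - g t x| ≤ (M * A + M * A) * V x ^ β := fun x => by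
      rw [add_mul]
      exact (abs_sub _ _).trans (add_le_add (hb s x) (hb t x))
    have key := h.abs_le_of_poisson s (φ := fun x => g s x - g t x) ((mg s).sub (mg t)) (by positivity) hφb
      (by rw [integral_sub (ig s) (ig t)]; simp only [hg]; rw [(hpois s).2, (hpois t).2, sub_zero])
      hψm (by positivity) hψb hψ0 (fun x => by
        rw [integral_sub (igk s s x) (igk t s x)]
        have e1 := (hpois s).1 x
        have e2 := (hpois t).1 x
        simp only [hψ]
        simp only [hg] at e1 e2 ⊢
        rw [e1, e2]; ring) x
    have hx : 0 ≤ V x ^ β := by linarith [h.one_le x]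
    refine key.trans ?_
    have : 0 ≤ M * A * δ * V x ^ β := by positivity
    linarith

end Resolvent

lemma MartApprox.mono_const {Ω : Type*} {m0 : MeasurableSpace Ω} {μ : Measure Ω}
    {F : ℕ → MeasurableSpace Ω} {q K K' : ℝ} {y D u r : ℕ → Ω → ℝ}
    (h : MartApprox μ F q K y D u r) (hK : K ≤ K') : MartApprox μ F q K' y D u r :=
  ⟨h.mono, h.le, h.eq, h.meas_y, h.meas_D, h.meas_u, fun i => (h.bound_y i).mono hK,
    fun i => (h.bound_D i).mono hK, fun i => (h.bound_u i).mono hK,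
    fun i => (h.bound_r i).mono (by gcongr), h.condExp⟩

/-! ### The adaptive chain: conditional expectations, moments, martingale approximation -/

section Chain

set_option linter.unusedSectionVars false

variable {Ω 𝕏 Θ : Type*} [m0 : MeasurableSpace Ω] [MeasurableSpace 𝕏] [MeasurableSpace Θ]
  {Pr : Measure Ω} [IsProbabilityMeasure Pr] {P : Θ → Kernel 𝕏 𝕏} [∀ t, IsMarkovKernel (P t)]
  {π : Measure 𝕏} [IsProbabilityMeasure π] {μ₀ : Measure (𝕏 × Θ)} [IsProbabilityMeasure μ₀]
  {X : ℕ → Ω → 𝕏} {θ : ℕ → Ω → Θ} {V : 𝕏 → ℝ} {η α β : ℝ}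

omit m0 in
lemma history_mono : Monotone (history X θ) := fun _ _ hmn =>
  iSup₂_le fun k hk => le_iSup₂_of_le (f := fun k (_ : k ≤ _) =>
    MeasurableSpace.comap (fun ω => (X k ω, θ k ω)) inferInstance) k (hk.trans hmn) le_rfl

omit m0 in
lemma measurable_pair_history (n : ℕ) :
    Measurable[history X θ n] (fun ω => (X n ω, θ n ω)) := by
  refine Measurable.mono (comap_measurable _) ?_ le_rfl
  exact le_iSup₂_of_le (f := fun k (_ : k ≤ n) =>
    MeasurableSpace.comap (fun ω => (X k ω, θ k ω)) inferInstance) n le_rfl le_rfl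

lemma IsAdaptiveChain.history_le (hX : IsAdaptiveChain Pr P μ₀ X θ) (n : ℕ) :
    history X θ n ≤ m0 :=
  iSup₂_le fun k _ => ((hX.measurable_X k).prodMk (hX.measurable_θ k)).comap_le

lemma IsAdaptiveChain.setLIntegral (hX : IsAdaptiveChain Pr P μ₀ X θ) (n : ℕ) {f : 𝕏 → ℝ≥0∞}
    (hf : Measurable f) {A : Set Ω} (hA : MeasurableSet[history X θ n] A) :
    ∫⁻ ω in A, f (X (n + 1) ω) ∂Pr = ∫⁻ ω in A, ∫⁻ y, f y ∂(P (θ n ω) (X n ω)) ∂Pr := by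
  rw [← setLIntegral_condLExp (hX.history_le n) Pr (fun ω => f (X (n + 1) ω)) hA]
  exact lintegral_congr_ae (ae_restrict_of_ae (hX.markov n f hf))

/-- The Markov property is assumed only for functions of `X_{n+1}`. For a rectangle the event on
`(θ_n, X_n)` can be moved into the conditioning set, and rectangles determine the joint law;
functions of `(θ_n, X_{n+1})` follow. -/
lemma IsAdaptiveChain.setIntegral (hP : ∀ A : Set 𝕏, MeasurableSet A →
    Measurable (fun q : Θ × 𝕏 => P q.1 q.2 A)) (hX : IsAdaptiveChain Pr P μ₀ X θ) (n : ℕ)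
    {g : Θ → 𝕏 → ℝ} (hg : Measurable (Function.uncurry g))
    (hi : Integrable (fun ω => g (θ n ω) (X (n + 1) ω)) Pr)
    {A : Set Ω} (hA : MeasurableSet[history X θ n] A) :
    ∫ ω in A, g (θ n ω) (X (n + 1) ω) ∂Pr
      = ∫ ω in A, ∫ y, g (θ n ω) y ∂(P (θ n ω) (X n ω)) ∂Pr := by
  have hA0 : MeasurableSet A := hX.history_le n A hA
  have hpair : Measurable fun ω => (θ n ω, X n ω) := (hX.measurable_θ n).prodMk (hX.measurable_X n)
  have hpairF : Measurable[history X θ n] fun ω => (θ n ω, X n ω) :=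
    measurable_swap.comp (measurable_pair_history n)
  have htrip : Measurable fun ω => ((θ n ω, X n ω), X (n + 1) ω) :=
    hpair.prodMk (hX.measurable_X (n + 1))
  set K := jointKernel P hP with hK
  have hlaw : (Pr.restrict A).map (fun ω => ((θ n ω, X n ω), X (n + 1) ω))
      = ((Pr.restrict A).map (fun ω => (θ n ω, X n ω))) ⊗ₘ K := by
    have : IsFiniteMeasure ((Pr.restrict A).map (fun ω => ((θ n ω, X n ω), X (n + 1) ω))) :=
      Measure.isFiniteMeasure_map _ _
    refine Measure.ext_prod fun {s t} hs ht => ?_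
    have hs' : MeasurableSet[history X θ n] ((fun ω => (θ n ω, X n ω)) ⁻¹' s ∩ A) :=
      (hpairF hs).inter hA
    rw [Measure.map_apply htrip (hs.prod ht), Measure.compProd_apply_prod hs ht,
      setLIntegral_map hs (K.measurable_coe ht) hpair, Measure.restrict_restrict (hpair hs),
      Measure.restrict_apply (htrip (hs.prod ht))]
    have h1 := hX.setLIntegral n (f := t.indicator 1) (measurable_one.indicator ht) hs'
    have h2 : ∀ ω, ∫⁻ y, t.indicator 1 y ∂(P (θ n ω) (X n ω)) = K (θ n ω, X n ω) t :=
      fun ω => lintegral_indicator_one ht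
    simp only [h2] at h1
    rw [← h1]
    have h3 : (fun ω => t.indicator (1 : 𝕏 → ℝ≥0∞) (X (n + 1) ω))
        = (X (n + 1) ⁻¹' t).indicator 1 := rfl
    rw [h3, lintegral_indicator_one (hX.measurable_X (n + 1) ht),
      Measure.restrict_apply (hX.measurable_X (n + 1) ht)]
    congr 1
    ext ω
    simp only [Set.mem_inter_iff, Set.mem_preimage, Set.mem_prod]
    tauto
  have hψ : Measurable fun q : (Θ × 𝕏) × 𝕏 => g q.1.1 q.2 :=
    hg.comp (measurable_fst.fst.prodMk measurable_snd)
  have h1 : ∫ ω in A, g (θ n ω) (X (n + 1) ω) ∂Pr = ∫ q, g q.1.1 q.2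
      ∂((Pr.restrict A).map (fun ω => ((θ n ω, X n ω), X (n + 1) ω))) :=
    (integral_map htrip.aemeasurable hψ.aestronglyMeasurable).symm
  have h2 : Integrable (fun q : (Θ × 𝕏) × 𝕏 => g q.1.1 q.2)
      ((Pr.restrict A).map (fun ω => ((θ n ω, X n ω), X (n + 1) ω))) :=
    (integrable_map_measure hψ.aestronglyMeasurable htrip.aemeasurable).2 hi.integrableOn
  rw [hlaw] at h1 h2
  rw [h1, Measure.integral_compProd h2]
  have h3 : StronglyMeasurable fun q : Θ × 𝕏 => ∫ y, g q.1 y ∂(K q) :=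
    StronglyMeasurable.integral_kernel_prod_right
      (f := fun (q : Θ × 𝕏) (y : 𝕏) => g q.1 y) hψ.stronglyMeasurable
  exact integral_map hpair.aemeasurable h3.aestronglyMeasurable

lemma IsAdaptiveChain.condExp_eq_zero (hP : ∀ A : Set 𝕏, MeasurableSet A →
    Measurable (fun q : Θ × 𝕏 => P q.1 q.2 A)) (hX : IsAdaptiveChain Pr P μ₀ X θ) (n : ℕ)
    {g u : Θ → 𝕏 → ℝ} (hg : Measurable (Function.uncurry g))
    (hu : ∀ t x, ∫ y, g t y ∂(P t x) = u t x)
    (hi : Integrable (fun ω => g (θ n ω) (X (n + 1) ω)) Pr)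
    (hi' : Integrable (fun ω => u (θ n ω) (X n ω)) Pr) :
    Pr[fun ω => g (θ n ω) (X (n + 1) ω) - u (θ n ω) (X n ω) | history X θ n] =ᵐ[Pr] 0 := by
  refine (ae_eq_condExp_of_forall_setIntegral_eq (hX.history_le n) (hi.sub hi')
    (fun s _ _ => (integrable_zero _ _ _).integrableOn) (fun s hs _ => ?_)
    aestronglyMeasurable_zero).symm
  have h1 := hX.setIntegral hP n hg hi hs
  simp only [hu] at h1
  have h2 : ∫ ω in s, (g (θ n ω) (X (n + 1) ω) - u (θ n ω) (X n ω)) ∂Pr = 0 := by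
    rw [integral_sub hi.integrableOn hi'.integrableOn, h1, sub_self]
  simpa using h2.symm

lemma GeomErgodic.exists_moment_bound (hX : IsAdaptiveChain Pr P μ₀ X θ)
    (hV : GeomErgodic P π μ₀ V) :
    ∃ S : ℝ, 1 ≤ S ∧ ∀ n, ∫⁻ ω, ENNReal.ofReal (V (X n ω)) ∂Pr ≤ ENNReal.ofReal S := by
  obtain ⟨c, lam, hc, hl, hl1, hd⟩ := hV.drift
  have h0 : ∫⁻ ω, ENNReal.ofReal (V (X 0 ω)) ∂Pr < ∞ := by
    have h := hV.initial_moment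
    have hm : Measurable fun z : 𝕏 × Θ => ENNReal.ofReal (V z.1) :=
      (hV.measurable_V.comp measurable_fst).ennreal_ofReal
    rw [← hX.initial, lintegral_map hm ((hX.measurable_X 0).prodMk (hX.measurable_θ 0))] at h
    exact h
  -- `S ≥ c / (1 - λ)` makes `S` stable under `x ↦ λ x + c`.
  set S := max 1 (max (∫⁻ ω, ENNReal.ofReal (V (X 0 ω)) ∂Pr).toReal (c / (1 - lam))) with hS
  have hS1 : 1 ≤ S := le_max_left _ _
  refine ⟨S, hS1, fun n => ?_⟩
  induction n with
  | zero =>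
    rw [← ENNReal.ofReal_toReal h0.ne]
    exact ENNReal.ofReal_le_ofReal ((le_max_left _ _).trans (le_max_right _ _))
  | succ n ih =>
    have h1 := hX.setLIntegral n (f := fun y => ENNReal.ofReal (V y))
      hV.measurable_V.ennreal_ofReal MeasurableSet.univ
    simp only [Measure.restrict_univ] at h1
    have hV0 : ∀ x, 0 ≤ V x := fun x => by linarith [hV.one_le_V x]
    have hVn : Measurable fun ω => V (X n ω) := hV.measurable_V.comp (hX.measurable_X n)
    calc ∫⁻ ω, ENNReal.ofReal (V (X (n + 1) ω)) ∂Pr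
        ≤ ∫⁻ ω, (ENNReal.ofReal lam * ENNReal.ofReal (V (X n ω)) + ENNReal.ofReal c) ∂Pr := by
          rw [h1]
          refine lintegral_mono fun ω => (hd _ _).trans (le_of_eq ?_)
          rw [ENNReal.ofReal_add (mul_nonneg hl.le (hV0 _)) hc.le, ENNReal.ofReal_mul hl.le]
      _ = ENNReal.ofReal lam * ∫⁻ ω, ENNReal.ofReal (V (X n ω)) ∂Pr + ENNReal.ofReal c := by
          rw [lintegral_add_right _ measurable_const,
            lintegral_const_mul _ hVn.ennreal_ofReal]
          simp
      _ ≤ ENNReal.ofReal lam * ENNReal.ofReal S + ENNReal.ofReal c := by gcongr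
      _ = ENNReal.ofReal (lam * S + c) := by
          rw [← ENNReal.ofReal_mul hl.le, ← ENNReal.ofReal_add (by positivity) hc.le]
      _ ≤ ENNReal.ofReal S := by
          refine ENNReal.ofReal_le_ofReal ?_
          have h2 : c / (1 - lam) ≤ S := (le_max_right _ _).trans (le_max_right _ _)
          rw [div_le_iff₀ (by linarith)] at h2
          linarith

/-- `Z^{qb} ≤ Z` because `Z ≥ 1` and `q b ≤ 1`; `S ≥ 1` gives `S ≤ S^q`, so `S` itself bounds the
`L^q`-norm. -/
lemma LpBound.of_moment {q b S : ℝ} (hq : 1 ≤ q) (hb : q * b ≤ 1) (hS : 1 ≤ S)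
    {Z : Ω → ℝ} (hZ : Measurable Z) (hZ1 : ∀ ω, 1 ≤ Z ω)
    (h : ∫⁻ ω, ENNReal.ofReal (Z ω) ∂Pr ≤ ENNReal.ofReal S) :
    LpBound Pr q (fun ω => Z ω ^ b) S := by
  refine .of_lintegral (hZ.pow_const b).aestronglyMeasurable (by linarith) (by linarith) ?_
  refine le_trans (lintegral_mono fun ω => ENNReal.ofReal_le_ofReal ?_)
    (h.trans (ENNReal.ofReal_le_ofReal (Real.self_le_rpow_of_one_le hS hq)))
  have h0 : 0 ≤ Z ω := by linarith [hZ1 ω]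
  rw [abs_of_nonneg (by positivity), ← Real.rpow_mul h0]
  exact Real.rpow_le_self_of_one_le (hZ1 ω) (by linarith)

lemma exists_bound_of_isBigO {f g : ℕ → ℝ} (h : f =O[atTop] g) (hg : ∀ n, 1 ≤ n → 0 < g n) :
    ∃ C : ℝ, 0 < C ∧ ∀ n, 1 ≤ n → |f n| ≤ C * g n := by
  obtain ⟨C, hC, hb⟩ := Asymptotics.bound_of_isBigO_nat_atTop h
  refine ⟨C, hC, fun n hn => ?_⟩
  have := hb (x := n) (hg n hn).ne'
  rwa [Real.norm_eq_abs, Real.norm_of_nonneg (hg n hn).le] at this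

lemma Diminishing.exists_bound (hA : Diminishing Pr P V X θ η α) (hV : ∀ x, 1 ≤ V x)
    (hβ : 0 ≤ β) (hβ1 : β ≤ 1) :
    ∃ C : ℝ, 0 ≤ C ∧ ∀ i : ℕ, ∀ᵐ ω ∂Pr,
      kernelDist P V β (θ (i + 1) ω) (θ i ω)
        ≤ ENNReal.ofReal (C / √((i : ℝ) + 1) * V (X (i + 1) ω) ^ η) := by
  obtain ⟨γ, hγ, -, hO, hb⟩ := hA.bound
  obtain ⟨C, hC⟩ := hb β hβ hβ1
  obtain ⟨C', hC', hγ'⟩ := exists_bound_of_isBigO hO fun n hn =>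
    Real.rpow_pos_of_pos (by exact_mod_cast hn) _
  have hsymm : ∀ s t, kernelDist P V β s t = kernelDist P V β t s := fun s t => by
    simp only [kernelDist, wNorm]
    simp_rw [abs_sub_comm]
  refine ⟨|C| * C', by positivity, fun i => ?_⟩
  filter_upwards [hC (i + 1) (by omega)] with ω hω
  rw [hsymm]
  refine hω.trans (ENNReal.ofReal_le_ofReal ?_)
  have hx : 0 ≤ V (X (i + 1) ω) ^ η := Real.rpow_nonneg (by linarith [hV (X (i + 1) ω)]) _
  refine mul_le_mul_of_nonneg_right ?_ hx
  have hi : (1 : ℝ) ≤ ((i + 1 : ℕ) : ℝ) := by push_cast; linarith [Nat.cast_nonneg (α := ℝ) i]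
  have h1 := hγ' (i + 1) (by omega)
  -- Only the order `i^{-1/2}` is retained from `α > 1/2`.
  have h2 : ((i + 1 : ℕ) : ℝ) ^ (-α) ≤ 1 / √((i : ℝ) + 1) := by
    rw [Real.sqrt_eq_rpow, one_div, ← Real.rpow_neg (by positivity)]
    push_cast at hi ⊢
    exact Real.rpow_le_rpow_of_exponent_le hi (by linarith [hA.lt_α])
  calc C * γ (i + 1) ≤ |C| * |γ (i + 1)| := by rw [← abs_mul]; exact le_abs_self _
    _ ≤ |C| * (C' * (1 / √((i : ℝ) + 1))) := by
        gcongr; exact h1.trans (by gcongr)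
    _ = _ := by ring

/-- The martingale approximation of `f_{θ_i}(X_i)` that comes from the Poisson equation. -/
theorem martApprox_of_poisson (hP : ∀ A : Set 𝕏, MeasurableSet A →
    Measurable (fun q : Θ × 𝕏 => P q.1 q.2 A)) (hX : IsAdaptiveChain Pr P μ₀ X θ)
    (hV : GeomErgodic P π μ₀ V) (hA : Diminishing Pr P V X θ η α) (hβ : 0 < β) (hβ1 : β ≤ 1)
    {f g : Θ → 𝕏 → ℝ} {M M' : ℝ} (hf : IsLipschitzField P π V β M f)
    (hg : IsLipschitzField P π V β M' g) (hfg : ∀ t x, ∫ y, g t y ∂(P t x) = g t x - f t x)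
    {q : ℝ} (hq : 1 ≤ q) (hqβ : q * (β + η) ≤ 1) :
    ∃ K : ℝ, MartApprox Pr (history X θ) q K (fun i ω => f (θ (i + 1) ω) (X (i + 1) ω))
      (fun i ω => g (θ i ω) (X (i + 1) ω) - (g (θ i ω) (X i ω) - f (θ i ω) (X i ω)))
      (fun i ω => g (θ i ω) (X i ω) - f (θ i ω) (X i ω))
      (fun i ω => g (θ (i + 1) ω) (X (i + 1) ω) - g (θ i ω) (X (i + 1) ω)) := by
  obtain ⟨S, hS1, hS⟩ := hV.exists_moment_bound hX
  obtain ⟨C, hC, hd⟩ := hA.exists_bound hV.one_le_V hβ.le hβ1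
  have hM := hf.nonneg
  have hM' := hg.nonneg
  have hη := hA.η_nonneg
  have hV0 : ∀ x, 0 ≤ V x := fun x => by linarith [hV.one_le_V x]
  have hXV : ∀ n, Measurable fun ω => V (X n ω) := fun n =>
    hV.measurable_V.comp (hX.measurable_X n)
  have hWb : ∀ n, LpBound Pr q (fun ω => V (X n ω) ^ β) S := fun n =>
    .of_moment hq (by nlinarith) hS1 (hXV n) (fun ω => hV.one_le_V _) (hS n)
  have hWb' : ∀ n, LpBound Pr q (fun ω => V (X n ω) ^ (β + η)) S := fun n =>
    .of_moment hq hqβ hS1 (hXV n) (fun ω => hV.one_le_V _) (hS n)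
  have hpX : ∀ n, Measurable[history X θ n] fun ω => (θ n ω, X n ω) := fun n =>
    measurable_swap.comp (measurable_pair_history n)
  have hθm : ∀ n, Measurable[history X θ n] (θ n) := fun n => measurable_fst.comp (hpX n)
  have hXm : ∀ n, Measurable[history X θ n] (X n) := fun n => measurable_snd.comp (hpX n)
  have hcross : ∀ n, Measurable[history X θ (n + 1)] fun ω => (θ n ω, X (n + 1) ω) := fun n =>
    ((hθm n).mono (history_mono (Nat.le_succ n)) le_rfl).prodMk (hXm (n + 1))
  have hle := hX.history_le
  have hbound : ∀ (k : Θ → 𝕏 → ℝ) (L : ℝ), 0 ≤ L → Measurable (Function.uncurry k) →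
      (∀ t x, |k t x| ≤ L * V x ^ β) → ∀ m n, LpBound Pr q (fun ω => k (θ m ω) (X n ω)) (L * S) := by
    intro k L hL hk hkb m n
    have h1 := (hWb n).const_mul L
    rw [abs_of_nonneg hL] at h1
    refine h1.mono_ae (hk.comp ((hX.measurable_θ m).prodMk
      (hX.measurable_X n))).aestronglyMeasurable (ae_of_all _ fun ω => ?_)
    exact (hkb _ _).trans (le_abs_self _)
  have bf := hbound f M hM hf.meas hf.bound
  have bg := hbound g M' hM' hg.meas hg.bound
  have bu : ∀ n, LpBound Pr q (fun ω => g (θ n ω) (X n ω) - f (θ n ω) (X n ω))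
      (M' * S + M * S) := fun n => (bg n n).sub hq (bf n n)
  set K := 2 * (M' * S) + M * S + M' * C * S with hK
  have e0 : 0 ≤ M' * S := by positivity
  have e1 : 0 ≤ M * S := by positivity
  have e2 : 0 ≤ M' * C * S := by positivity
  refine ⟨K, history_mono, hle, fun i ω => by ring, fun i => hf.meas.comp (hpX (i + 1)),
    fun i => (hg.meas.comp (hcross i)).sub (((hg.meas.comp (hpX i)).sub
      (hf.meas.comp (hpX i))).mono (history_mono (Nat.le_succ i)) le_rfl),
    fun i => (hg.meas.comp (hpX i)).sub (hf.meas.comp (hpX i)),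
    fun i => (bf _ _).mono (by linarith),
    fun i => ((bg _ _).sub hq (bu i)).mono (by linarith),
    fun i => (bu i).mono (by linarith), fun i => ?_, fun i => ?_⟩
  -- The factor `V^η` of the adaptation bound multiplies the growth `V^β` of `g`; this is where the
  -- moment of order `q (β + η)` is needed.
  · have h1 := (hWb' (i + 1)).const_mul (M' * (C / √((i : ℝ) + 1)))
    rw [abs_of_nonneg (by positivity)] at h1
    refine (h1.mono_ae ?_ ?_).mono ?_
    · exact ((hg.meas.comp ((hpX (i + 1)).mono (hle _) le_rfl)).sub
        (hg.meas.comp ((hcross i).mono (hle _) le_rfl))).aestronglyMeasurable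
    · filter_upwards [hd i] with ω hω
      have hx : 0 ≤ V (X (i + 1) ω) ^ η := Real.rpow_nonneg (hV0 _) _
      have h2 := hg.lipschitz _ _ _ (by positivity) hω (X (i + 1) ω)
      refine h2.trans ((le_of_eq ?_).trans (le_abs_self _))
      rw [Real.rpow_add (by linarith [hV.one_le_V (X (i + 1) ω)])]
      ring
    · rw [show M' * (C / √((i : ℝ) + 1)) * S = M' * C * S / √((i : ℝ) + 1) by ring]
      gcongr
      linarith
  · exact hX.condExp_eq_zero hP i hg.meas hfg ((bg _ _).integrable hq) ((bu i).integrable hq)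

end Chain

/-! ### The three error terms and the conclusion -/

/-- The bias term of the kernel estimator that is due to `w (b) ≠ 1`. -/
def biasTerm {Ω : Type*} (c : ℕ → ℝ) (y u : ℕ → Ω → ℝ) (n : ℕ) (ω : Ω) : ℝ :=
  (n : ℝ)⁻¹ * (2 * (c 1 - 1) * ∑ i ∈ Finset.range n, y i ω * u (i + 1) ω)

/-- The difference between the estimator with known mean and the average of the squared martingale
differences, without the bias term. -/
def fluctuationTerm {Ω : Type*} (c : ℕ → ℝ) (y D u : ℕ → Ω → ℝ) (n : ℕ) (ω : Ω) : ℝ :=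
  (n : ℝ)⁻¹ * (∑ i ∈ Finset.range n, (y i ω ^ 2 - D i ω ^ 2)
    + 2 * ∑ i ∈ Finset.range n, lagSum c y i ω * y i ω
    - 2 * (c 1 - 1) * ∑ i ∈ Finset.range n, y i ω * u (i + 1) ω)

section Bounds

variable {Ω : Type*} {m0 : MeasurableSpace Ω} {μ : Measure Ω} [IsProbabilityMeasure μ]

/-- Since `N ≤ (1 + b 1) / b n`, `√N` turns into `b n ^ (-1/2)` in the fluctuation and `N` into `1 /
b n` in the centring error. -/
theorem decomposition_bounds {w : ℝ → ℝ} (hw : IsLagWindow w) {b : ℕ → ℝ} (hb : IsBandwidth b)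
    {p : ℝ} (hp : 1 < p) {F : ℕ → MeasurableSpace Ω} {K : ℝ}
    {y D u r D' u' r' : ℕ → Ω → ℝ} (H : MartApprox μ F (2 * p) K y D u r)
    (H' : MartApprox μ F (2 * p) K (fun i => u (i + 1)) D' u' r') :
    ∃ C : ℝ, 0 ≤ C ∧ ∀ n : ℕ, 1 ≤ n →
      LpBound μ p (fluctuationTerm (fun k => w (k * b n)) y D u n)
        (C * (b n + (n : ℝ) ^ (-1 + max (1 / 2) (1 / p)) * b n ^ (-(1 / 2) : ℝ))) ∧
      LpBound μ p (biasTerm (fun k => w (k * b n)) y u n) (C * b n) ∧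
      LpBound μ p (centringError (fun k => w (k * b n)) y n)
        (C * ((n : ℝ)⁻¹ * (b n)⁻¹)) := by
  have hp0 : 0 < p := by linarith
  have hK : 0 ≤ K := (H.bound_u 0).nonneg
  set B := b 1 with hB
  have hB0 : 0 < B := hb.pos 1 le_rfl
  obtain ⟨m, hm, hwt⟩ := hw.weights B hB0.le
  obtain ⟨C₁, hC₁, h₁⟩ := quadratic_form_bound hp H H' m hm
  obtain ⟨C₂, hC₂, h₂⟩ := centringError_bound hp H m hm
  refine ⟨C₁ * (√(1 + B) + 1) + 2 * m * (K * K) + C₂ * (1 + B), by positivity, fun n hn => ?_⟩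
  have hbn := hb.pos n hn
  obtain ⟨N, hN1, hN, hc, hc1, hc2, hcv⟩ := hwt (b n) hbn
    (hb.antitone (Set.mem_Ici.2 le_rfl) (Set.mem_Ici.2 hn) hn)
  have hn0 : (0 : ℝ) < n := by exact_mod_cast hn
  have e1 : 0 ≤ C₁ * (√(1 + B) + 1) := by positivity
  have e2 : 0 ≤ 2 * m * (K * K) := by positivity
  have e3 : 0 ≤ C₂ * (1 + B) := by positivity
  refine ⟨?_, ?_, ?_⟩
  · have h := (h₁ (fun k => w (k * b n)) N n (b n) hN1 hn hbn.le hc hc2 hcv).const_mul (n : ℝ)⁻¹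
    refine h.mono ?_
    rw [abs_of_pos (inv_pos.2 hn0)]
    set M := (n : ℝ) ^ max (1 / 2) (1 / p) with hM
    have hM0 : 0 ≤ M := by positivity
    have hs : √(N : ℝ) ≤ √(1 + B) * b n ^ (-(1 / 2) : ℝ) := by
      rw [Real.rpow_neg hbn.le, ← Real.sqrt_eq_rpow, ← Real.sqrt_inv,
        ← Real.sqrt_mul (by positivity)]
      exact Real.sqrt_le_sqrt hN
    have hpow : (n : ℝ) ^ (-1 + max (1 / 2) (1 / p)) = (n : ℝ)⁻¹ * M := by
      rw [Real.rpow_add hn0, Real.rpow_neg_one]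
    rw [hpow]
    set t := b n ^ (-(1 / 2) : ℝ) with ht
    have ht0 : 0 ≤ t := by positivity
    calc (n : ℝ)⁻¹ * (C₁ * (M * √N + n * b n))
        ≤ (n : ℝ)⁻¹ * (C₁ * (M * (√(1 + B) * t) + n * b n)) := by gcongr
      _ = C₁ * √(1 + B) * ((n : ℝ)⁻¹ * M * t) + C₁ * b n := by field_simp
      _ ≤ C₁ * (√(1 + B) + 1) * (b n + (n : ℝ)⁻¹ * M * t) := by
          have k1 : 0 ≤ C₁ * ((n : ℝ)⁻¹ * M * t) := by positivity
          have k2 : 0 ≤ C₁ * √(1 + B) * b n := by positivity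
          linarith
      _ ≤ _ := by
          gcongr
          linarith
  · have h := ((LpBound.sum_range_mul (n := n) hp.le H.bound_y
      (fun i => H.bound_u (i + 1))).const_mul (2 * (w ((1 : ℕ) * b n) - 1))).const_mul (n : ℝ)⁻¹
    refine h.mono ?_
    rw [abs_of_pos (inv_pos.2 hn0), abs_mul, abs_two]
    calc (n : ℝ)⁻¹ * (2 * |w ((1 : ℕ) * b n) - 1| * (n * (K * K)))
        ≤ (n : ℝ)⁻¹ * (2 * (m * b n) * (n * (K * K))) := by gcongr
      _ = 2 * m * (K * K) * b n := by field_simp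
      _ ≤ _ := by
          gcongr
          linarith
  · refine (h₂ (fun k => w (k * b n)) N n hN1 hn hc).mono ?_
    calc C₂ * ((n : ℝ)⁻¹ * N) ≤ C₂ * ((n : ℝ)⁻¹ * ((1 + B) * (b n)⁻¹)) := by gcongr
      _ = C₂ * (1 + B) * ((n : ℝ)⁻¹ * (b n)⁻¹) := by ring
      _ ≤ _ := by
          gcongr
          linarith

end Bounds

lemma measurable_lagSum' {Ω : Type*} [MeasurableSpace Ω] {y : ℕ → Ω → ℝ}
    (hy : ∀ i, Measurable (y i)) (c : ℕ → ℝ) (i : ℕ) : Measurable (lagSum c y i) :=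
  Finset.measurable_fun_sum _ fun j _ => (hy j).const_mul _

lemma measurable_biasTerm {Ω : Type*} [MeasurableSpace Ω] {y u : ℕ → Ω → ℝ}
    (hy : ∀ i, Measurable (y i)) (hu : ∀ i, Measurable (u i)) (c : ℕ → ℝ) (n : ℕ) :
    Measurable (biasTerm c y u n) :=
  ((Finset.measurable_fun_sum _ fun i _ => (hy i).mul (hu (i + 1))).const_mul _).const_mul _

lemma measurable_fluctuationTerm {Ω : Type*} [MeasurableSpace Ω] {y D u : ℕ → Ω → ℝ}
    (hy : ∀ i, Measurable (y i)) (hD : ∀ i, Measurable (D i)) (hu : ∀ i, Measurable (u i))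
    (c : ℕ → ℝ) (n : ℕ) : Measurable (fluctuationTerm c y D u n) := by
  have h1 : Measurable fun ω => ∑ i ∈ Finset.range n, (y i ω ^ 2 - D i ω ^ 2) :=
    Finset.measurable_fun_sum _ fun i _ => ((hy i).pow_const 2).sub ((hD i).pow_const 2)
  have h2 : Measurable fun ω => ∑ i ∈ Finset.range n, lagSum c y i ω * y i ω :=
    Finset.measurable_fun_sum _ fun i _ => (measurable_lagSum' hy c i).mul (hy i)
  have h3 : Measurable fun ω => ∑ i ∈ Finset.range n, y i ω * u (i + 1) ω :=
    Finset.measurable_fun_sum _ fun i _ => (hy i).mul (hu (i + 1))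
  exact ((h1.add (h2.const_mul 2)).sub (h3.const_mul _)).const_mul _

lemma measurable_centringError {Ω : Type*} [MeasurableSpace Ω] {y : ℕ → Ω → ℝ}
    (hy : ∀ i, Measurable (y i)) (c : ℕ → ℝ) (n : ℕ) : Measurable (centringError c y n) := by
  have h0 : ∀ k, Measurable fun ω => ∑ j ∈ Finset.range k, y j ω := fun k =>
    Finset.measurable_fun_sum _ fun j _ => hy j
  have h1 : ∀ k, Measurable (centringTerm y n k) := fun k =>
    (((((h0 n).const_mul _).pow_const 2).const_mul _).sub (((h0 n).const_mul _).mul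
      ((h0 (n - k)).add ((h0 n).sub (h0 k))))).const_mul _
  exact ((Finset.measurable_fun_sum _ fun k _ => (h1 k).const_mul _).const_mul 2).sub
    ((h1 0).const_mul _)

section Final

variable {𝕏 Θ : Type*} [MeasurableSpace 𝕏] [MeasurableSpace Θ] {P : Θ → Kernel 𝕏 𝕏}
  [∀ t, IsMarkovKernel (P t)] {π : Measure 𝕏} [IsProbabilityMeasure π] {W V : 𝕏 → ℝ}
  {ρ C β : ℝ}

/-- `P̄ h = P̄ f` for `f = h - π(h)`, so the two resolvents differ only in their zeroth terms, by
the constant `π(h)`, which cancels in `G`. The Poisson equation rewrites the remaining integral. -/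
lemma UniformlyErgodic.martDiff_eq (hP : ∀ A : Set 𝕏, MeasurableSet A →
    Measurable (fun q : Θ × 𝕏 => P q.1 q.2 A)) (hW : UniformlyErgodic P π W ρ C) {h : 𝕏 → ℝ}
    (hm : Measurable h) {M : ℝ} (hM : 0 ≤ M) (hb : ∀ x, |h x - ∫ z, h z ∂π| ≤ M * W x)
    (hi : Integrable h π) (hik : ∀ t x, Integrable h (P t x)) (t : Θ) (x y : 𝕏) :
    martDiff (P t) π h x y =
      resolvent (P t) π (fun x => h x - ∫ z, h z ∂π) y
        - (resolvent (P t) π (fun x => h x - ∫ z, h z ∂π) x - (h x - ∫ z, h z ∂π)) := by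
  set a := ∫ z, h z ∂π with ha
  set f : 𝕏 → ℝ := fun x => h x - a with hf
  have hfm : Measurable f := hm.sub_const a
  have h0 : ∫ x, f x ∂π = 0 := by
    rw [hf, integral_sub hi (integrable_const _)]; simp [ha]
  have hcent : centred (P t) π h = centred (P t) π f := by
    funext x
    rw [centred, centred, h0, hf, integral_sub (hik t x) (integrable_const _)]
    simp [ha]
  have hres : ∀ y, resolvent (P t) π h y = a + resolvent (P t) π f y := fun y => by
    have hs := hW.summable hfm hM hb h0 t y
    have hs' : Summable fun j => (centred (P t) π)^[j] h y := by
      rw [← summable_nat_add_iff 1] at hs ⊢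
      simpa only [Function.iterate_succ_apply, hcent] using hs
    rw [resolvent, resolvent, hs'.tsum_eq_zero_add, hs.tsum_eq_zero_add]
    simp only [Function.iterate_succ_apply, hcent, Function.iterate_zero, id_eq, hf]
    ring
  have hgm : Measurable (resolvent (P t) π f) := by
    refine measurable_of_tendsto_metrizable (f := fun n x =>
      ∑ j ∈ Finset.range n, (centred (P t) π)^[j] f x) (fun n => Finset.measurable_fun_sum _
        fun j _ => (measurable_centred_iterate (π := π) hP (f := fun _ => f)
          (hfm.comp measurable_snd) j).comp measurable_prodMk_left) ?_
    rw [tendsto_pi_nhds]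
    exact fun x => (hW.summable hfm hM hb h0 t x).hasSum.tendsto_sum_nat
  have hgi : Integrable (resolvent (P t) π f) (P t x) :=
    integrable_of_abs_le_mul (hW.integrable_kernel t x) hgm
      (hW.abs_resolvent_le hfm hM hb h0 t)
  rw [martDiff, hres]
  simp only [hres]
  rw [integral_add (integrable_const _) hgi, (hW.integral_resolvent hP hfm hM hb h0 t).1 x]
  simp [hf]

end Final

end AdaptiveMC

end

theorem theorem4p1
    {Ω 𝕏 Θ : Type*} [MeasurableSpace Ω] [MeasurableSpace 𝕏]
    [MeasurableSpace.CountablyGenerated 𝕏] [MeasurableSpace Θ]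
    (Pr : Measure Ω) [IsProbabilityMeasure Pr]
    (P : Θ → Kernel 𝕏 𝕏) [∀ t, IsMarkovKernel (P t)]
    (hP : ∀ A : Set 𝕏, MeasurableSet A → Measurable (fun q : Θ × 𝕏 => P q.1 q.2 A))
    (π : Measure 𝕏) [IsProbabilityMeasure π]
    (μ₀ : Measure (𝕏 × Θ)) [IsProbabilityMeasure μ₀]
    (X : ℕ → Ω → 𝕏) (θ : ℕ → Ω → Θ)
    (hX : AdaptiveMC.IsAdaptiveChain Pr P μ₀ X θ)
    (V : 𝕏 → ℝ) (hA1 : AdaptiveMC.GeomErgodic P π μ₀ V)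
    (η α : ℝ) (hA2 : AdaptiveMC.Diminishing Pr P V X θ η α)
    (w : ℝ → ℝ) (hA3 : AdaptiveMC.IsLagWindow w)
    (b : ℕ → ℝ) (hb : AdaptiveMC.IsBandwidth b)
    (β : ℝ) (hβ : β ∈ Set.Ioo 0 (1 / 2 - η))
    (h : 𝕏 → ℝ) (hh : AdaptiveMC.MemLW (fun x => V x ^ β) h) :
    (∃ Q D ε : ℕ → Ω → ℝ,
      (∀ n, 1 ≤ n → Measurable (Q n) ∧ Measurable (D n) ∧ Measurable (ε n)) ∧
      (∀ n, 1 ≤ n → ∀ ω, AdaptiveMC.kernelEstimator w b h X n ω =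
        AdaptiveMC.avgSqVar P π h X θ n ω + Q n ω + D n ω + ε n ω) ∧
      ∀ p : ℝ, 1 < p → 2 * p * (β + η) ≤ 1 →
        ∃ C : ℝ, ∀ n : ℕ, 1 ≤ n →
          ∫⁻ ω, ENNReal.ofReal (|Q n ω| ^ p) ∂Pr ≤
            ENNReal.ofReal (C * (b n + (n : ℝ) ^ (-α) * b n ^ (-1 + α)
              + (n : ℝ) ^ (-1 + max (1 / 2) (1 / p)) * b n ^ (-(1 / 2) : ℝ)) ^ p) ∧
          ∫⁻ ω, ENNReal.ofReal (|D n ω| ^ p) ∂Pr ≤ ENNReal.ofReal (C * b n ^ p) ∧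
          ∫⁻ ω, ENNReal.ofReal (|ε n ω| ^ p) ∂Pr ≤
            ENNReal.ofReal (C * ((n : ℝ)⁻¹ * (b n)⁻¹) ^ p)) ∧
    ∀ p : ℝ, 1 < p → 2 * p * (β + η) ≤ 1 →
      Tendsto b atTop (𝓝 0) →
      Tendsto (fun n : ℕ => (n : ℝ) ^ (-1 + max (1 / 2) (1 / p)) * b n ^ (-(1 / 2) : ℝ))
        atTop (𝓝 0) →
      (∀ n, 1 ≤ n → MemLp (fun ω => AdaptiveMC.kernelEstimator w b h X n ω
        - AdaptiveMC.avgSqVar P π h X θ n ω) (ENNReal.ofReal p) Pr) ∧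
      Tendsto (fun n : ℕ => eLpNorm (fun ω => AdaptiveMC.kernelEstimator w b h X n ω
        - AdaptiveMC.avgSqVar P π h X θ n ω) (ENNReal.ofReal p) Pr) atTop (𝓝 0) := by
  open AdaptiveMC in
  obtain ⟨hβ0, hβη⟩ := hβ
  have hη := hA2.η_nonneg
  have hβ1 : β ≤ 1 := by linarith
  obtain ⟨ρ, C, hW⟩ := hA1.uniformlyErgodic hβ0 hβ1
  -- the centred function, its resolvent, and the resolvent of the latter's image
  obtain ⟨hhm, hhn⟩ := hh
  set M₀ := (wNorm (fun x => V x ^ β) h).toReal with hM₀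
  have hM₀0 : 0 ≤ M₀ := ENNReal.toReal_nonneg
  have hhb : ∀ x, |h x| ≤ M₀ * V x ^ β :=
    abs_le_of_wNorm_le hW.one_le hM₀0 (by rw [ENNReal.ofReal_toReal hhn.ne])
  have hhi : Integrable h π := integrable_of_abs_le_mul hW.integrable hhm hhb
  set a := ∫ z, h z ∂π with ha
  have hab : ∀ x, |h x - a| ≤ (M₀ + |a|) * V x ^ β := fun x => by
    have h1 := hW.one_le x
    have h2 : |a| ≤ |a| * V x ^ β := le_mul_of_one_le_right (abs_nonneg _) h1
    linarith [abs_sub (h x) a, hhb x]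
  have hf : IsLipschitzField P π V β (M₀ + |a|) (fun _ x => h x - a) := by
    refine ⟨(hhm.sub_const a).comp measurable_snd, by positivity, fun _ => hab, fun _ => ?_,
      fun s t δ hδ _ x => ?_⟩
    · rw [integral_sub hhi (integrable_const _)]; simp [ha]
    · have h1 := hW.one_le x
      rw [sub_self, abs_zero]
      positivity
  obtain ⟨M₁, hg, hfg⟩ := hf.resolvent hP hW
  set g := fun t => resolvent (P t) π (fun x => h x - a) with hgdef
  -- `P_θ g_θ = g_θ - f` is again a centred Lipschitz field, so `u` has a martingale approximation
  -- of its own.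
  have hf' := hg.sub hW hf
  obtain ⟨M₂, hg', hfg'⟩ := hf'.resolvent hP hW
  have hmart : ∀ q : ℝ, 1 ≤ q → q * (β + η) ≤ 1 → ∃ K, MartApprox Pr (history X θ) q K
      (fun i ω => h (X (i + 1) ω) - a)
      (fun i ω => g (θ i ω) (X (i + 1) ω) - (g (θ i ω) (X i ω) - (h (X i ω) - a)))
      (fun i ω => g (θ i ω) (X i ω) - (h (X i ω) - a))
      (fun i ω => g (θ (i + 1) ω) (X (i + 1) ω) - g (θ i ω) (X (i + 1) ω)) :=
    fun q hq hqβ => martApprox_of_poisson hP hX hA1 hA2 hβ0 hβ1 hf hg hfg hq hqβ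
  have hmart' := fun (q : ℝ) (hq : 1 ≤ q) (hqβ : q * (β + η) ≤ 1) =>
    martApprox_of_poisson hP hX hA1 hA2 hβ0 hβ1 hf' hg' hfg' hq hqβ
  set y : ℕ → Ω → ℝ := fun i ω => h (X (i + 1) ω) - a with hy
  set Δ : ℕ → Ω → ℝ := fun i ω =>
    g (θ i ω) (X (i + 1) ω) - (g (θ i ω) (X i ω) - (h (X i ω) - a)) with hΔ
  set u : ℕ → Ω → ℝ := fun i ω => g (θ i ω) (X i ω) - (h (X i ω) - a) with hu
  set c : ℕ → ℕ → ℝ := fun n k => w (k * b n) with hc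
  -- The exponent `1` is always admissible and serves only for measurability, so the error variables
  -- do not depend on `p`.
  obtain ⟨K₀, H₀⟩ := hmart 1 le_rfl (by linarith)
  have hym : ∀ i, Measurable (y i) := fun i => (H₀.meas_y i).mono (H₀.le _) le_rfl
  have hΔm : ∀ i, Measurable (Δ i) := fun i => (H₀.meas_D i).mono (H₀.le _) le_rfl
  have hum : ∀ i, Measurable (u i) := fun i => (H₀.meas_u i).mono (H₀.le _) le_rfl
  have hdecomp : ∀ n, 1 ≤ n → ∀ ω, kernelEstimator w b h X n ω =
      avgSqVar P π h X θ n ω + fluctuationTerm (c n) y Δ u n ω + biasTerm (c n) y u n ω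
        + centringError (c n) y n ω := by
    intro n hn ω
    have havg : avgSqVar P π h X θ n ω = (n : ℝ)⁻¹ * ∑ i ∈ Finset.range n, Δ i ω ^ 2 := by
      rw [avgSqVar, sum_Icc_one_eq_range]
      congr 1
      refine Finset.sum_congr rfl fun i _ => ?_
      rw [hW.martDiff_eq hP hhm (by positivity) hab hhi
        (fun t x => integrable_of_abs_le_mul (hW.integrable_kernel t x) hhm hhb)]
      rfl
    rw [kernelEstimator_eq w hA3.even b h X a n hn ω, havg, hA3.zero, fluctuationTerm, biasTerm,
      Finset.sum_sub_distrib]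
    ring
  have hbounds : ∀ p : ℝ, 1 < p → 2 * p * (β + η) ≤ 1 → ∃ C : ℝ, 0 ≤ C ∧ ∀ n : ℕ, 1 ≤ n →
      LpBound Pr p (fluctuationTerm (c n) y Δ u n)
        (C * (b n + (n : ℝ) ^ (-1 + max (1 / 2) (1 / p)) * b n ^ (-(1 / 2) : ℝ))) ∧
      LpBound Pr p (biasTerm (c n) y u n) (C * b n) ∧
      LpBound Pr p (centringError (c n) y n) (C * ((n : ℝ)⁻¹ * (b n)⁻¹)) := by
    intro p hp hpβ
    obtain ⟨K₁, H₁⟩ := hmart (2 * p) (by linarith) hpβ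
    obtain ⟨K₂, H₂⟩ := hmart' (2 * p) (by linarith) hpβ
    exact decomposition_bounds hA3 hb hp (H₁.mono_const (le_max_left K₁ K₂))
      (H₂.mono_const (le_max_right K₁ K₂))
  refine ⟨⟨fun n => fluctuationTerm (c n) y Δ u n, fun n => biasTerm (c n) y u n,
    fun n => centringError (c n) y n, fun n _ => ⟨measurable_fluctuationTerm hym hΔm hum _ _,
      measurable_biasTerm hym hum _ _, measurable_centringError hym _ _⟩, hdecomp,
    fun p hp hpβ => ?_⟩, fun p hp hpβ hb0 hr0 => ?_⟩
  · obtain ⟨K, hK, hbd⟩ := hbounds p hp hpβ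
    have hp0 : 0 < p := by linarith
    refine ⟨K ^ p, fun n hn => ?_⟩
    obtain ⟨h1, h2, h3⟩ := hbd n hn
    have hbn := hb.pos n hn
    refine ⟨?_, ?_, ?_⟩
    · refine (h1.lintegral_le hp0).trans (ENNReal.ofReal_le_ofReal ?_)
      rw [← Real.mul_rpow hK (by positivity)]
      refine Real.rpow_le_rpow (by positivity) (mul_le_mul_of_nonneg_left ?_ hK) hp0.le
      -- The term in `α` is pure slack: adaptation remainders of order `i^{-1/2}` already fit into
      -- the last term of the rate.
      have : 0 ≤ (n : ℝ) ^ (-α) * b n ^ (-1 + α) := by positivity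
      linarith
    · have := h2.lintegral_le hp0
      rwa [Real.mul_rpow hK hbn.le] at this
    · have := h3.lintegral_le hp0
      rwa [Real.mul_rpow hK (by positivity)] at this
  · obtain ⟨K, hK, hbd⟩ := hbounds p hp hpβ
    set r : ℕ → ℝ := fun n => (n : ℝ) ^ (-1 + max (1 / 2) (1 / p)) * b n ^ (-(1 / 2) : ℝ) with hr
    have htot : ∀ n, 1 ≤ n → LpBound Pr p (fun ω => kernelEstimator w b h X n ω
        - avgSqVar P π h X θ n ω) (K * (b n + r n) + K * b n + K * (r n * r n)) := by
      intro n hn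
      obtain ⟨h1, h2, h3⟩ := hbd n hn
      have hbn := hb.pos n hn
      have hn1 : (1 : ℝ) ≤ n := by exact_mod_cast hn
      have e : (fun ω => kernelEstimator w b h X n ω - avgSqVar P π h X θ n ω) = fun ω =>
          fluctuationTerm (c n) y Δ u n ω + biasTerm (c n) y u n ω
            + centringError (c n) y n ω := by
        funext ω; rw [hdecomp n hn ω]; ring
      rw [e]
      refine (((h1.add hp.le h2).add hp.le h3)).mono ?_
      refine add_le_add le_rfl (mul_le_mul_of_nonneg_left ?_ hK)
      have h4 : (n : ℝ) ^ (-(1 / 2) : ℝ) * b n ^ (-(1 / 2) : ℝ) ≤ r n := by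
        refine mul_le_mul_of_nonneg_right ?_ (by positivity)
        refine Real.rpow_le_rpow_of_exponent_le hn1 ?_
        linarith [le_max_left (1 / 2) (1 / p)]
      -- `1 / (n b_n)` is the square of `(n b_n)^{-1/2} ≤ r n`, so the centring error vanishes under
      -- the assumed convergence of `r`.
      have h5 : (n : ℝ)⁻¹ * (b n)⁻¹ = ((n : ℝ) ^ (-(1 / 2) : ℝ) * b n ^ (-(1 / 2) : ℝ))
          * ((n : ℝ) ^ (-(1 / 2) : ℝ) * b n ^ (-(1 / 2) : ℝ)) := by
        rw [mul_mul_mul_comm, ← Real.rpow_add (by positivity), ← Real.rpow_add hbn]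
        norm_num [Real.rpow_neg_one]
      rw [h5]
      have h6 : 0 ≤ (n : ℝ) ^ (-(1 / 2) : ℝ) * b n ^ (-(1 / 2) : ℝ) := by positivity
      exact mul_le_mul h4 h4 h6 (h6.trans h4)
    refine ⟨fun n hn => (htot n hn).memLp, ?_⟩
    have hlim : Tendsto (fun n => K * (b n + r n) + K * b n + K * (r n * r n)) atTop (𝓝 0) := by
      simpa using (((hb0.add hr0).const_mul K).add (hb0.const_mul K)).add
        ((hr0.mul hr0).const_mul K)
    have hlim' := ENNReal.tendsto_ofReal hlim
    rw [ENNReal.ofReal_zero] at hlim'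
    refine tendsto_of_tendsto_of_tendsto_of_le_of_le' tendsto_const_nhds hlim'
      (Eventually.of_forall fun _ => zero_le) ?_
    filter_upwards [eventually_ge_atTop 1] with n hn
    exact (htot n hn).le
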